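/- **Setting.** $M$ is a (finite-dimensional, Hausdorff) paracompact smooth manifold, $X$ and $Y$ are smooth manifolds, "bundle" means smooth principal $\mathbb C^\times$-bundle, $\otimes$ is the contracted product and $L^*$ the dual bundle. Fibre products carry the smooth structure induced from the ambient product. A *bundle gerbe* $(P,Y,B)$ consists of a smooth surjection $Y\to B$ admitting local sections, a bundle $P\to Y\times_B Y$ and an associative smooth product $P_{(y_2,y_3)}\otimes P_{(y_1,y_2)}\to P_{(y_1,y_3)}$; write $e(y)\in P_{(y,y)}$ for its identity. A *trivialisation* of it is a bundle $L\to Y$ with an isomorphism $\delta(L)\simeq P$, $\delta(L)_{(y,y')}=L_{y'}\otimes L_y^*$, compatible with the products. A *bundle 2-gerbe* $(Q,Y,X,M)$ consists of a smooth surjection $\pi:X\to M$ admitting local sections; a bundle gerbe $(Q,Y,X^{[2]})$, where $X^{[p]}$ is the $p$-fold fibre product over $M$; a bundle gerbe morphism $(\hat m,m)$ over $X^{[3]}$, i.e. smooth maps $m:Y_{(x_2,x_3)}\times Y_{(x_1,x_2)}\to Y_{(x_1,x_3)}$ and $\hat m: Q_{(y_{23},y_{23}')}\otimes Q_{(y_{12},y_{12}')}\to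 Q_{(m(y_{23},y_{12}),\,m(y_{23}',y_{12}'))}$, the latter commuting with the bundle gerbe products; and an associator section $a$ over $X^{[4]}$ of the bundle $A$ to which $(m_1,m_2)^{-1}Q$ descends, where $m_1=m\circ(m\times 1)$ and $m_2=m\circ(1\times m)$. Equivalently, $a$ is a smooth section $\hat a(y_{34},y_{23},y_{12})\in Q_{(m_1,m_2)}$ satisfying $\hat m(p\otimes\hat m(q\otimes r))\cdot \hat a(y_{34},y_{23},y_{12})=\hat a(y_{34}',y_{23}',y_{12}')\cdot\hat m(\hat m(p\otimes q)\otimes r)$ for $p\in Q_{(y_{34},y_{34}')}$, $q\in Q_{(y_{23},y_{23}')}$, $r\in Q_{(y_{12},y_{12}')}$. The section $a$ is required to satisfy the coherency condition $\delta(a)=1$ over $X^{[5]}$, i.e. $$\hat m(e(y_{45})\otimes\hat a(y_{34},y_{23},y_{12}))\cdot\hat a(y_{45},m(y_{34},y_{23}),y_{12})\cdot\hat m(\hat a(y_{45},y_{34},y_{23})\otimes e(y_{12}))=\hat a(y_{45},y_{34},m(y_{23},y_{12}))\cdot\hat a(m(y_{45},y_{34}),y_{23},y_{12}).$$ **Construction.**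 Let $(Q,Y,X,M)$ be a bundle 2-gerbe. Choose, in turn: 1. an open cover $\{U_i\}_{i\in I}$ of $M$, all of whose nonempty finite intersections are contractible, with smooth sections $s_i:U_i\to X$ of $\pi$; 2. for all $i,j$ a trivialisation $L_{ij}\to Y_{ij}$ of the pullback $(Q_{ij},Y_{ij},U_{ij})$ of $(Q,Y,X^{[2]})$ by $(s_i,s_j):U_{ij}\to X^{[2]}$; 3. for all $i,j,k$ a bundle $L_{ijk}\to U_{ijk}$ to which $L_{jk}\otimes m^{-1}L_{ik}^*\otimes L_{ij}\to Y_{jk}\times_M Y_{ij}$ descends, with respect to the descent isomorphism induced by $\hat m$ and the trivialisations (the isomorphism with the pullback of $L_{ijk}$ being part of the choice); 4. smooth sections $\sigma_{ijk}$ of $L_{ijk}$. The trivialisations and the isomorphisms in 3 induce an isomorphism $L_{jkl}\otimes L_{ikl}^*\otimes L_{ijl}\otimes L_{ijk}^*\simeq A_{ijkl}=(s_i,s_j,s_k,s_l)^{-1}A$ over $U_{ijkl}$: the two ways of computing $L_{kl}\otimes L_{jk}\otimes L_{ij}\otimes m_r^{-1}L_{il}^*$ ($r=1,2$) from 3 give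 $L_{ijl}\otimes L_{jkl}$ and $L_{ijk}\otimes L_{ikl}$, and the quotient $m_2^{-1}L_{il}\otimes m_1^{-1}L_{il}^*$ of the two is $(m_1,m_2)^{-1}Q_{il}$ by 2. Let $a_{ijkl}$ be the pullback of $a$ and define $g_{ijkl}:U_{ijkl}\to\mathbb C^\times$ by $$\sigma_{jkl}\otimes\sigma_{ikl}^*\otimes\sigma_{ijl}\otimes\sigma_{ijk}^*\cdot g_{ijkl}=a_{ijkl}.$$ **Proposition 9.1.** The choices 1–4 can be made successively: a cover with sections as in 1 exists, and each later choice is possible whatever the earlier ones were. They determine well-defined smooth functions $g_{ijkl}$, which satisfy the Čech 3-cocycle condition $$g_{jklm}\,g_{iklm}^{-1}\,g_{ijlm}\,g_{ijkm}^{-1}\,g_{ijkl}=1\quad\text{on }U_{ijklm}.$$ The class of $g$ in $\check H^3(M;\underline{\mathbb C}^\times_M)$ (the direct limit over open covers) is independent of all the choices: of the cover, the $s_i$, the $L_{ij}$, the $L_{ijk}$ and the $\sigma_{ijk}$. Moreover the connecting homomorphism of the exponential sequence $0\to\mathbb Z\to\underline{\mathbb C}_M\to\underline{\mathbb C}^\times_M\to0$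 is a well-defined isomorphism $\check H^3(M;\underline{\mathbb C}^\times_M)\cong H^4(M;\mathbb Z)$, where $H^4(M;\mathbb Z)$ denotes Čech cohomology with coefficients in the constant sheaf $\mathbb Z$. -/

import Mathlib

open scoped Manifold ContDiff Topology

universe u uX uY w

/-! ## Principal bundles with structure group `ℂˣ` -/

section CstarBundle

variable {E : Type*} [NormedAddCommGroup E] [NormedSpace ℝ E] {H : Type*} [TopologicalSpace H]

/-- A smooth principal `ℂˣ`-bundle over a subset `S` of a manifold `N` (for us `S` is an open set
or a fibre product), presented by its fibres, which are `ℂˣ`-torsors, and by an atlas of smooth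
local trivialisations.  An element `f` of `frames` is a local section `f.2`, defined on the
relatively open part `f.1 ∩ S` of `S`; the transition function of two of them is smooth.
As usual with total functions, `Fib` and the local sections are defined on all of `N`, but only
what happens over `S` (resp. `f.1 ∩ S`) is meaningful. -/
structure CstarBundle (I : ModelWithCorners ℝ E H) {N : Type*} [TopologicalSpace N]
    [ChartedSpace H N] (S : Set N) where
  /-- the fibres -/
  Fib : N → Type w
  [torsor : ∀ b, Torsor ℂˣ (Fib b)]
  /-- the local trivialisations -/
  frames : Set (Set N × (∀ b, Fib b))
  frames_nhds : ∀ f ∈ frames, ∀ b ∈ f.1 ∩ S, f.1 ∈ 𝓝[S] b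
  frames_cover : ∀ b ∈ S, ∃ f ∈ frames, b ∈ f.1
  frames_compat : ∀ f ∈ frames, ∀ g ∈ frames,
    ContMDiffOn I 𝓘(ℝ, ℂ) ∞ (fun b => ((f.2 b /ₛ g.2 b : ℂˣ) : ℂ)) (f.1 ∩ g.1 ∩ S)

attribute [instance] CstarBundle.torsor

variable {I : ModelWithCorners ℝ E H} {N : Type*} [TopologicalSpace N] [ChartedSpace H N]
  {S : Set N}

/-- `τ` is a section over `A` of the pullback `c⁻¹ P` of the bundle `P` along a map `c`
(which is smooth on `A` and maps `A` into `S`); this says that `τ` is smooth on `A`. -/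
def CstarBundle.SmoothAlong (P : CstarBundle I S)
    {E' : Type*} [NormedAddCommGroup E'] [NormedSpace ℝ E'] {H' : Type*} [TopologicalSpace H']
    (J : ModelWithCorners ℝ E' H') {K : Type*} [TopologicalSpace K] [ChartedSpace H' K]
    (c : K → N) (τ : ∀ k, P.Fib (c k)) (A : Set K) : Prop :=
  ∀ f ∈ P.frames,
    ContMDiffOn J 𝓘(ℝ, ℂ) ∞ (fun k => ((τ k /ₛ f.2 (c k) : ℂˣ) : ℂ)) (A ∩ c ⁻¹' f.1)

/-- `τ` is a smooth section of `P` over `A ⊆ S`. -/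
def CstarBundle.SmoothOn (P : CstarBundle I S) (τ : ∀ b, P.Fib b) (A : Set N) : Prop :=
  P.SmoothAlong I (fun b => b) τ A

end CstarBundle

/-! ## Bundle gerbes and their trivialisations

A homomorphism of `ℂˣ`-bundles out of a contracted product of bundles and dual bundles is given
as a fibrewise map of several variables which is equivariant in each variable, with weight `1` for
a bundle and weight `-1` for a dual bundle.  Such a map is automatically an isomorphism. -/

section Gerbe

variable {EN : Type*} [NormedAddCommGroup EN] [NormedSpace ℝ EN] {HN : Type*} [TopologicalSpace HN]
  {EY : Type*} [NormedAddCommGroup EY] [NormedSpace ℝ EY] {HY : Type*} [TopologicalSpace HY]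

/-- A bundle gerbe `(P, Y, B)` over a subset `B` of a manifold `N`: a smooth map from `Y` onto `B`
admitting local sections, a `ℂˣ`-bundle `P` on `Y ×_B Y` whose fibre at `(y₁, y₂)` is written
`P_(y₁,y₂)`, and an associative product `P_(y₂,y₃) ⊗ P_(y₁,y₂) → P_(y₁,y₃)`. -/
structure BundleGerbe (IN : ModelWithCorners ℝ EN HN) {N : Type*} [TopologicalSpace N]
    [ChartedSpace HN N] (B : Set N) (IY : ModelWithCorners ℝ EY HY) (Y : Type*)
    [TopologicalSpace Y] [ChartedSpace HY Y] where
  proj : Y → N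
  proj_smooth : ContMDiff IY IN ∞ proj
  proj_mem : ∀ y, proj y ∈ B
  proj_surj : ∀ b ∈ B, ∃ y, proj y = b
  local_sections : ∀ b ∈ B, ∃ V ∈ 𝓝[B] b, ∃ t : N → Y,
    ContMDiffOn IN IY ∞ t (V ∩ B) ∧ ∀ v ∈ V ∩ B, proj (t v) = v
  bundle : CstarBundle.{w} (IY.prod IY) {z : Y × Y | proj z.1 = proj z.2}
  mul : ∀ {y₁ y₂ y₃ : Y}, bundle.Fib (y₂, y₃) → bundle.Fib (y₁, y₂) → bundle.Fib (y₁, y₃)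
  mul_smul : ∀ {y₁ y₂ y₃ : Y}, proj y₁ = proj y₂ → proj y₂ = proj y₃ →
    ∀ (z z' : ℂˣ) (p : bundle.Fib (y₂, y₃)) (q : bundle.Fib (y₁, y₂)),
      mul (z • p) (z' • q) = (z * z') • mul p q
  mul_smooth : ∀ f ∈ bundle.frames, ∀ g ∈ bundle.frames,
    bundle.SmoothAlong (IY.prod (IY.prod IY)) (fun t : Y × Y × Y => (t.1, t.2.2))
      (fun t => mul (f.2 (t.2.1, t.2.2)) (g.2 (t.1, t.2.1)))
      {t | proj t.1 = proj t.2.1 ∧ proj t.2.1 = proj t.2.2 ∧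
        (t.2.1, t.2.2) ∈ f.1 ∧ (t.1, t.2.1) ∈ g.1}
  mul_assoc : ∀ {y₁ y₂ y₃ y₄ : Y}, proj y₁ = proj y₂ → proj y₂ = proj y₃ → proj y₃ = proj y₄ →
    ∀ (p : bundle.Fib (y₃, y₄)) (q : bundle.Fib (y₂, y₃)) (r : bundle.Fib (y₁, y₂)),
      mul p (mul q r) = mul (mul p q) r

variable {IN : ModelWithCorners ℝ EN HN} {N : Type*} [TopologicalSpace N]
    [ChartedSpace HN N] {B : Set N} {IY : ModelWithCorners ℝ EY HY} {Y : Type*}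
    [TopologicalSpace Y] [ChartedSpace HY Y]

/-- The identity `e(y) ∈ P_(y,y)` of a bundle gerbe: if `p · p = z p` then `e(y) = z⁻¹ p`. -/
noncomputable def BundleGerbe.unit (G : BundleGerbe.{w} IN B IY Y) (y : Y) : G.bundle.Fib (y, y) :=
  ((Classical.arbitrary (G.bundle.Fib (y, y))) /ₛ
    (G.mul (Classical.arbitrary (G.bundle.Fib (y, y)))
      (Classical.arbitrary (G.bundle.Fib (y, y)))) : ℂˣ) •
    Classical.arbitrary (G.bundle.Fib (y, y))

/-- A trivialisation of the bundle gerbe obtained from `G` by restriction to `T ⊆ Y`: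
a `ℂˣ`-bundle `L` on `T` with an isomorphism from `δ(L)`, whose fibre at `(y, y')` is
`L_y' ⊗ L_y*`, to `P`, which takes the product `u₃ ⊗ u₂* ⊗ u₂ ⊗ u₁* ↦ u₃ ⊗ u₁*` of `δ(L)` to the
product of `P`. -/
structure BundleGerbe.Trivialisation (G : BundleGerbe.{w} IN B IY Y) (T : Set Y) where
  L : CstarBundle.{w} IY T
  φ : ∀ {y y' : Y}, L.Fib y' → L.Fib y → G.bundle.Fib (y, y')
  φ_smul : ∀ {y y' : Y}, y ∈ T → y' ∈ T → G.proj y = G.proj y' →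
    ∀ (z z' : ℂˣ) (u' : L.Fib y') (u : L.Fib y), φ (z • u') (z' • u) = (z * z'⁻¹) • φ u' u
  φ_smooth : ∀ f ∈ L.frames, ∀ g ∈ L.frames,
    G.bundle.SmoothAlong (IY.prod IY) (fun t : Y × Y => (t.1, t.2))
      (fun t => φ (f.2 t.2) (g.2 t.1))
      {t | t.1 ∈ T ∧ t.2 ∈ T ∧ G.proj t.1 = G.proj t.2 ∧ t.2 ∈ f.1 ∧ t.1 ∈ g.1}
  φ_mul : ∀ {y₁ y₂ y₃ : Y}, y₁ ∈ T → y₂ ∈ T → y₃ ∈ T →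
    G.proj y₁ = G.proj y₂ → G.proj y₂ = G.proj y₃ →
    ∀ (u₃ : L.Fib y₃) (u₂ : L.Fib y₂) (u₁ : L.Fib y₁),
      G.mul (φ u₃ u₂) (φ u₂ u₁) = φ u₃ u₁

end Gerbe

/-! ## Bundle 2-gerbes -/

section TwoGerbe

variable {EM : Type*} [NormedAddCommGroup EM] [NormedSpace ℝ EM] {HM : Type*} [TopologicalSpace HM]
  {EX : Type*} [NormedAddCommGroup EX] [NormedSpace ℝ EX] {HX : Type*} [TopologicalSpace HX]
  {EY : Type*} [NormedAddCommGroup EY] [NormedSpace ℝ EY] {HY : Type*} [TopologicalSpace HY]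

/-- A bundle 2-gerbe `(Q, Y, X, M)`.  Write `Y_(x₁,x₂)` for the fibre of `Y → X ×_M X`; variables
called `y₁₂` are meant to lie in `Y_(x₁,x₂)`, and so on. -/
structure Bundle2Gerbe (IM : ModelWithCorners ℝ EM HM) (M : Type u) [TopologicalSpace M]
    [ChartedSpace HM M] (IX : ModelWithCorners ℝ EX HX) (X : Type uX) [TopologicalSpace X]
    [ChartedSpace HX X] (IY : ModelWithCorners ℝ EY HY) (Y : Type uY) [TopologicalSpace Y]
    [ChartedSpace HY Y] where
  π : X → M
  π_smooth : ContMDiff IX IM ∞ π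
  π_surj : Function.Surjective π
  π_local_sections : ∀ x : M, ∃ V ∈ 𝓝 x, ∃ t : M → X,
    ContMDiffOn IM IX ∞ t V ∧ ∀ v ∈ V, π (t v) = v
  /-- the bundle gerbe `(Q, Y, X ×_M X)` -/
  gerbe : BundleGerbe.{w} (IX.prod IX) {q : X × X | π q.1 = π q.2} IY Y
  /-- The map `m : Y_(x₂,x₃) × Y_(x₁,x₂) → Y_(x₁,x₃)` of total spaces over `X ×_M X ×_M X`. -/
  m : Y → Y → Y
  proj_m : ∀ y₂₃ y₁₂ : Y, (gerbe.proj y₁₂).2 = (gerbe.proj y₂₃).1 →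
    gerbe.proj (m y₂₃ y₁₂) = ((gerbe.proj y₁₂).1, (gerbe.proj y₂₃).2)
  m_smooth : ContMDiffOn (IY.prod IY) IY ∞ (fun z : Y × Y => m z.1 z.2)
    {z | (gerbe.proj z.2).2 = (gerbe.proj z.1).1}
  /-- The bundle map `Q_(y₂₃,y₂₃') ⊗ Q_(y₁₂,y₁₂') → Q_(m(y₂₃,y₁₂),m(y₂₃',y₁₂'))` covering `m`. -/
  mHat : ∀ {y₂₃ y₂₃' y₁₂ y₁₂' : Y}, gerbe.bundle.Fib (y₂₃, y₂₃') → gerbe.bundle.Fib (y₁₂, y₁₂') →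
    gerbe.bundle.Fib (m y₂₃ y₁₂, m y₂₃' y₁₂')
  mHat_smul : ∀ {y₂₃ y₂₃' y₁₂ y₁₂' : Y}, gerbe.proj y₂₃ = gerbe.proj y₂₃' →
    gerbe.proj y₁₂ = gerbe.proj y₁₂' → (gerbe.proj y₁₂).2 = (gerbe.proj y₂₃).1 →
    ∀ (z z' : ℂˣ) (p : gerbe.bundle.Fib (y₂₃, y₂₃')) (q : gerbe.bundle.Fib (y₁₂, y₁₂')),
      mHat (z • p) (z' • q) = (z * z') • mHat p q
  mHat_smooth : ∀ f ∈ gerbe.bundle.frames, ∀ g ∈ gerbe.bundle.frames,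
    gerbe.bundle.SmoothAlong ((IY.prod IY).prod (IY.prod IY))
      (fun t : (Y × Y) × (Y × Y) => (m t.1.1 t.2.1, m t.1.2 t.2.2))
      (fun t => mHat (f.2 (t.1.1, t.1.2)) (g.2 (t.2.1, t.2.2)))
      {t | gerbe.proj t.1.1 = gerbe.proj t.1.2 ∧ gerbe.proj t.2.1 = gerbe.proj t.2.2 ∧
        (gerbe.proj t.2.1).2 = (gerbe.proj t.1.1).1 ∧ t.1 ∈ f.1 ∧ t.2 ∈ g.1}
  /-- `mHat` commutes with the bundle gerbe products. -/
  mHat_mul : ∀ {y₂₃ y₂₃' y₂₃'' y₁₂ y₁₂' y₁₂'' : Y},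
    gerbe.proj y₂₃ = gerbe.proj y₂₃' → gerbe.proj y₂₃' = gerbe.proj y₂₃'' →
    gerbe.proj y₁₂ = gerbe.proj y₁₂' → gerbe.proj y₁₂' = gerbe.proj y₁₂'' →
    (gerbe.proj y₁₂).2 = (gerbe.proj y₂₃).1 →
    ∀ (p' : gerbe.bundle.Fib (y₂₃', y₂₃'')) (p : gerbe.bundle.Fib (y₂₃, y₂₃'))
      (q' : gerbe.bundle.Fib (y₁₂', y₁₂'')) (q : gerbe.bundle.Fib (y₁₂, y₁₂')),
      mHat (gerbe.mul p' p) (gerbe.mul q' q) = gerbe.mul (mHat p' q') (mHat p q)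
  /-- The associator: a section of the bundle `A` on `X ×_M X ×_M X ×_M X` to which the bundle
  `(m₁, m₂)⁻¹ Q` descends, where `m₁ = m ∘ (m × 1)` and `m₂ = m ∘ (1 × m)`.  It is given as a
  section of `(m₁, m₂)⁻¹ Q` which is compatible with the descent isomorphism. -/
  a : ∀ y₃₄ y₂₃ y₁₂ : Y, gerbe.bundle.Fib (m (m y₃₄ y₂₃) y₁₂, m y₃₄ (m y₂₃ y₁₂))
  a_smooth : gerbe.bundle.SmoothAlong (IY.prod (IY.prod IY))
    (fun t : Y × Y × Y => (m (m t.1 t.2.1) t.2.2, m t.1 (m t.2.1 t.2.2)))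
    (fun t => a t.1 t.2.1 t.2.2)
    {t | (gerbe.proj t.2.2).2 = (gerbe.proj t.2.1).1 ∧ (gerbe.proj t.2.1).2 = (gerbe.proj t.1).1}
  a_descent : ∀ {y₃₄ y₃₄' y₂₃ y₂₃' y₁₂ y₁₂' : Y}, gerbe.proj y₃₄ = gerbe.proj y₃₄' →
    gerbe.proj y₂₃ = gerbe.proj y₂₃' → gerbe.proj y₁₂ = gerbe.proj y₁₂' →
    (gerbe.proj y₁₂).2 = (gerbe.proj y₂₃).1 → (gerbe.proj y₂₃).2 = (gerbe.proj y₃₄).1 →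
    ∀ (p : gerbe.bundle.Fib (y₃₄, y₃₄')) (q : gerbe.bundle.Fib (y₂₃, y₂₃'))
      (r : gerbe.bundle.Fib (y₁₂, y₁₂')),
      gerbe.mul (mHat p (mHat q r)) (a y₃₄ y₂₃ y₁₂) =
        gerbe.mul (a y₃₄' y₂₃' y₁₂') (mHat (mHat p q) r)
  /-- The coherency condition `δ(a) = 1` on the five-fold fibre product of `X`. -/
  a_coherent : ∀ y₄₅ y₃₄ y₂₃ y₁₂ : Y, (gerbe.proj y₁₂).2 = (gerbe.proj y₂₃).1 →
    (gerbe.proj y₂₃).2 = (gerbe.proj y₃₄).1 → (gerbe.proj y₃₄).2 = (gerbe.proj y₄₅).1 →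
    gerbe.mul (mHat (gerbe.unit y₄₅) (a y₃₄ y₂₃ y₁₂))
        (gerbe.mul (a y₄₅ (m y₃₄ y₂₃) y₁₂) (mHat (a y₄₅ y₃₄ y₂₃) (gerbe.unit y₁₂))) =
      gerbe.mul (a y₄₅ y₃₄ (m y₂₃ y₁₂)) (a (m y₄₅ y₃₄) y₂₃ y₁₂)

namespace Bundle2Gerbe

variable {IM : ModelWithCorners ℝ EM HM} {M : Type u} [TopologicalSpace M] [ChartedSpace HM M]
  {IX : ModelWithCorners ℝ EX HX} {X : Type uX} [TopologicalSpace X] [ChartedSpace HX X]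
  {IY : ModelWithCorners ℝ EY HY} {Y : Type uY} [TopologicalSpace Y] [ChartedSpace HY Y]

/-- An open cover of `M`, all of whose nonempty finite intersections are contractible, together
with smooth sections of `π : X → M` over its members. -/
structure GoodCover (𝒢 : Bundle2Gerbe.{u, uX, uY, w} IM M IX X IY Y) where
  ι : Type u
  U : ι → Set M
  isOpen : ∀ i, IsOpen (U i)
  cover : ∀ x, ∃ i, x ∈ U i
  good : ∀ (n : ℕ) (i : Fin (n + 1) → ι),
    (⋂ k, U (i k)) = ∅ ∨ ContractibleSpace ↥(⋂ k, U (i k))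
  s : ι → M → X
  s_smooth : ∀ i, ContMDiffOn IM IX ∞ (s i) (U i)
  s_section : ∀ i, ∀ x ∈ U i, 𝒢.π (s i x) = x

variable {𝒢 : Bundle2Gerbe.{u, uX, uY, w} IM M IX X IY Y}

/-- `y` lies in the fibre at `x ∈ U_i ∩ U_j` of the pullback `Y_ij` of `Y` by `(s_i, s_j)`. -/
def GoodCover.Over (c : 𝒢.GoodCover) (i j : c.ι) (x : M) (y : Y) : Prop :=
  x ∈ c.U i ∧ x ∈ c.U j ∧ 𝒢.gerbe.proj y = (c.s i x, c.s j x)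

/-- The total space `Y_ij`, as a subset of `Y`: the point `x` below `y ∈ Y_ij` is
`π (proj y).1`. -/
def GoodCover.YSet (c : 𝒢.GoodCover) (i j : c.ι) : Set Y := {y | ∃ x, c.Over i j x y}

/-- A trivialisation of each of the bundle gerbes `(Q_ij, Y_ij, U_ij)`. -/
abbrev GoodCover.Trivs (c : 𝒢.GoodCover) := ∀ i j, 𝒢.gerbe.Trivialisation (c.YSet i j)

/-- A `ℂˣ`-bundle `L_ijk` on `U_ijk` to which `L_jk ⊗ m⁻¹ L_ik* ⊗ L_ij` descends: the isomorphism
`D` from the latter bundle on `Y_jk ×_M Y_ij` to the pullback of `L_ijk` takes the descent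
isomorphism which comes from `mHat` and from the trivialisations to the identity. -/
structure Descended (c : 𝒢.GoodCover) (t : c.Trivs) (i j k : c.ι) where
  L : CstarBundle.{w} IM (c.U i ∩ c.U j ∩ c.U k)
  D : ∀ (x : M) {y₂₃ y₁₂ : Y}, (t j k).L.Fib y₂₃ → (t i k).L.Fib (𝒢.m y₂₃ y₁₂) →
    (t i j).L.Fib y₁₂ → L.Fib x
  D_smul : ∀ {x : M} {y₂₃ y₁₂ : Y}, c.Over j k x y₂₃ → c.Over i j x y₁₂ →
    ∀ (z z' z'' : ℂˣ) (u : (t j k).L.Fib y₂₃) (v : (t i k).L.Fib (𝒢.m y₂₃ y₁₂))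
      (w : (t i j).L.Fib y₁₂), D x (z • u) (z' • v) (z'' • w) = (z * z'⁻¹ * z'') • D x u v w
  D_smooth : ∀ f ∈ (t j k).L.frames, ∀ g ∈ (t i k).L.frames, ∀ h ∈ (t i j).L.frames,
    L.SmoothAlong (IY.prod IY) (fun z : Y × Y => 𝒢.π (𝒢.gerbe.proj z.2).1)
      (fun z => D (𝒢.π (𝒢.gerbe.proj z.2).1) (f.2 z.1) (g.2 (𝒢.m z.1 z.2)) (h.2 z.2))
      {z | (∃ x, c.Over j k x z.1 ∧ c.Over i j x z.2) ∧
        z.1 ∈ f.1 ∧ 𝒢.m z.1 z.2 ∈ g.1 ∧ z.2 ∈ h.1}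
  D_descent : ∀ {x : M} {y₂₃ y₂₃' y₁₂ y₁₂' : Y}, c.Over j k x y₂₃ → c.Over j k x y₂₃' →
    c.Over i j x y₁₂ → c.Over i j x y₁₂' →
    ∀ (u : (t j k).L.Fib y₂₃) (u' : (t j k).L.Fib y₂₃')
      (v : (t i k).L.Fib (𝒢.m y₂₃ y₁₂)) (v' : (t i k).L.Fib (𝒢.m y₂₃' y₁₂'))
      (w : (t i j).L.Fib y₁₂) (w' : (t i j).L.Fib y₁₂'),
      𝒢.mHat ((t j k).φ u' u) ((t i j).φ w' w) = (t i k).φ v' v → D x u' v' w' = D x u v w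

/-- All the choices that enter the construction of the cocycle: a good cover with local sections
of `π`, trivialisations `L_ij`, descended bundles `L_ijk` and sections `σ_ijk` of these. -/
structure Choices (𝒢 : Bundle2Gerbe.{u, uX, uY, w} IM M IX X IY Y) where
  c : 𝒢.GoodCover
  t : c.Trivs
  d : ∀ i j k, Descended c t i j k
  σ : ∀ i j k x, (d i j k).L.Fib x
  σ_smooth : ∀ i j k, (d i j k).L.SmoothOn (σ i j k) (c.U i ∩ c.U j ∩ c.U k)

/-- `σ_jkl ⊗ σ_ikl* ⊗ σ_ijl ⊗ σ_ijk* · g_ijkl = a_ijkl` on `U_ijkl`.  Here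
`L_jkl ⊗ L_ikl* ⊗ L_ijl ⊗ L_ijk*` is identified with the bundle `A_ijkl` to which
`(m₁, m₂)⁻¹ Q_il` descends in the following way.  Let `y₃₄`, `y₂₃`, `y₁₂` be points of `Y_kl`,
`Y_jk`, `Y_ij` over `x`, with `m₁`, `m₂ ∈ Y_il` their two triple products, and let `u₃₄`, `u₂₃`,
`u₁₂`, `v₂₄`, `v₁₃`, `l₁`, `l₂` be elements of the fibres of `L_kl`, `L_jk`, `L_ij`, `L_jl`,
`L_ik`, `L_il`, `L_il` at `y₃₄`, `y₂₃`, `y₁₂`, `m(y₃₄,y₂₃)`, `m(y₂₃,y₁₂)`, `m₁`, `m₂`. The element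
`l₂ ⊗ l₁*` of `(m₁, m₂)⁻¹ δ(L_il) ≃ (m₁, m₂)⁻¹ Q_il` corresponds to
`(u₃₄ ⊗ v₂₄* ⊗ u₂₃) ⊗ (u₃₄ ⊗ l₂* ⊗ v₁₃)* ⊗ (v₂₄ ⊗ l₁* ⊗ u₁₂) ⊗ (u₂₃ ⊗ v₁₃* ⊗ u₁₂)*`. -/
def Choices.Represents (C : 𝒢.Choices) (g : C.c.ι → C.c.ι → C.c.ι → C.c.ι → M → ℂˣ) : Prop :=
  ∀ (i j k l : C.c.ι) (x : M) (y₃₄ y₂₃ y₁₂ : Y),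
    C.c.Over k l x y₃₄ → C.c.Over j k x y₂₃ → C.c.Over i j x y₁₂ →
    ∀ (u₃₄ : (C.t k l).L.Fib y₃₄) (u₂₃ : (C.t j k).L.Fib y₂₃) (u₁₂ : (C.t i j).L.Fib y₁₂)
      (v₂₄ : (C.t j l).L.Fib (𝒢.m y₃₄ y₂₃)) (v₁₃ : (C.t i k).L.Fib (𝒢.m y₂₃ y₁₂))
      (l₁ : (C.t i l).L.Fib (𝒢.m (𝒢.m y₃₄ y₂₃) y₁₂))
      (l₂ : (C.t i l).L.Fib (𝒢.m y₃₄ (𝒢.m y₂₃ y₁₂))),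
      ((C.d j k l).D x u₃₄ v₂₄ u₂₃ /ₛ C.σ j k l x : ℂˣ) *
          ((C.d i k l).D x u₃₄ l₂ v₁₃ /ₛ C.σ i k l x : ℂˣ)⁻¹ *
          ((C.d i j l).D x v₂₄ l₁ u₁₂ /ₛ C.σ i j l x : ℂˣ) *
          ((C.d i j k).D x u₂₃ v₁₃ u₁₂ /ₛ C.σ i j k x : ℂˣ)⁻¹ *
          (𝒢.a y₃₄ y₂₃ y₁₂ /ₛ (C.t i l).φ l₂ l₁ : ℂˣ) =
        g i j k l x

end Bundle2Gerbe

end TwoGerbe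

/-! ## Čech cohomology -/

section Cech

/-- A sheaf of `A`-valued functions on `M`, given by the subgroups of those functions on `M` which
are sections of the sheaf on `U` (only their values on `U` matter). -/
structure FunctionSheaf (M : Type*) (A : Type*) [AddCommGroup A] where
  sections : Set M → AddSubgroup (M → A)
  mono : ∀ {U V : Set M}, U ⊆ V → sections V ≤ sections U

variable {M : Type u} {A : Type*} [AddCommGroup A]

/-- The Čech differential
`(δg)_{i₀…iₙ₊₁} = ∑ₖ (-1)ᵏ g_{i₀…îₖ…iₙ₊₁}`. -/
def cechD {ι : Type*} {n : ℕ} (g : (Fin (n + 1) → ι) → M → A) : (Fin (n + 2) → ι) → M → A :=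
  fun i x => ∑ k : Fin (n + 2), ((-1 : ℤ) ^ (k : ℕ)) • g (i ∘ k.succAbove) x

theorem cechD_zero {ι : Type*} {n : ℕ} :
    cechD (0 : (Fin (n + 1) → ι) → M → A) = 0 := by
  funext i x; simp [cechD]

theorem cechD_add {ι : Type*} {n : ℕ} (g h : (Fin (n + 1) → ι) → M → A) :
    cechD (g + h) = cechD g + cechD h := by
  funext i x; simp [cechD, smul_add, Finset.sum_add_distrib]

theorem cechD_neg {ι : Type*} {n : ℕ} (g : (Fin (n + 1) → ι) → M → A) :
    cechD (-g) = -cechD g := by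
  funext i x; simp [cechD]

/-- The Čech `n`-cocycles of a cover. -/
def cechCocycles (F : FunctionSheaf M A) {ι : Type*} (U : ι → Set M) (n : ℕ) :
    AddSubgroup ((Fin (n + 1) → ι) → M → A) where
  carrier := {g | (∀ i, g i ∈ F.sections (⋂ k, U (i k))) ∧
    ∀ i, ∀ x ∈ ⋂ k, U (i k), cechD g i x = 0}
  zero_mem' := ⟨fun _ => zero_mem _, fun _ _ _ => by rw [cechD_zero]; rfl⟩
  add_mem' := by
    intro g h hg hh
    refine ⟨fun i => add_mem (hg.1 i) (hh.1 i), fun i x hx => ?_⟩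
    rw [cechD_add, Pi.add_apply, Pi.add_apply, hg.2 i x hx, hh.2 i x hx, add_zero]
  neg_mem' := by
    intro g hg
    refine ⟨fun i => neg_mem (hg.1 i), fun i x hx => ?_⟩
    rw [cechD_neg, Pi.neg_apply, Pi.neg_apply, hg.2 i x hx, neg_zero]

/-- The Čech `n`-coboundaries of a cover (together with the irrelevant cochains which vanish on
all the intersections). -/
def cechBoundaries (F : FunctionSheaf M A) {ι : Type*} (U : ι → Set M) :
    (n : ℕ) → AddSubgroup ((Fin (n + 1) → ι) → M → A)
  | 0 =>
    { carrier := {g | ∀ i, ∀ x ∈ ⋂ k, U (i k), g i x = 0}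
      zero_mem' := fun _ _ _ => rfl
      add_mem' := by
        intro g h hg hh i x hx
        rw [Pi.add_apply, Pi.add_apply, hg i x hx, hh i x hx, add_zero]
      neg_mem' := by
        intro g hg i x hx
        rw [Pi.neg_apply, Pi.neg_apply, hg i x hx, neg_zero] }
  | n + 1 =>
    { carrier := {g | ∃ f : (Fin (n + 1) → ι) → M → A,
        (∀ i, f i ∈ F.sections (⋂ k, U (i k))) ∧ ∀ i, ∀ x ∈ ⋂ k, U (i k), g i x = cechD f i x}
      zero_mem' := ⟨0, fun _ => zero_mem _, fun _ _ _ => by rw [cechD_zero]⟩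
      add_mem' := by
        rintro g h ⟨f, hf, hg⟩ ⟨f', hf', hh⟩
        refine ⟨f + f', fun i => add_mem (hf i) (hf' i), fun i x hx => ?_⟩
        rw [cechD_add, Pi.add_apply, Pi.add_apply, Pi.add_apply, Pi.add_apply, hg i x hx,
          hh i x hx]
      neg_mem' := by
        rintro g ⟨f, hf, hg⟩
        refine ⟨-f, fun i => neg_mem (hf i), fun i x hx => ?_⟩
        rw [cechD_neg, Pi.neg_apply, Pi.neg_apply, Pi.neg_apply, Pi.neg_apply, hg i x hx] }

/-- The Čech cohomology group of a cover. -/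
abbrev CechHCover (F : FunctionSheaf M A) {ι : Type*} (U : ι → Set M) (n : ℕ) : Type _ :=
  cechCocycles F U n ⧸ (cechBoundaries F U n).addSubgroupOf (cechCocycles F U n)

variable (M) in
/-- The open covers of `M` which are indexed by the points of `M`, with `x ∈ U_x`.  Ordered by
`U ≤ V` if `V_x ⊆ U_x` for all `x`, they are cofinal among all covers, and there is a preferred
refinement map. -/
structure PointedCover [TopologicalSpace M] where
  U : M → Set M
  isOpen : ∀ x, IsOpen (U x)
  mem : ∀ x, x ∈ U x

instance [TopologicalSpace M] : Preorder (PointedCover M) where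
  le 𝒰 𝒱 := ∀ x, 𝒱.U x ⊆ 𝒰.U x
  le_refl _ _ := subset_rfl
  le_trans _ _ _ h h' x := (h' x).trans (h x)

variable [TopologicalSpace M]

theorem cechCocycles_mono (F : FunctionSheaf M A) {𝒰 𝒱 : PointedCover M} (h : 𝒰 ≤ 𝒱) (n : ℕ) :
    cechCocycles F 𝒰.U n ≤ cechCocycles F 𝒱.U n := by
  intro g hg
  have hs : ∀ {k : ℕ} (i : Fin k → M), (⋂ l, 𝒱.U (i l)) ⊆ ⋂ l, 𝒰.U (i l) :=
    fun i => Set.iInter_mono fun l => h (i l)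
  exact ⟨fun i => F.mono (hs i) (hg.1 i), fun i x hx => hg.2 i x (hs i hx)⟩

theorem cechBoundaries_mono (F : FunctionSheaf M A) {𝒰 𝒱 : PointedCover M} (h : 𝒰 ≤ 𝒱) (n : ℕ) :
    cechBoundaries F 𝒰.U n ≤ cechBoundaries F 𝒱.U n := by
  have hs : ∀ {k : ℕ} (i : Fin k → M), (⋂ l, 𝒱.U (i l)) ⊆ ⋂ l, 𝒰.U (i l) :=
    fun i => Set.iInter_mono fun l => h (i l)
  cases n with
  | zero => exact fun g hg i x hx => hg i x (hs i hx)
  | succ n =>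
    rintro g ⟨f, hf, hg⟩
    exact ⟨f, fun i => F.mono (hs i) (hf i), fun i x hx => hg i x (hs i hx)⟩

/-- Restriction to a finer cover. -/
def cechRestrict (F : FunctionSheaf M A) (n : ℕ) (𝒰 𝒱 : PointedCover M) (h : 𝒰 ≤ 𝒱) :
    CechHCover F 𝒰.U n →+ CechHCover F 𝒱.U n :=
  QuotientAddGroup.map _ _ (AddSubgroup.inclusion (cechCocycles_mono F h n))
    (fun _ hg => cechBoundaries_mono F h n hg)

open Classical in
/-- Čech cohomology: the direct limit over all open covers. -/
abbrev CechH (F : FunctionSheaf M A) (n : ℕ) : Type _ :=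
  AddCommGroup.DirectLimit (fun 𝒰 : PointedCover M => CechHCover F 𝒰.U n) (cechRestrict F n)

open Classical in
/-- The class in Čech cohomology of a cocycle on a pointed cover. -/
noncomputable def cechClass (F : FunctionSheaf M A) {n : ℕ} (𝒰 : PointedCover M)
    (g : (Fin (n + 1) → M) → M → A) (hg : g ∈ cechCocycles F 𝒰.U n) : CechH F n :=
  AddCommGroup.DirectLimit.of (fun 𝒰 : PointedCover M => CechHCover F 𝒰.U n)
    (cechRestrict F n) 𝒰 (QuotientAddGroup.mk ⟨g, hg⟩)

/-- The pointed cover `x ↦ U_{r(x)}`, a refinement of a given cover `U`. -/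
def PointedCover.ofIndex {ι : Type*} (U : ι → Set M) (hU : ∀ i, IsOpen (U i)) (r : M → ι)
    (hr : ∀ x, x ∈ U (r x)) : PointedCover M where
  U x := U (r x)
  isOpen x := hU (r x)
  mem := hr

/-- Pulling back a cocycle along an index map `r`. -/
theorem cechCocycles_pullback (F : FunctionSheaf M A) {ι : Type*} {U : ι → Set M}
    (hU : ∀ i, IsOpen (U i)) (r : M → ι) (hr : ∀ x, x ∈ U (r x)) {n : ℕ}
    {g : (Fin (n + 1) → ι) → M → A} (hg : g ∈ cechCocycles F U n) :
    (fun i => g (r ∘ i)) ∈ cechCocycles F (PointedCover.ofIndex U hU r hr).U n :=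
  ⟨fun i => hg.1 (r ∘ i), fun i x hx => hg.2 (r ∘ i) x hx⟩

/-- The sheaf of smooth functions with values in `ℂˣ`. -/
def smoothUnits {E : Type*} [NormedAddCommGroup E] [NormedSpace ℝ E] {H : Type*}
    [TopologicalSpace H] (I : ModelWithCorners ℝ E H) (M : Type u) [TopologicalSpace M]
    [ChartedSpace H M] : FunctionSheaf M (Additive ℂˣ) where
  sections U :=
    { carrier := {f | ContMDiffOn I 𝓘(ℝ, ℂ) ∞ (fun x => ((f x).toMul : ℂ)) U}
      zero_mem' := contMDiffOn_const
      add_mem' := by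
        intro f g hf hg
        have h : ContDiff ℝ ∞ (fun p : ℂ × ℂ => p.1 * p.2) := contDiff_fst.mul contDiff_snd
        exact h.contMDiff.comp_contMDiffOn (hf.prodMk_space hg)
      neg_mem' := by
        intro f hf x hx
        have h : ContDiffAt ℝ ∞ (fun z : ℂ => z⁻¹) ((f x).toMul : ℂ) :=
          contDiffAt_inv ℝ (Units.ne_zero _)
        have := h.contMDiffAt.comp_contMDiffWithinAt x (hf x hx)
        exact this.congr (fun y _ => by simp) (by simp) }
  mono h _ hf := ContMDiffOn.mono hf h

/-- The constant sheaf `ℤ`: the locally constant functions with values in `ℤ`. -/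
def constInt (M : Type u) [TopologicalSpace M] : FunctionSheaf M ℤ where
  sections U :=
    { carrier := {f | ContinuousOn f U}
      zero_mem' := continuousOn_const
      add_mem' := fun hf hg => ContinuousOn.add hf hg
      neg_mem' := fun hf => ContinuousOn.neg hf }
  mono h _ hf := ContinuousOn.mono hf h

/-- `e` is the connecting homomorphism `Ȟ³(M; ℂˣ) → Ȟ⁴(M; ℤ)` of the exponential sequence
`0 → ℤ → ℂ → ℂˣ → 0`: if `g = exp(2πi h)` for a cochain `h` of smooth functions with values in `ℂ`,
then the class of `g` goes to the class of `δh`. -/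
def IsConnecting {E : Type*} [NormedAddCommGroup E] [NormedSpace ℝ E] {H : Type*}
    [TopologicalSpace H] (I : ModelWithCorners ℝ E H) [ChartedSpace H M]
    (e : CechH (smoothUnits I M) 3 → CechH (constInt M) 4) : Prop :=
  ∀ (𝒰 : PointedCover M) (g : (Fin 4 → M) → M → Additive ℂˣ)
    (hg : g ∈ cechCocycles (smoothUnits I M) 𝒰.U 3)
    (h : (Fin 4 → M) → M → ℂ) (n : (Fin 5 → M) → M → ℤ) (hn : n ∈ cechCocycles (constInt M) 𝒰.U 4),
    (∀ i, ContMDiffOn I 𝓘(ℝ, ℂ) ∞ (h i) (⋂ k, 𝒰.U (i k))) →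
    (∀ i, ∀ x ∈ ⋂ k, 𝒰.U (i k),
      Complex.exp (2 * Real.pi * Complex.I * h i x) = ((g i x).toMul : ℂ)) →
    (∀ i, ∀ x ∈ ⋂ k, 𝒰.U (i k), (n i x : ℂ) = cechD h i x) →
    e (cechClass (smoothUnits I M) 𝒰 g hg) = cechClass (constInt M) 𝒰 n hn

/-- A family `g_ijkl` as a Čech 3-cochain, written additively. -/
def toCochain {ι : Type*} (g : ι → ι → ι → ι → M → ℂˣ) : (Fin 4 → ι) → M → Additive ℂˣ :=
  fun i x => Additive.ofMul (g (i 0) (i 1) (i 2) (i 3) x)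

end Cech

/-! Everything rests on one vanishing statement: on a contractible manifold, a Čech cocycle of
positive degree with values in nonvanishing smooth functions becomes a coboundary after refinement
(`exists_refinement_boundary`). In degree 1 it turns local frames of a bundle into a section over a
contractible open set (`CstarBundle.exists_smoothAlong`). In degree 2 it corrects isomorphisms
between local sections of a bundle gerbe until they are coherent, and coherent isomorphisms glue to
a trivialisation (`BundleGerbe.nonempty_trivialisation`). These give the choices of the sections and
of the trivialisations. The descended bundles exist by descent alone (`nonempty_descended`), and
good covers come from small coordinate balls that are convex in all of finitely many charts
(`exists_good_refinement`).

The vanishing statement is proved through the exponential sequence. On a good cover a cocycle has a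
logarithm `h`, and the coboundary of `h` is an integral cocycle. Its values are constants on
connected intersections, so it can be read as an Alexander–Spanier cochain, a function of tuples of
nearby points. A contraction, cut into steps so small that each moves a point within one member of
the cover, kills such cochains: consecutive steps are joined by prism operators, and the sum
telescopes (`exists_altD_eq_of_contractible`). A partition of unity then removes what is left in the
sheaf of smooth functions (`cechBoundaries_of_integral`).

For the functions `g`, every ratio of two values of a descent isomorphism is a ratio computed with
`mHat` and the trivialisations (`Descended.D_sdiv_D`). With it, the descent property of the
associator says exactly that `g` does not depend on the points and fibre elements used
(`value_eq_value`), and its coherency says exactly that `g` is a cocycle (`Represents.cocycle`).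

For independence, two sets of choices are placed on two copies of a common good refinement and
completed by arbitrary choices on the mixed intersections (`joinChoices`). The two given cocycles
are then pullbacks of a single cocycle along two refinement maps, which are homotopic
(`cechBoundaries_refine_sub`).

The connecting map is obtained as a relation between classes of `exp(2πi h)` and of `δh`. Logarithms
on good covers make it total, partitions of unity make it surjective, and the same two tools show
that zero corresponds only to zero (`exists_addEquiv_of_rel`). -/

/-! ### Alternating cochains and the prism homotopy -/

section AlternatingSum

variable {X A : Type*} [AddCommGroup A]

/-- The alternating sum of the faces, for cochains on tuples of points of a set. -/
def altD {n : ℕ} (c : (Fin n → X) → A) : (Fin (n + 1) → X) → A :=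
  fun t => ∑ k : Fin (n + 1), ((-1 : ℤ) ^ (k : ℕ)) • c (t ∘ k.succAbove)

/-- Insertion of `x` in the first place. -/
def contr {n : ℕ} (x : X) (c : (Fin (n + 1) → X) → A) : (Fin n → X) → A :=
  fun t => c (Fin.cons x t)

theorem cons_comp_succAbove_zero {n : ℕ} (x : X) (t : Fin n → X) :
    (Fin.cons x t : Fin (n + 1) → X) ∘ (Fin.succAbove 0) = t := by
  funext j; simp

theorem cons_comp_succAbove_succ {n : ℕ} (x : X) (t : Fin (n + 1) → X) (k : Fin (n + 1)) :
    (Fin.cons x t : Fin (n + 2) → X) ∘ (Fin.succAbove k.succ) = Fin.cons x (t ∘ k.succAbove) := by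
  funext j
  refine Fin.cases ?_ (fun j => ?_) j
  · simp
  · simp

/-- The zeroth face forgets `x`, while every other face keeps `x` in front and has its sign shifted
by one. Both `altD_altD` and `altD_prism` are inductions on this recursion, which avoids double
sums. -/
theorem altD_cons {n : ℕ} (c : (Fin (n + 1) → X) → A) (x : X) (t : Fin (n + 1) → X) :
    altD c (Fin.cons x t) = c t - altD (contr x c) t := by
  unfold altD
  rw [Fin.sum_univ_succ, cons_comp_succAbove_zero]
  simp only [cons_comp_succAbove_succ, contr, Fin.val_zero, pow_zero, one_smul, Fin.val_succ,
    pow_succ, mul_neg, mul_one, neg_smul, Finset.sum_neg_distrib, sub_eq_add_neg]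

theorem altD_one (c : (Fin 0 → X) → A) (t : Fin 1 → X) : altD c t = c (fun j => j.elim0) := by
  unfold altD
  rw [Fin.sum_univ_succ]
  simp only [Finset.univ_eq_empty, Finset.sum_empty, Fin.val_zero, pow_zero, one_smul, add_zero]
  exact congrArg c (Subsingleton.elim _ _)

theorem altD_sub {n : ℕ} (c d : (Fin n → X) → A) : altD (c - d) = altD c - altD d := by
  funext t; simp [altD, smul_sub]

theorem altD_add {n : ℕ} (c d : (Fin n → X) → A) : altD (c + d) = altD c + altD d := by
  funext t; simp [altD, smul_add, Finset.sum_add_distrib]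

theorem altD_zero {n : ℕ} : altD (0 : (Fin n → X) → A) = 0 := by
  funext t; simp [altD]

theorem altD_map {B : Type*} [AddCommGroup B] (f : A →+ B) {n : ℕ} (c : (Fin n → X) → A) :
    altD (fun t => f (c t)) = fun t => f (altD c t) := by
  funext t; simp [altD]

theorem contr_altD {n : ℕ} (c : (Fin (n + 1) → X) → A) (x : X) :
    contr x (altD c) = c - altD (contr x c) := by
  funext t; exact altD_cons c x t

theorem altD_altD : ∀ {n : ℕ} (c : (Fin n → X) → A), altD (altD c) = 0
  | 0, c => by
    funext t
    obtain ⟨x, s, rfl⟩ : ∃ x s, t = Fin.cons x s := ⟨t 0, Fin.tail t, by simp⟩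
    rw [altD_cons, altD_one, altD_one, contr, altD_one]; simp
  | n + 1, c => by
    funext t
    obtain ⟨x, s, rfl⟩ : ∃ x s, t = Fin.cons x s := ⟨t 0, Fin.tail t, by simp⟩
    rw [altD_cons, contr_altD, altD_sub, altD_altD]; simp

/-- The prism operator: `∑ₖ (-1)ᵏ c(x₀, …, xₖ, yₖ, …, yₙ₋₁)`. -/
def prism : ∀ {n : ℕ}, ((Fin (n + 1) → X) → A) → (Fin n → X × X) → A
  | 0, _, _ => 0
  | _ + 1, c, e =>
    c (Fin.cons (e 0).1 (fun k => (e k).2)) - prism (contr (e 0).1 c) (Fin.tail e)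

/-- The prism evaluates `c` only on tuples made of entries of `e`. This locality makes the error
term of the homotopy formula vanish for cochains that are cocycles only on small tuples. -/
theorem prism_eq_zero {S : Set X} : ∀ {n : ℕ} (c : (Fin (n + 1) → X) → A)
    (_ : ∀ t, (∀ k, t k ∈ S) → c t = 0) (e : Fin n → X × X)
    (_ : ∀ k, (e k).1 ∈ S ∧ (e k).2 ∈ S), prism c e = 0
  | 0, _, _, _, _ => rfl
  | n + 1, c, hc, e, he => by
    rw [prism, hc, prism_eq_zero (contr (e 0).1 c), sub_zero]
    · intro t ht
      refine hc _ fun k => ?_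
      refine Fin.cases ?_ (fun k => ?_) k
      · simpa using (he 0).1
      · simpa using ht k
    · exact fun k => he _
    · intro k
      refine Fin.cases ?_ (fun k => ?_) k
      · simpa using (he 0).1
      · simpa using (he k).2

theorem prism_cons {n : ℕ} (c : (Fin (n + 2) → X) → A) (x y : X) (s : Fin n → X × X) :
    prism c (Fin.cons (x, y) s) =
      c (Fin.cons x (Fin.cons y fun k => (s k).2)) - prism (contr x c) s := by
  have : (fun k => ((Fin.cons (x, y) s : Fin (n + 1) → X × X) k).2) =
      Fin.cons y (fun k => (s k).2) := by
    funext k; refine Fin.cases ?_ (fun k => ?_) k <;> simp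
  rw [prism, this, Fin.cons_zero, Fin.tail_cons]

theorem prism_sub : ∀ {n : ℕ} (c d : (Fin (n + 1) → X) → A) (e : Fin n → X × X),
    prism (c - d) e = prism c e - prism d e
  | 0, _, _, _ => by simp [prism]
  | n + 1, c, d, e => by
    have : contr (e 0).1 (c - d) = contr (e 0).1 c - contr (e 0).1 d := rfl
    rw [prism, prism, prism, this, prism_sub]; simp only [Pi.sub_apply]; abel

/-- This is the chain homotopy between the two projections of a tuple of pairs. Peeling off the
first pair `(x, y)` reduces it to the same formula for `contr x c`; the terms in `contr y (contr x
c)` cancel. -/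
theorem altD_prism : ∀ {n : ℕ} (c : (Fin (n + 1) → X) → A) (e : Fin (n + 1) → X × X),
    altD (prism c) e + prism (altD c) e = c (fun k => (e k).2) - c (fun k => (e k).1)
  | 0, c, e => by
    have h : prism c = 0 := rfl
    have h1 : ∀ t : Fin 1 → X, t = Fin.cons (t 0) (fun j => j.elim0) := fun t => by
      funext j; rw [Subsingleton.elim j 0]; rfl
    rw [h, altD_zero, prism, prism, altD_cons, altD_one]
    simp only [contr, Pi.zero_apply, zero_add, sub_zero]
    rw [h1 (fun k => (e k).1)]
  | n + 1, c, e => by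
    obtain ⟨⟨x, y⟩, s, rfl⟩ : ∃ x s, e = Fin.cons x s := ⟨e 0, Fin.tail e, by simp⟩
    have ih := altD_prism (contr x c) s
    have e1 : contr (x, y) (prism c) =
        (fun s => contr y (contr x c) fun k => (s k).2) - prism (contr x c) := by
      funext s
      exact prism_cons c x y s
    have e2 : altD (fun s : Fin (n) → X × X => contr y (contr x c) fun k => (s k).2) s =
        altD (contr y (contr x c)) (fun k => (s k).2) := rfl
    have e3 : (fun k => ((Fin.cons (x, y) s : Fin (n + 2) → X × X) k).2) =
        Fin.cons y (fun k => (s k).2) := by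
      funext k; refine Fin.cases ?_ (fun k => ?_) k <;> simp
    have e4 : (fun k => ((Fin.cons (x, y) s : Fin (n + 2) → X × X) k).1) =
        Fin.cons x (fun k => (s k).1) := by
      funext k; refine Fin.cases ?_ (fun k => ?_) k <;> simp
    rw [altD_cons, e1, altD_sub, Pi.sub_apply, e2, prism_cons, e3, e4]
    rw [altD_cons, contr_altD, prism_sub, altD_cons]
    have h1 : c (Fin.cons x fun k => (s k).1) = contr x c (fun k => (s k).1) := rfl
    have h3 : contr x c (fun k => (s k).2) = c (Fin.cons x fun k => (s k).2) := rfl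
    rw [h1]
    rw [h3] at ih
    have : prism (altD (contr x c)) s = c (Fin.cons x fun k => (s k).2) -
      contr x c (fun k => (s k).1) - altD (prism (contr x c)) s := by rw [← ih]; abel
    rw [this, h3]
    abel

/-- An odd number of alternating signs starting with `+` sums to `1`. It allows a cocycle to be
normalised at a constant tuple. -/
theorem altD_const_of_even {n : ℕ} (hn : Even n) (u : A) (t : Fin (n + 1) → X) :
    altD (fun _ : Fin n → X => u) t = u := by
  simp only [altD, ← Finset.sum_smul]
  rw [Fin.sum_univ_eq_sum_range (fun k => (-1 : ℤ) ^ k), neg_one_geom_sum,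
    if_neg (by simpa [Nat.even_add_one] using hn), one_smul]

end AlternatingSum

/-! ### Star refinements, and σ-compactness of connected paracompact spaces -/

section Covers

open Set

variable {X : Type*} [TopologicalSpace X]

/-- In a paracompact Hausdorff space every open cover has a pointed refinement `G` with a strong
star property. -/
theorem exists_star_refinement [T2Space X] [ParacompactSpace X] {ι : Type*} (V : ι → Set X)
    (hV : ∀ i, IsOpen (V i)) (hc : ∀ x, ∃ i, x ∈ V i) :
    ∃ (i : X → ι) (F : X → Finset ι) (G : X → Set X), (∀ x, IsOpen (G x)) ∧ (∀ x, x ∈ G x) ∧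
      (∀ p, ∀ α ∈ F p, p ∈ V α) ∧ (∀ p, ∀ w ∈ G p, i w ∈ F p) := by
  obtain ⟨v, hvo, hvc, hvf, hvV⟩ := precise_refinement V hV (iUnion_eq_univ_iff.2 hc)
  obtain ⟨w, hwc, hwo, hwv⟩ := exists_iUnion_eq_closure_subset hvo
    (fun x => hvf.point_finite x) hvc
  have hwf : LocallyFinite fun i => closure (w i) := hvf.subset hwv
  choose i hi using iUnion_eq_univ_iff.1 hwc
  -- `F p` collects the closed shrunken members through `p`, and `G p` removes all the others. Their
  -- union is closed by local finiteness, so `G p` is open, and a point of `G p` can only be indexed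
  -- by an element of `F p`.
  refine ⟨i, fun p => (hwf.point_finite p).toFinset,
    fun p => (⋃ β ∈ {β | p ∉ closure (w β)}, closure (w β))ᶜ, ?_, ?_, ?_, ?_⟩
  · intro p
    rw [isOpen_compl_iff, biUnion_eq_iUnion]
    exact (hwf.comp_injective Subtype.val_injective).isClosed_iUnion fun _ => isClosed_closure
  · intro p
    simp
  · intro p α hα
    simp only [Finite.mem_toFinset, mem_ofPred_eq] at hα
    exact hvV _ (hwv _ hα)
  · intro p x hx
    simp only [Finite.mem_toFinset, mem_ofPred_eq]
    by_contra h
    refine hx (mem_biUnion (x := i x) h (subset_closure (hi x)))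

/-- Since `F p` is finite, `G p` may be intersected with all the `V α`, `α ∈ F p`. The index `i w`
depends on `w` alone, so all members of `G` through a point `w` lie in one and the same `V (i w)`.
-/
theorem exists_star_refinement' [T2Space X] [ParacompactSpace X] {ι : Type*} (V : ι → Set X)
    (hV : ∀ i, IsOpen (V i)) (hc : ∀ x, ∃ i, x ∈ V i) :
    ∃ (i : X → ι) (G : PointedCover X), ∀ p, ∀ w ∈ G.U p, G.U p ⊆ V (i w) := by
  obtain ⟨i, F, G, hGo, hG, hF, hi⟩ := exists_star_refinement V hV hc
  refine ⟨i, ⟨fun p => G p ∩ ⋂ α ∈ F p, V α, fun p => (hGo p).inter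
    (isOpen_biInter_finset fun _ _ => hV _), fun p => ⟨hG p, ?_⟩⟩, ?_⟩
  · simpa using hF p
  · rintro p w ⟨hw, -⟩ x ⟨-, hx⟩
    simp only [mem_iInter] at hx
    exact hx _ (hi p w hw)

/-- In a locally finite cover by relatively compact open sets, a compact set meets only finitely
many members. Starting from a point and repeatedly adding the closures of all members met gives
compact sets whose union is open and closed, hence everything. -/
theorem sigmaCompactSpace_of_connected [T2Space X] [ParacompactSpace X] [LocallyCompactSpace X]
    [PreconnectedSpace X] : SigmaCompactSpace X := by
  rcases isEmpty_or_nonempty X with hX | ⟨⟨x₀⟩⟩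
  · infer_instance
  choose K hK hKx using fun x : X => exists_compact_mem_nhds x
  obtain ⟨V, hVo, hVc, hVf, hVK⟩ := precise_refinement (fun x => interior (K x))
    (fun _ => isOpen_interior) (iUnion_eq_univ_iff.2 fun x => ⟨x, mem_interior_iff_mem_nhds.2 (hKx x)⟩)
  have hcl : ∀ x, IsCompact (closure (V x)) := fun x =>
    (hK x).of_isClosed_subset isClosed_closure
      (closure_minimal ((hVK x).trans interior_subset) (hK x).isClosed)
  have step : ∀ C : Set X, IsCompact C → ∃ C', IsCompact C' ∧
      ∀ x, (V x ∩ C).Nonempty → V x ⊆ C' := by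
    intro C hC
    have hfin := hVf.finite_nonempty_inter_compact hC
    refine ⟨⋃ x ∈ {x | (V x ∩ C).Nonempty}, closure (V x), hfin.isCompact_biUnion fun x _ => hcl x,
      fun x hx => subset_closure.trans (subset_biUnion_of_mem (u := fun x => closure (V x)) hx)⟩
  choose! N hN1 hN2 using step
  let C : ℕ → Set X := fun n => Nat.rec {x₀} (fun _ C => N C) n
  have hC : ∀ n, IsCompact (C n) := fun n => by
    induction n with
    | zero => exact isCompact_singleton
    | succ n ih => exact hN1 _ ih
  have hCN : ∀ n x, (V x ∩ C n).Nonempty → V x ⊆ C (n + 1) := fun n x => hN2 _ (hC n) x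
  have hmem : ∀ x, ∃ a, x ∈ V a := iUnion_eq_univ_iff.1 hVc
  have hopen : IsOpen (⋃ n, C n) := by
    refine isOpen_iff_mem_nhds.2 fun x hx => ?_
    obtain ⟨n, hn⟩ := mem_iUnion.1 hx
    obtain ⟨a, ha⟩ := hmem x
    exact Filter.mem_of_superset ((hVo a).mem_nhds ha)
      ((hCN n a ⟨x, ha, hn⟩).trans (subset_iUnion C (n + 1)))
  have hclosed : IsClosed (⋃ n, C n) := by
    refine ⟨isOpen_iff_mem_nhds.2 fun x hx => ?_⟩
    obtain ⟨a, ha⟩ := hmem x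
    refine Filter.mem_of_superset ((hVo a).mem_nhds ha) fun y hy hy' => hx ?_
    obtain ⟨n, hn⟩ := mem_iUnion.1 hy'
    exact mem_iUnion.2 ⟨n + 1, hCN n a ⟨y, hy, hn⟩ ha⟩
  have huniv : ⋃ n, C n = univ :=
    IsClopen.eq_univ ⟨hclosed, hopen⟩ ⟨x₀, mem_iUnion.2 ⟨0, rfl⟩⟩
  exact SigmaCompactSpace.of_countable (range C) (countable_range C)
    (by rintro _ ⟨n, rfl⟩; exact hC n) (by simpa using huniv)

end Covers

/-! ### Alexander–Spanier cochains on contractible spaces -/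

section Contractible

open Set Filter

variable {X : Type*} [TopologicalSpace X]

/-- A contraction of `X`, subdivided so finely that consecutive stages of each point lie in a
common member of a given open cover. -/
theorem exists_subdivided_contraction [T2Space X] [ParacompactSpace X] [ContractibleSpace X]
    {ι : Type*} (G : ι → Set X) (hG : ∀ i, IsOpen (G i)) (hc : ∀ x, ∃ i, x ∈ G i) :
    ∃ (y₀ : X) (p : ℕ → X → X), (∀ k, Continuous (p k)) ∧ (∀ x, p 0 x = x) ∧
      (∀ x, ∃ K, ∀ᶠ x' in 𝓝 x, ∀ k ≥ K, p k x' = y₀) ∧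
      ∀ k x, ∃ a, p k x ∈ G a ∧ p (k + 1) x ∈ G a := by
  obtain ⟨y₀, ⟨H⟩⟩ := id_nullhomotopic X
  -- Clamping the time lets a step run past `1` without a case distinction; from time `1` on the
  -- point rests at `y₀`.
  let h : X → ℝ → X := fun x s => H (projIcc 0 1 zero_le_one s, x)
  have hcont : Continuous (fun z : X × ℝ => h z.1 z.2) := by
    refine H.continuous.comp ?_
    exact ((continuous_projIcc).comp continuous_snd).prodMk continuous_fst
  have h0 : ∀ x, h x 0 = x := fun x => by simp [h]
  have h1 : ∀ x, ∀ s ≥ (1 : ℝ), h x s = y₀ := fun x s hs => by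
    simp only [h, projIcc_of_right_le zero_le_one hs]
    simp
  -- One step length is good for all points near `x₀`: steps of length at most `ε`, begun at any
  -- time in `[0, 1]`, stay in one member of the cover. Near a given time this is continuity at step
  -- length `0`; compactness of `[0, 1]` makes it uniform in time.
  have loc : ∀ x₀ : X, ∃ ε : ℝ, ∀ᶠ x in 𝓝 x₀, ε ∈ {ε : ℝ | 0 < ε ∧ ∀ δ, 0 < δ → δ ≤ ε →
      ∀ s ∈ Icc (0 : ℝ) 1, ∃ a, h x s ∈ G a ∧ h x (s + δ) ∈ G a} := by
    intro x₀
    have key : ∀ s ∈ Icc (0 : ℝ) 1, ∀ᶠ z : (X × ℝ) × ℝ in 𝓝 ((x₀, (0 : ℝ)), s),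
        ∃ a, h z.1.1 z.2 ∈ G a ∧ h z.1.1 (z.2 + z.1.2) ∈ G a := by
      intro s _
      obtain ⟨a, ha⟩ := hc (h x₀ s)
      have c1 : Continuous fun z : (X × ℝ) × ℝ => h z.1.1 z.2 :=
        hcont.comp (continuous_fst.fst.prodMk continuous_snd)
      have c2 : Continuous fun z : (X × ℝ) × ℝ => h z.1.1 (z.2 + z.1.2) :=
        hcont.comp (continuous_fst.fst.prodMk (continuous_snd.add continuous_fst.snd))
      have e1 := c1.continuousAt.preimage_mem_nhds (x := ((x₀, (0 : ℝ)), s))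
        ((hG a).mem_nhds (by simpa using ha))
      have e2 := c2.continuousAt.preimage_mem_nhds (x := ((x₀, (0 : ℝ)), s))
        ((hG a).mem_nhds (by simpa using ha))
      filter_upwards [e1, e2] with z hz1 hz2
      exact ⟨a, hz1, hz2⟩
    have := isCompact_Icc.eventually_forall_of_forall_eventually
      (P := fun (z : X × ℝ) (s : ℝ) => ∃ a, h z.1 s ∈ G a ∧ h z.1 (s + z.2) ∈ G a) key
    rw [nhds_prod_eq, eventually_prod_iff] at this
    obtain ⟨pa, hpa, pb, hpb, hp⟩ := this
    obtain ⟨ε, hε, hball⟩ := Metric.eventually_nhds_iff.1 hpb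
    refine ⟨ε / 2, hpa.mono fun x hx => ⟨by positivity, fun δ hδ hδε s hs => ?_⟩⟩
    exact hp hx (hball (by rw [Real.dist_0_eq_abs, abs_of_pos hδ]; linarith)) s hs
  -- The good step lengths at a point form an order-connected, hence convex, set of reals. The
  -- locally constant choices can therefore be averaged to a continuous step length.
  obtain ⟨ε, hε⟩ := exists_continuous_forall_mem_convex_of_local_const (fun x => by
    refine Set.OrdConnected.convex ⟨?_⟩
    rintro a ⟨ha, -⟩ b ⟨-, hb⟩ c ⟨hac, hcb⟩
    exact ⟨ha.trans_le hac, fun δ h1 h2 => hb δ h1 (h2.trans hcb)⟩) loc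
  refine ⟨y₀, fun k x => h x (k * ε x), fun k => ?_, fun x => by simpa using h0 x, fun x => ?_,
    fun k x => ?_⟩
  · exact hcont.comp (continuous_id.prodMk (continuous_const.mul ε.continuous))
  · obtain ⟨K, hK⟩ := exists_nat_gt (1 / ε x)
    have hpos := (hε x).1
    have hK' : 1 < K * ε x := by rwa [div_lt_iff₀ hpos] at hK
    have : ∀ᶠ x' in 𝓝 x, 1 < K * ε x' :=
      (continuous_const.mul ε.continuous).continuousAt.eventually (lt_mem_nhds hK')
    refine ⟨K, this.mono fun x' hx' k hk => h1 _ _ ?_⟩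
    refine hx'.le.trans (mul_le_mul_of_nonneg_right (by exact_mod_cast hk) (hε x').1.le)
  · have hpos := (hε x).1
    rcases le_or_gt ((k : ℝ) * ε x) 1 with hk | hk
    · obtain ⟨a, ha⟩ := (hε x).2 _ hpos le_rfl (k * ε x) ⟨by positivity, hk⟩
      refine ⟨a, ha.1, ?_⟩
      push_cast
      rw [add_mul, one_mul]
      exact ha.2
    · obtain ⟨a, ha⟩ := hc y₀
      have hk' : ((k + 1 : ℕ) : ℝ) * ε x ≥ 1 := by push_cast; rw [add_mul, one_mul]; linarith
      exact ⟨a, by simpa only [h1 x _ hk.le] using ha, by simpa only [h1 x _ hk'] using ha⟩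

/-- The Alexander–Spanier cohomology of a contractible paracompact space vanishes in positive
degrees. -/
theorem exists_altD_eq_of_contractible [T2Space X] [ParacompactSpace X] [ContractibleSpace X]
    {A : Type*} [AddCommGroup A] (G : PointedCover X) {n : ℕ} (c : (Fin (n + 2) → X) → A)
    (hc : ∀ a, ∀ t, (∀ k, t k ∈ G.U a) → altD c t = 0) :
    ∃ (G' : PointedCover X) (b : (Fin (n + 1) → X) → A),
      ∀ a, ∀ t, (∀ k, t k ∈ G'.U a) → altD b t = c t := by
  obtain ⟨y₀, p, hp, hp0, hpK, hps⟩ := exists_subdivided_contraction G.U G.isOpen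
    fun x => ⟨x, G.mem x⟩
  -- The telescoping sum ends at the value of `c` on the constant tuple, so this must be zero. For
  -- `n + 1` even, subtract the coboundary of a constant cochain; for `n + 1` odd, the cocycle
  -- condition at the constant tuple already forces it.
  wlog hy : c (fun _ => y₀) = 0 generalizing c
  · rcases Nat.even_or_odd (n + 1) with hn | hn
    · obtain ⟨G', b, hb⟩ := this (c - altD fun _ => c fun _ => y₀) (by
        intro a t ht; rw [altD_sub, altD_altD, sub_zero, hc a t ht])
        (by rw [Pi.sub_apply, altD_const_of_even hn, sub_self])
      refine ⟨G', b + fun _ => c fun _ => y₀, fun a t ht => ?_⟩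
      rw [altD_add, Pi.add_apply, hb a t ht, Pi.sub_apply, sub_add_cancel]
    · refine absurd ?_ hy
      have h := hc y₀ (fun _ => y₀) (fun _ => G.mem y₀)
      have e : altD c (fun _ => y₀) = altD (fun _ : Fin (n + 2) → X => c fun _ => y₀)
          (fun _ => y₀) := rfl
      exact (altD_const_of_even (n := n + 2) hn.add_one _ _).symm.trans (e.symm.trans h)
  choose K hK using hpK
  choose a ha ha' using hps
  -- Near `x` only the finitely many stages below `K x` matter, and each of these steps stays in a
  -- member `G.U (a k x)` that does not depend on the nearby point.
  let S : X → Set X := fun x => {x' | (∀ k ≥ K x, p k x' = y₀) ∧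
    ∀ k < K x, p k x' ∈ G.U (a k x) ∧ p (k + 1) x' ∈ G.U (a k x)}
  have hS : ∀ x, S x ∈ 𝓝 x := by
    intro x
    refine inter_mem (hK x) ?_
    have : ∀ k ∈ Finset.range (K x), ∀ᶠ x' in 𝓝 x,
        p k x' ∈ G.U (a k x) ∧ p (k + 1) x' ∈ G.U (a k x) := fun k _ =>
      ((hp k).continuousAt.eventually ((G.isOpen _).mem_nhds (ha k x))).and
        ((hp (k + 1)).continuousAt.eventually ((G.isOpen _).mem_nhds (ha' k x)))
    have := (Filter.eventually_all_finset (Finset.range (K x))).2 this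
    filter_upwards [this] with x' hx' k hk using hx' k (Finset.mem_range.2 hk)
  let P : ℕ → (Fin (n + 1) → X) → A := fun k t =>
    prism c fun j => (p k (t j), p (k + 1) (t j))
  have hP : ∀ x t, (∀ j, t j ∈ S x) → ∀ k ≥ K x, P k t = 0 := by
    intro x t ht k hk
    refine prism_eq_zero (S := {y₀}) c (fun s hs => ?_) _ fun j => ⟨(ht j).1 k hk,
      (ht j).1 (k + 1) (by omega)⟩
    rw [show s = fun _ => y₀ from funext hs, hy]
  -- The number of nonzero prisms is only locally bounded, hence the `finsum`. The sum of their
  -- coboundaries telescopes to the final value minus the initial one, that is to `0 - c t`, which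
  -- explains the sign.
  refine ⟨⟨fun x => interior (S x), fun _ => isOpen_interior, fun x =>
    mem_interior_iff_mem_nhds.2 (hS x)⟩, fun t => -∑ᶠ k, P k t, fun x t ht => ?_⟩
  replace ht : ∀ j, t j ∈ S x := fun j => interior_subset (ht j)
  have hfin : ∀ s : Fin (n + 1) → X, (∀ j, s j ∈ S x) →
      ∑ᶠ k, P k s = ∑ k ∈ Finset.range (K x), P k s := by
    intro s hs
    refine finsum_eq_sum_of_support_subset _ fun k hk => ?_
    simp only [Finset.coe_range, mem_Iio]
    by_contra h
    exact hk (hP x s hs k (not_lt.1 h))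
  have e1 : altD (fun t => -∑ᶠ k, P k t) t = -∑ k ∈ Finset.range (K x), altD (P k) t := by
    simp only [altD]
    rw [Finset.sum_comm, ← Finset.sum_neg_distrib]
    refine Finset.sum_congr rfl fun j _ => ?_
    rw [hfin (t ∘ j.succAbove) fun i => ht _, smul_neg, Finset.smul_sum]
  have e2 : ∀ k ∈ Finset.range (K x), altD (P k) t =
      c (fun j => p (k + 1) (t j)) - c (fun j => p k (t j)) := by
    intro k hk
    have h := altD_prism c (fun j => (p k (t j), p (k + 1) (t j)))
    rw [prism_eq_zero (S := G.U (a k x)) (altD c) (fun s hs => hc _ s hs) _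
      fun j => (ht j).2 k (Finset.mem_range.1 hk), add_zero] at h
    exact h
  rw [e1, Finset.sum_congr rfl e2, Finset.sum_range_sub (fun k => c fun j => p k (t j))]
  have e3 : (fun j => p (K x) (t j)) = fun _ => y₀ := funext fun j => (ht j).1 _ le_rfl
  rw [e3, hy]
  simp [hp0]

end Contractible

/-! ### Smooth partitions of unity on paracompact manifolds -/

section PartitionOfUnity

open Set Filter TopologicalSpace

theorem sigmaCompactSpace_component (E : Type*) [NormedAddCommGroup E] [NormedSpace ℝ E]
    [FiniteDimensional ℝ E] {M : Type*} [TopologicalSpace M] [T2Space M] [ParacompactSpace M]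
    [ChartedSpace E M] (C : Opens M) {x : M}
    (hC : (C : Set M) = connectedComponent x) : SigmaCompactSpace C := by
  have : LocallyCompactSpace C := ChartedSpace.locallyCompactSpace E C
  have : PreconnectedSpace C := by
    refine Subtype.preconnectedSpace ?_
    have : (C : Set M) = connectedComponent x := hC
    exact this ▸ isPreconnected_connectedComponent
  have hcl : IsClosed (C : Set M) := hC ▸ isClosed_connectedComponent
  have : ParacompactSpace C := hcl.isClosedEmbedding_subtypeVal.paracompactSpace
  exact sigmaCompactSpace_of_connected

/-- An open subset of a paracompact space need not be paracompact, so the argument goes through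
second countability. A connected open set lies in one component, which is σ-compact and therefore
second countable, and this passes to subsets. -/
theorem sigmaCompactSpace_of_isPreconnected (E : Type*) [NormedAddCommGroup E] [NormedSpace ℝ E]
    [FiniteDimensional ℝ E] {M : Type*} [TopologicalSpace M] [T2Space M] [ParacompactSpace M]
    [ChartedSpace E M] (U : Opens M) (hU : IsPreconnected (U : Set M)) :
    SigmaCompactSpace U := by
  rcases isEmpty_or_nonempty U with h | ⟨⟨x, hx⟩⟩
  · infer_instance
  have := ChartedSpace.locallyConnectedSpace E M
  let C : Opens M := ⟨connectedComponent x, isOpen_connectedComponent⟩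
  have := sigmaCompactSpace_component E C rfl
  have := ChartedSpace.secondCountable_of_sigmaCompact E C
  have hUC : U ≤ C := hU.subset_connectedComponent hx
  have : SecondCountableTopology U :=
    (Topology.IsEmbedding.inclusion hUC).secondCountableTopology
  have : LocallyCompactSpace U := ChartedSpace.locallyCompactSpace E U
  infer_instance

theorem paracompactSpace_of_isPreconnected (E : Type*) [NormedAddCommGroup E] [NormedSpace ℝ E]
    [FiniteDimensional ℝ E] {M : Type*} [TopologicalSpace M] [T2Space M] [ParacompactSpace M]
    [ChartedSpace E M] (U : Opens M) (hU : IsPreconnected (U : Set M)) :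
    ParacompactSpace U := by
  have := sigmaCompactSpace_of_isPreconnected E U hU
  have : LocallyCompactSpace U := ChartedSpace.locallyCompactSpace E U
  infer_instance

variable {E : Type*} [NormedAddCommGroup E] [NormedSpace ℝ E] [FiniteDimensional ℝ E]
  {M : Type*} [TopologicalSpace M] [T2Space M] [ParacompactSpace M] [ChartedSpace E M]
  [IsManifold 𝓘(ℝ, E) ∞ M]

/-- The components are open and σ-compact, so the smooth Urysohn lemma holds on each of them, and
functions given on the components glue to a smooth function. -/
theorem exists_contMDiff_urysohn {s t : Set M} (hs : IsClosed s) (ht : IsClosed t)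
    (hd : Disjoint s t) : ∃ f : M → ℝ, ContMDiff 𝓘(ℝ, E) 𝓘(ℝ, ℝ) ∞ f ∧ EqOn f 0 s ∧ EqOn f 1 t ∧
      ∀ x, f x ∈ Icc (0 : ℝ) 1 := by
  have := ChartedSpace.locallyConnectedSpace E M
  have key : ∀ C : Set M, (∃ x, C = connectedComponent x) → ∃ f : M → ℝ,
      (∀ x ∈ C, ContMDiffAt 𝓘(ℝ, E) 𝓘(ℝ, ℝ) ∞ f x) ∧ (∀ x ∈ C, x ∈ s → f x = 0) ∧
      (∀ x ∈ C, x ∈ t → f x = 1) ∧ ∀ x ∈ C, f x ∈ Icc (0 : ℝ) 1 := by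
    rintro C ⟨x₀, hC⟩
    let D : Opens M := ⟨C, hC ▸ isOpen_connectedComponent⟩
    have := sigmaCompactSpace_component E D hC
    obtain ⟨f, hf0, hf1, hf⟩ := exists_contMDiffMap_zero_one_of_isClosed 𝓘(ℝ, E) (n := ⊤) (M := D)
      (hs.preimage continuous_subtype_val) (ht.preimage continuous_subtype_val)
      (hd.preimage _)
    classical
    let g : M → ℝ := fun x => if h : x ∈ C then f ⟨x, h⟩ else 0
    have hg : ∀ x : D, g x = f x := fun x => dif_pos x.2
    refine ⟨g, fun x hx => ?_, fun x hx hxs => ?_, fun x hx hxt => ?_, fun x hx => ?_⟩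
    · refine (contMDiffAt_subtype_iff (U := D) (x := ⟨x, hx⟩)).1 ?_
      have : (fun x : D => g x) = f := funext hg
      rw [this]
      exact f.contMDiff _
    · rw [hg ⟨x, hx⟩]; exact hf0 hxs
    · rw [hg ⟨x, hx⟩]; exact hf1 hxt
    · rw [hg ⟨x, hx⟩]; exact hf _
  choose! F h1 h2 h3 h4 using key
  have hm : ∀ x : M, x ∈ connectedComponent x := fun x => mem_connectedComponent
  refine ⟨fun x => F (connectedComponent x) x, fun x => ?_, fun x hx => h2 _ ⟨x, rfl⟩ x (hm x) hx,
    fun x hx => h3 _ ⟨x, rfl⟩ x (hm x) hx, fun x => h4 _ ⟨x, rfl⟩ x (hm x)⟩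
  refine (h1 _ ⟨x, rfl⟩ x (hm x)).congr_of_eventuallyEq ?_
  filter_upwards [isOpen_connectedComponent.mem_nhds (hm x)] with y hy
  rw [connectedComponent_eq hy]

-- A bump covering built from smooth Urysohn functions yields a smooth partition of unity; no
-- countability of the set of components is involved.
variable (E) in
theorem exists_smoothPartitionOfUnity {ι : Type*} (V : ι → Set M) (hV : ∀ i, IsOpen (V i))
    (hc : ∀ x, ∃ i, x ∈ V i) :
    ∃ ρ : SmoothPartitionOfUnity ι 𝓘(ℝ, E) M univ, ρ.IsSubordinate V := by
  obtain ⟨f, hf, hfV⟩ := BumpCovering.exists_isSubordinate_of_prop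
    (fun f : M → ℝ => ContMDiff 𝓘(ℝ, E) 𝓘(ℝ, ℝ) ∞ f) (fun s t hs ht hd => by
      obtain ⟨f, hf, h⟩ := exists_contMDiff_urysohn (E := E) hs ht hd
      exact ⟨⟨f, hf.continuous⟩, hf, h⟩) isClosed_univ V hV fun x _ => mem_iUnion.2 (hc x)
  exact ⟨_, hfV.toSmoothPartitionOfUnity hf⟩

end PartitionOfUnity

/-! ### Good covers -/

section GoodCovers

open Set Filter

/-- The square of the norm of a `C²` immersion is convex near a zero of the immersion. -/
theorem exists_convexOn_norm_sq {E F : Type*} [NormedAddCommGroup E] [NormedSpace ℝ E]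
    [FiniteDimensional ℝ E] [NormedAddCommGroup F] [InnerProductSpace ℝ F] {T : E → F} {v₀ : E}
    (hT : ContDiffAt ℝ 2 T v₀) (h0 : T v₀ = 0) (hinj : Function.Injective (fderiv ℝ T v₀)) :
    ∃ R > 0, ∀ r ≤ R, ConvexOn ℝ (Metric.ball v₀ r) fun v => ‖T v‖ ^ 2 := by
  -- `G` is half the derivative of `‖T‖²`. Because `T v₀ = 0`, the term with the second derivative
  -- of `T` drops out of the derivative of `G` at `v₀`, which leaves the form `d ↦ ⟪T' d, T' ·⟫`.
  let G : E → E →L[ℝ] ℝ := fun v => (innerSL ℝ (T v)).comp (fderiv ℝ T v)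
  have hT1 : ContDiffAt ℝ 1 (fderiv ℝ T) v₀ := hT.fderiv_right (by norm_num)
  have hd1 : HasStrictFDerivAt (fderiv ℝ T) (fderiv ℝ (fderiv ℝ T) v₀) v₀ :=
    hT1.hasStrictFDerivAt one_ne_zero
  have hd0 : HasStrictFDerivAt T (fderiv ℝ T v₀) v₀ := hT.hasStrictFDerivAt two_ne_zero
  have hdi : HasStrictFDerivAt (fun v => innerSL ℝ (T v))
      ((innerSL ℝ : F →L[ℝ] F →L[ℝ] ℝ).comp (fderiv ℝ T v₀)) v₀ :=
    ((innerSL ℝ : F →L[ℝ] F →L[ℝ] ℝ).hasStrictFDerivAt).comp v₀ hd0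
  have hG := hdi.clm_comp hd1
  obtain ⟨K, hK, hanti⟩ := LinearMap.exists_antilipschitzWith (fderiv ℝ T v₀).toLinearMap
    (LinearMap.ker_eq_bot.2 hinj)
  have hK' : ∀ d, ‖d‖ ≤ K * ‖fderiv ℝ T v₀ d‖ := fun d => by
    simpa using hanti.le_mul_dist d 0
  have hKpos : (0 : ℝ) < K := by exact_mod_cast hK
  have hsmall := hG.isLittleO.def (c := 1 / (K : ℝ) ^ 2) (by positivity)
  -- Injectivity of `T'` bounds `‖T' d‖²` below by `‖d‖² / K²`, and strict differentiability makes
  -- the error of the linear approximation at most that. So the derivative of `‖T‖²` is monotone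
  -- near `v₀`.
  have hmono : ∀ᶠ p : E × E in 𝓝 (v₀, v₀), 0 ≤ (G p.1 - G p.2) (p.1 - p.2) := by
    filter_upwards [hsmall] with p hp
    set d := p.1 - p.2 with hd
    have h1 := (ContinuousLinearMap.le_opNorm _ d).trans (mul_le_mul_of_nonneg_right hp (norm_nonneg d))
    have h2 := (abs_le.1 ((Real.norm_eq_abs _).symm.le.trans h1)).1
    have h3 : ‖d‖ ^ 2 ≤ K ^ 2 * ‖fderiv ℝ T v₀ d‖ ^ 2 := by
      rw [← mul_pow]; exact pow_le_pow_left₀ (norm_nonneg _) (hK' d) 2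
    have h4 : 1 / (K : ℝ) ^ 2 * ‖d‖ * ‖d‖ ≤ ‖fderiv ℝ T v₀ d‖ ^ 2 := by
      rw [mul_assoc, ← pow_two, div_mul_eq_mul_div, one_mul, div_le_iff₀ (by positivity)]
      linarith
    simp only [sub_apply, add_apply,
      ContinuousLinearMap.comp_apply, ContinuousLinearMap.compL_apply, h0, map_zero,
      zero_apply, ContinuousLinearMap.flip_apply, innerSL_apply_apply,
      real_inner_self_eq_norm_sq] at h2
    simp only [G, sub_apply, 
      ContinuousLinearMap.comp_apply, innerSL_apply_apply]
    linarith
  have hdiff : ∀ᶠ v in 𝓝 v₀, DifferentiableAt ℝ T v :=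
    (hT.eventually (by simp)).mono fun v hv => hv.differentiableAt two_ne_zero
  obtain ⟨R₁, hR₁, h1⟩ := Metric.eventually_nhds_iff.1 hdiff
  obtain ⟨R₂, hR₂, h2⟩ := Metric.eventually_nhds_iff.1 hmono
  refine ⟨min R₁ R₂, lt_min hR₁ hR₂, fun r hr => ⟨convex_ball _ _, ?_⟩⟩
  intro x hx y hy a b ha hb hab
  let z : ℝ → E := fun t => x + t • (y - x)
  have hz : ∀ t ∈ Icc (0 : ℝ) 1, z t ∈ Metric.ball v₀ r := fun t ht =>
    (convex_ball v₀ r).add_smul_sub_mem hx hy ht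
  have hzd : ∀ t, HasDerivAt z (y - x) t := fun t => by
    have := ((hasDerivAt_id t).smul_const (y - x)).const_add x
    rwa [one_smul] at this
  have hder : ∀ t ∈ Icc (0 : ℝ) 1, HasDerivAt (fun t => ‖T (z t)‖ ^ 2) (2 * G (z t) (y - x)) t := by
    intro t ht
    have hd := (h1 ((Metric.mem_ball.1 (hz t ht)).trans_le (hr.trans (min_le_left _ _)))).hasFDerivAt
    have := (hd.comp_hasDerivAt t (hzd t)).norm_sq
    simpa [G] using this
  -- Convexity is checked along the segment from `x` to `y`, where monotonicity of `G` says that the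
  -- one-variable derivative increases.
  have hconv : ConvexOn ℝ (Icc (0 : ℝ) 1) fun t => ‖T (z t)‖ ^ 2 := by
    refine MonotoneOn.convexOn_of_deriv (convex_Icc 0 1)
      (fun t ht => (hder t ht).continuousAt.continuousWithinAt)
      (fun t ht => (hder t (interior_subset ht)).differentiableAt.differentiableWithinAt) ?_
    intro s hs t ht hst
    replace hs := interior_subset hs
    replace ht := interior_subset ht
    rw [(hder s hs).deriv, (hder t ht).deriv]
    have hbs := (Metric.mem_ball.1 (hz s hs)).trans_le (hr.trans (min_le_right _ _))
    have hbt := (Metric.mem_ball.1 (hz t ht)).trans_le (hr.trans (min_le_right _ _))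
    have := h2 (y := (z t, z s)) (by rw [Prod.dist_eq]; exact max_lt hbt hbs)
    simp only at this
    have e : z t - z s = (t - s) • (y - x) := by simp only [z]; module
    rw [e, map_smul, smul_eq_mul, sub_apply] at this
    rcases hst.eq_or_lt with rfl | hlt
    · exact le_rfl
    · have := nonneg_of_mul_nonneg_right this (sub_pos.2 hlt)
      linarith
  have := hconv.2 (x := 0) (by simp) (y := 1) (by simp) ha hb hab
  have e1 : z (a • 0 + b • 1) = a • x + b • y := by
    obtain rfl : a = 1 - b := by linarith
    simp only [z, smul_eq_mul]; simp; module
  have e0 : z 0 = x := by simp [z]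
  have e2 : z 1 = y := by simp [z]
  simpa only [e1, e0, e2] using this

variable (E : Type*) [NormedAddCommGroup E] [NormedSpace ℝ E] [FiniteDimensional ℝ E]
  {M : Type*} [TopologicalSpace M] [ChartedSpace E M] [IsManifold 𝓘(ℝ, E) ∞ M]

/-- Small coordinate balls are convex in any finite number of other charts. -/
theorem exists_nhds_convex_in_charts (p : M) (F : Finset M)
    (hF : ∀ α ∈ F, p ∈ (chartAt E α).source) {O : Set M} (hO : O ∈ 𝓝 p) :
    ∃ B, IsOpen B ∧ p ∈ B ∧ B ⊆ O ∧
      ∀ α ∈ F, B ⊆ (chartAt E α).source ∧ Convex ℝ (chartAt E α '' B) := by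
  let e := toEuclidean (E := E)
  let φ := chartAt E p
  have hp : p ∈ φ.source := mem_chart_source E p
  -- The balls are taken for a Euclidean norm, since the squared norm of `E` itself need not be
  -- smooth.
  let D : ℝ → Set E := fun ε => {v | ‖e v - e (φ p)‖ < ε}
  have hDo : ∀ ε, IsOpen (D ε) := fun ε =>
    isOpen_lt (e.continuous.sub continuous_const).norm continuous_const
  let B : ℝ → Set M := fun ε => φ.source ∩ φ ⁻¹' D ε
  have hB : ∀ O ∈ 𝓝 p, ∀ᶠ ε in 𝓝[>] (0 : ℝ), B ε ⊆ O := by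
    intro O hO
    have h1 : φ.symm ⁻¹' O ∈ 𝓝 (φ p) :=
      (φ.continuousAt_symm (φ.map_source hp)).preimage_mem_nhds (by rwa [φ.left_inv hp])
    rw [e.toHomeomorph.isInducing.nhds_eq_comap] at h1
    obtain ⟨δ, hδ, h⟩ := ((Metric.nhds_basis_ball (x := e (φ p))).comap e).mem_iff.1 h1
    filter_upwards [Ioo_mem_nhdsGT hδ] with ε hε x hx
    have : φ.symm (φ x) ∈ O := h (by
      rw [mem_preimage, Metric.mem_ball, dist_eq_norm]
      exact lt_trans hx.2 hε.2)
    rwa [φ.left_inv hx.1] at this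
  have hconv : ∀ α ∈ F, ∀ᶠ ε in 𝓝[>] (0 : ℝ),
      B ε ⊆ (chartAt E α).source ∧ Convex ℝ (chartAt E α '' B ε) := by
    intro α hα
    let ψ := chartAt E α
    have hpψ : p ∈ ψ.source := hF α hα
    have hτ : ContDiffAt ℝ ∞ (fun v => φ (ψ.symm v)) (ψ p) := by
      have h2 : ContMDiffAt 𝓘(ℝ, E) 𝓘(ℝ, E) ∞ ψ.symm (ψ p) :=
        (contMDiffOn_chart_symm (I := 𝓘(ℝ, E)) (x := α)).contMDiffAt
          (ψ.open_target.mem_nhds (ψ.map_source hpψ))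
      have h1 : ContMDiffAt 𝓘(ℝ, E) 𝓘(ℝ, E) ∞ φ (ψ.symm (ψ p)) := by
        rw [ψ.left_inv hpψ]
        exact (contMDiffOn_chart (I := 𝓘(ℝ, E)) (x := p)).contMDiffAt
          (φ.open_source.mem_nhds hp)
      exact (h1.comp _ h2).contDiffAt
    have hτ' : ContDiffAt ℝ ∞ (fun v => ψ (φ.symm v)) (φ p) := by
      have h2 : ContMDiffAt 𝓘(ℝ, E) 𝓘(ℝ, E) ∞ φ.symm (φ p) :=
        (contMDiffOn_chart_symm (I := 𝓘(ℝ, E)) (x := p)).contMDiffAt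
          (φ.open_target.mem_nhds (φ.map_source hp))
      have h1 : ContMDiffAt 𝓘(ℝ, E) 𝓘(ℝ, E) ∞ ψ (φ.symm (φ p)) := by
        rw [φ.left_inv hp]
        exact (contMDiffOn_chart (I := 𝓘(ℝ, E)) (x := α)).contMDiffAt
          (ψ.open_source.mem_nhds hpψ)
      exact (h1.comp _ h2).contDiffAt
    have hsymm : ContinuousAt ψ.symm (ψ p) := ψ.continuousAt_symm (ψ.map_source hpψ)
    have hev : ∀ᶠ v in 𝓝 (ψ p), v ∈ ψ.target ∧ ψ.symm v ∈ φ.source :=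
      Filter.Eventually.and (ψ.open_target.mem_nhds (ψ.map_source hpψ))
        (hsymm.preimage_mem_nhds (φ.open_source.mem_nhds (by rwa [ψ.left_inv hpψ])))
    let T : E → EuclideanSpace ℝ (Fin (Module.finrank ℝ E)) :=
      fun v => e (φ (ψ.symm v)) - e (φ p)
    have hTc : ContDiffAt ℝ 2 T (ψ p) :=
      (((e.contDiff.contDiffAt).comp _ hτ).sub contDiffAt_const).of_le
        ENat.LEInfty.out
    have hT0 : T (ψ p) = 0 := by simp only [T, ψ.left_inv hpψ, sub_self]
    -- The transition map in the other direction is a left inverse near `ψ p`; the chain rule passes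
    -- this on to the derivatives.
    have hinj : Function.Injective (fderiv ℝ T (ψ p)) := by
      have d1 : HasFDerivAt (fun v => φ (ψ.symm v)) (fderiv ℝ (fun v => φ (ψ.symm v)) (ψ p)) (ψ p) :=
        (hτ.differentiableAt (by simp)).hasFDerivAt
      have e1 : φ (ψ.symm (ψ p)) = φ p := by rw [ψ.left_inv hpψ]
      have d2 : HasFDerivAt (fun v => ψ (φ.symm v)) (fderiv ℝ (fun v => ψ (φ.symm v)) (φ p))
          (φ (ψ.symm (ψ p))) := by
        rw [e1]; exact (hτ'.differentiableAt (by simp)).hasFDerivAt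
      have d3 := d2.comp (ψ p) d1
      have d4 : HasFDerivAt (fun v : E => v) (ContinuousLinearMap.id ℝ E) (ψ p) := hasFDerivAt_id _
      have d5 := (d3.congr_of_eventuallyEq (f₁ := fun v => v) (by
        filter_upwards [hev] with v hv
        simp only [Function.comp]
        rw [φ.left_inv hv.2, ψ.right_inv hv.1])).unique d4
      have dT : HasFDerivAt T (e.toContinuousLinearMap.comp
          (fderiv ℝ (fun v => φ (ψ.symm v)) (ψ p))) (ψ p) :=
        (e.toContinuousLinearMap.hasFDerivAt.comp (ψ p) d1).sub_const _
      rw [dT.fderiv]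
      refine e.injective.comp fun v w hvw => ?_
      have := congrArg (fderiv ℝ (fun v => ψ (φ.symm v)) (φ p)) hvw
      have h5 : ∀ v, fderiv ℝ (fun v => ψ (φ.symm v)) (φ p)
        (fderiv ℝ (fun v => φ (ψ.symm v)) (ψ p) v) = v := fun v => DFunLike.congr_fun d5 v
      exact (h5 v).symm.trans (this.trans (h5 w))
    obtain ⟨R, hR, hRc⟩ := exists_convexOn_norm_sq hTc hT0 hinj
    obtain ⟨R', hR', hball⟩ := Metric.eventually_nhds_iff_ball.1 hev
    set r := min R R'
    have hr : 0 < r := lt_min hR hR'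
    have hN : ψ.source ∩ ψ ⁻¹' Metric.ball (ψ p) r ∈ 𝓝 p :=
      inter_mem (ψ.open_source.mem_nhds hpψ)
        ((ψ.continuousAt hpψ).preimage_mem_nhds (Metric.ball_mem_nhds _ hr))
    filter_upwards [hB _ hN, self_mem_nhdsWithin] with ε hε hε0
    refine ⟨hε.trans inter_subset_left, ?_⟩
    -- Seen in the chart `ψ`, the coordinate ball is a sublevel set of the convex function `‖T‖²`.
    have himg : ψ '' B ε = {v | v ∈ Metric.ball (ψ p) r ∧ ‖T v‖ ^ 2 < ε ^ 2} := by
      ext v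
      constructor
      · rintro ⟨x, hx, rfl⟩
        refine ⟨(hε hx).2, ?_⟩
        have : ‖e (φ x) - e (φ p)‖ < ε := hx.2
        simp only [T, ψ.left_inv (hε hx).1]
        exact pow_lt_pow_left₀ this (norm_nonneg _) two_ne_zero
      · rintro ⟨hv, hvT⟩
        have hv' := hball v (Metric.ball_subset_ball (min_le_right _ _) hv)
        refine ⟨ψ.symm v, ⟨hv'.2, ?_⟩, ψ.right_inv hv'.1⟩
        exact lt_of_pow_lt_pow_left₀ 2 (le_of_lt hε0) hvT
    rw [show chartAt E α = ψ from rfl, himg]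
    exact (hRc r (min_le_left _ _)).convex_lt _
  have hall := ((Filter.eventually_all_finset F).2 hconv).and
    ((hB O hO).and (self_mem_nhdsWithin : ∀ᶠ ε in 𝓝[>] (0 : ℝ), 0 < ε))
  obtain ⟨ε, h1, h2, h3⟩ := hall.exists
  refine ⟨B ε, φ.isOpen_inter_preimage (hDo ε), ⟨hp, ?_⟩, h2, h1⟩
  simpa [D] using h3

/-- All nonempty finite intersections of members of the family are contractible. -/
def IsGoodFamily {ι : Type*} (U : ι → Set M) : Prop :=
  ∀ (n : ℕ) (i : Fin (n + 1) → ι), (⋂ k, U (i k)) = ∅ ∨ ContractibleSpace ↥(⋂ k, U (i k))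

/-- Intersections of convex sets are convex only within a common chart. A star refinement of the
chart domains attaches a finite set `F p` of charts to each `p`, and `B p` is made convex in all of
them. If `w` lies in several members, the chart indexed by `i w` belongs to each of their finite
sets, so their intersection is convex in that chart and hence contractible. -/
theorem exists_good_refinement (E : Type*) [NormedAddCommGroup E] [NormedSpace ℝ E]
    [FiniteDimensional ℝ E] {M : Type*} [TopologicalSpace M] [T2Space M] [ParacompactSpace M]
    [ChartedSpace E M] [IsManifold 𝓘(ℝ, E) ∞ M] {ι : Type*} (V : ι → Set M)
    (hV : ∀ i, IsOpen (V i)) (hc : ∀ x, ∃ i, x ∈ V i) :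
    ∃ (𝒲 : PointedCover M) (r : M → ι), (∀ x, 𝒲.U x ⊆ V (r x)) ∧ IsGoodFamily 𝒲.U := by
  choose r hr using hc
  obtain ⟨i, F, G, hGo, hG, hF, hi⟩ := exists_star_refinement
    (fun x : M => (chartAt E x).source) (fun x => (chartAt E x).open_source)
    (fun x => ⟨x, mem_chart_source E x⟩)
  choose B hBo hpB hBO hB using fun p => exists_nhds_convex_in_charts E p (F p) (hF p)
    (inter_mem ((hGo p).mem_nhds (hG p)) ((hV (r p)).mem_nhds (hr p)))
  refine ⟨⟨B, hBo, hpB⟩, r, fun x => (hBO x).trans inter_subset_right, fun n j => ?_⟩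
  rcases eq_empty_or_nonempty (⋂ k, B (j k)) with h | ⟨w, hw⟩
  · exact Or.inl h
  right
  have hw' : ∀ k, w ∈ B (j k) := mem_iInter.1 hw
  have hk : ∀ k, i w ∈ F (j k) := fun k => hi _ w (hBO _ (hw' k)).1
  set ψ := chartAt E (i w)
  have hsub : (⋂ k, B (j k)) ⊆ ψ.source := (iInter_subset _ 0).trans (hB _ _ (hk 0)).1
  have himg : ψ '' (⋂ k, B (j k)) = ⋂ k, ψ '' B (j k) :=
    InjOn.image_iInter_eq (ψ.injOn.mono (iUnion_subset fun k => (hB _ _ (hk k)).1))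
  have hconv : Convex ℝ (ψ '' (⋂ k, B (j k))) := by
    rw [himg]; exact convex_iInter fun k => (hB _ _ (hk k)).2
  have := hconv.contractibleSpace ⟨_, mem_image_of_mem _ hw⟩
  exact (ψ.homeomorphOfImageSubsetSource hsub rfl).contractibleSpace

end GoodCovers

/-! ### The exponential map and smooth logarithms -/

section ExponentialSequence

open Set Filter

/-- The exponential map `z ↦ exp (2πi z)`. -/
noncomputable def expUnits : ℂ →+ Additive ℂˣ where
  toFun z := Additive.ofMul
    (Units.mk0 (Complex.exp (2 * Real.pi * Complex.I * z)) (Complex.exp_ne_zero _))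
  map_zero' := by
    apply Additive.toMul.injective
    ext
    simp
  map_add' z w := by
    apply Additive.toMul.injective
    ext
    simp [mul_add, Complex.exp_add]

theorem coe_expUnits (z : ℂ) :
    (((expUnits z).toMul : ℂˣ) : ℂ) = Complex.exp (2 * Real.pi * Complex.I * z) := rfl

theorem expUnits_eq_iff (z : ℂ) (a : Additive ℂˣ) :
    expUnits z = a ↔ Complex.exp (2 * Real.pi * Complex.I * z) = ((a.toMul : ℂˣ) : ℂ) := by
  rw [← coe_expUnits, Units.val_inj]
  exact Additive.toMul.injective.eq_iff.symm

theorem expUnits_eq_zero_iff (z : ℂ) : expUnits z = 0 ↔ ∃ n : ℤ, z = n := by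
  rw [expUnits_eq_iff]
  simp only [toMul_zero, Units.val_one, Complex.exp_eq_one_iff]
  refine exists_congr fun n => ?_
  rw [mul_comm, mul_left_inj' Complex.two_pi_I_ne_zero]

variable {E : Type*} [NormedAddCommGroup E] [NormedSpace ℝ E] {H : Type*} [TopologicalSpace H]
  {I : ModelWithCorners ℝ E H} {M : Type*} [TopologicalSpace M] [ChartedSpace H M]

/-- Near `x` the continuous logarithm `g` stays within `π` of `g x`, so it equals `g x` plus the
principal logarithm of `f / f x`, which is smooth near `1`. -/
theorem contMDiffAt_of_exp {g f : M → ℂ} {x : M} (hg : ContinuousAt g x)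
    (hf : ContMDiffAt I 𝓘(ℝ, ℂ) ∞ f x) (h : ∀ᶠ y in 𝓝 x, Complex.exp (g y) = f y) :
    ContMDiffAt I 𝓘(ℝ, ℂ) ∞ g x := by
  have hx := h.self_of_nhds
  have hlog : ContMDiffAt 𝓘(ℝ, ℂ) 𝓘(ℝ, ℂ) ∞ (fun z => g x + Complex.log (z / f x)) (f x) := by
    have h1 : ContDiffAt ℝ ∞ Complex.log (f x / f x) := by
      rw [div_self (hx ▸ Complex.exp_ne_zero _)]
      exact (Complex.contDiffAt_log Complex.one_mem_slitPlane).restrict_scalars ℝ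
    have h2 : ContDiffAt ℝ ∞ (fun z : ℂ => z / f x) (f x) := contDiffAt_id.div_const _
    exact (contDiffAt_const.add (ContDiffAt.comp (f x) (f := fun z : ℂ => z / f x) h1 h2)).contMDiffAt
  refine (hlog.comp x hf).congr_of_eventuallyEq ?_
  have hsmall : ∀ᶠ y in 𝓝 x, dist (g y) (g x) < Real.pi :=
    hg.eventually (Metric.ball_mem_nhds _ Real.pi_pos)
  filter_upwards [h, hsmall] with y hy hd
  have him : |(g y - g x).im| < Real.pi :=
    (Complex.abs_im_le_norm _).trans_lt (by rwa [← dist_eq_norm])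
  simp only [Function.comp]
  rw [← hy, ← hx, ← Complex.exp_sub, Complex.log_exp (abs_lt.1 him).1 (abs_lt.1 him).2.le]
  ring

theorem contMDiffOn_expUnits {h : M → ℂ} {U : Set M} (hh : ContMDiffOn I 𝓘(ℝ, ℂ) ∞ h U) :
    ContMDiffOn I 𝓘(ℝ, ℂ) ∞ (fun x => (((expUnits (h x)).toMul : ℂˣ) : ℂ)) U := by
  have : ContDiff ℝ ∞ (fun z : ℂ => Complex.exp (2 * Real.pi * Complex.I * z)) :=
    (contDiff_const.mul contDiff_id).cexp
  exact this.contMDiff.comp_contMDiffOn hh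

/-- Smooth functions with values in `ℂˣ` on contractible open sets have smooth logarithms. -/
theorem exists_smooth_log [LocallyPathConnectedSpace M] {W : Set M} (hW : IsOpen W)
    (hc : W = ∅ ∨ ContractibleSpace W) {f : M → Additive ℂˣ}
    (hf : ContMDiffOn I 𝓘(ℝ, ℂ) ∞ (fun x => (((f x).toMul : ℂˣ) : ℂ)) W) :
    ∃ h : M → ℂ, ContMDiffOn I 𝓘(ℝ, ℂ) ∞ h W ∧ ∀ x ∈ W, expUnits (h x) = f x := by
  rcases hc with rfl | hc
  · exact ⟨0, fun x hx => hx.elim, fun x hx => hx.elim⟩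
  have hs : IsSimplyConnected W := inferInstanceAs (SimplyConnectedSpace W)
  -- A contractible set is simply connected, so a continuous logarithm exists; its smoothness is
  -- then a local matter.
  obtain ⟨g, hg, hge⟩ := Complex.exists_continuousOn_eqOn_exp_comp hs hW hf.continuousOn
    (by rintro ⟨x, -, hx⟩; exact Units.ne_zero _ hx)
  have hgs : ∀ x ∈ W, ContMDiffAt I 𝓘(ℝ, ℂ) ∞ g x := fun x hx =>
    contMDiffAt_of_exp (hg.continuousAt (hW.mem_nhds hx)) (hf.contMDiffAt (hW.mem_nhds hx))
      (Filter.mem_of_superset (hW.mem_nhds hx) fun y hy => hge hy)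
  refine ⟨fun x => g x / (2 * Real.pi * Complex.I), fun x hx => ?_, fun x hx => ?_⟩
  · have : ContDiff ℝ ∞ (fun z : ℂ => z / (2 * Real.pi * Complex.I)) := contDiff_id.div_const _
    exact (this.contMDiff.contMDiffAt.comp x (hgs x hx)).contMDiffWithinAt
  · rw [expUnits_eq_iff, mul_div_cancel₀ _ Complex.two_pi_I_ne_zero]
    exact hge hx

theorem contMDiffOn_intCast {n : M → ℤ} {U : Set M} (hU : IsOpen U) (hn : ContinuousOn n U) :
    ContMDiffOn I 𝓘(ℝ, ℂ) ∞ (fun x => (n x : ℂ)) U := by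
  intro x hx
  refine ContMDiffAt.contMDiffWithinAt ?_
  refine (contMDiffAt_const (c := (n x : ℂ))).congr_of_eventuallyEq ?_
  have h := (hn.continuousAt (hU.mem_nhds hx)).eventually
    ((isOpen_discrete {n x}).mem_nhds (mem_singleton (n x)))
  filter_upwards [h] with y hy
  rw [mem_singleton_iff.1 hy]

theorem continuousOn_of_intCast {X : Type*} [TopologicalSpace X] {n : X → ℤ} {U : Set X}
    (hn : ContinuousOn (fun x => (n x : ℂ)) U) : ContinuousOn n U := by
  rw [Int.isClosedEmbedding_coe_real.isInducing.continuousOn_iff]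
  exact (Complex.continuous_re.comp_continuousOn hn).congr fun x _ => by simp

end ExponentialSequence

/-! ### Čech cochains of smooth, nonvanishing and integral functions -/

section CechLemmas

open Set Filter

theorem cechD_apply {ι M A : Type*} [AddCommGroup A] {n : ℕ} (g : (Fin (n + 1) → ι) → M → A)
    (i : Fin (n + 2) → ι) (x : M) : cechD g i x = altD (fun j => g j x) i := rfl

theorem mem_iInter_face {ι M : Type*} {U : ι → Set M} {n : ℕ} {i : Fin (n + 1) → ι} {x : M}
    (hx : x ∈ ⋂ k, U (i k)) (k : Fin (n + 1)) : x ∈ ⋂ l, U ((i ∘ k.succAbove) l) :=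
  mem_iInter.2 fun l => mem_iInter.1 hx (k.succAbove l)

theorem altD_congr {ι M A : Type*} [AddCommGroup A] {U : ι → Set M} {n : ℕ}
    {g h : (Fin n → ι) → A} {x : M} (H : ∀ i, (∀ k, x ∈ U (i k)) → g i = h i)
    {i : Fin (n + 1) → ι} (hx : x ∈ ⋂ k, U (i k)) : altD g i = altD h i :=
  Finset.sum_congr rfl fun k _ => by
    rw [H (i ∘ k.succAbove) fun l => mem_iInter.1 hx (k.succAbove l)]

theorem cechCocycles_comp {M A : Type*} [AddCommGroup A] (F : FunctionSheaf M A) {ι κ : Type*}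
    {V : ι → Set M} {W : κ → Set M} (r : κ → ι) (hr : ∀ k, W k ⊆ V (r k)) {n : ℕ}
    {g : (Fin (n + 1) → ι) → M → A} (hg : g ∈ cechCocycles F V n) :
    (fun i => g (r ∘ i)) ∈ cechCocycles F W n :=
  have hs : ∀ {m : ℕ} (i : Fin m → κ), (⋂ l, W (i l)) ⊆ ⋂ l, V ((r ∘ i) l) :=
    fun i => iInter_mono fun l => hr (i l)
  ⟨fun i => F.mono (hs i) (hg.1 (r ∘ i)), fun i x hx => hg.2 (r ∘ i) x (hs i hx)⟩

variable {E : Type*} [NormedAddCommGroup E] [NormedSpace ℝ E] {H : Type*} [TopologicalSpace H]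

/-- The sheaf of smooth complex functions. -/
def smoothFunctions (I : ModelWithCorners ℝ E H) (M : Type u) [TopologicalSpace M]
    [ChartedSpace H M] : FunctionSheaf M ℂ where
  sections U :=
    { carrier := {f | ContMDiffOn I 𝓘(ℝ, ℂ) ∞ f U}
      zero_mem' := contMDiffOn_const
      add_mem' := fun hf hg => hf.add hg
      neg_mem' := fun hf => hf.neg }
  mono h _ hf := ContMDiffOn.mono hf h

variable {I : ModelWithCorners ℝ E H} {M : Type u} [TopologicalSpace M] [ChartedSpace H M]

theorem contMDiffOn_cechD {ι : Type*} {U : ι → Set M} {n : ℕ} {h : (Fin (n + 1) → ι) → M → ℂ}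
    (hh : ∀ i, h i ∈ (smoothFunctions I M).sections (⋂ k, U (i k))) (i : Fin (n + 2) → ι) :
    ContMDiffOn I 𝓘(ℝ, ℂ) ∞ (cechD h i) (⋂ k, U (i k)) := by
  have : cechD h i = ∑ k : Fin (n + 2), ((-1 : ℤ) ^ (k : ℕ)) • h (i ∘ k.succAbove) := by
    funext x; simp [cechD]
  rw [this]
  exact AddSubgroup.sum_mem ((smoothFunctions I M).sections (⋂ k, U (i k))) fun k _ =>
    AddSubgroup.zsmul_mem _ ((smoothFunctions I M).mono
      (fun x hx => mem_iInter_face hx k) (hh _)) _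

/-- The sheaf of smooth functions is acyclic. -/
theorem cechBoundaries_of_partition {ι : Type*} {U : ι → Set M} (hU : ∀ i, IsOpen (U i))
    (ρ : SmoothPartitionOfUnity ι I M univ) (hρ : ρ.IsSubordinate U) {n : ℕ}
    {c : (Fin (n + 2) → ι) → M → ℂ} (hc : c ∈ cechCocycles (smoothFunctions I M) U (n + 1)) :
    c ∈ cechBoundaries (smoothFunctions I M) U (n + 1) := by
  -- This is the usual contracting homotopy. The values of `c (Fin.cons j i)` outside `U j` are
  -- meaningless, but there `ρ j` vanishes, and subordination of its closed support gives
  -- smoothness.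
  refine ⟨fun i x => ∑ᶠ j, ρ j x • c (Fin.cons j i) x, fun i x hx => ?_, fun i x hx => ?_⟩
  · refine ContMDiffAt.contMDiffWithinAt (ρ.contMDiffAt_finsum fun j hj => ?_)
    refine (hc.1 (Fin.cons j i)).contMDiffAt ((isOpen_iInter_of_finite fun k => hU _).mem_nhds ?_)
    refine mem_iInter.2 fun k => ?_
    refine Fin.cases ?_ (fun k => ?_) k
    · simpa using hρ j hj
    · simpa using mem_iInter.1 hx k
  · have hfin : ∀ s : Fin (n + 1) → ι, ∑ᶠ j, ρ j x • c (Fin.cons j s) x =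
        ∑ j ∈ ρ.finsupport x, ρ j x • c (Fin.cons j s) x := by
      intro s
      refine finsum_eq_sum_of_support_subset _ fun j hj => ?_
      rw [Finset.mem_coe, ρ.mem_finsupport]
      exact fun h0 => hj (by simp only [h0, zero_smul])
    rw [cechD_apply]
    have e1 : altD (fun s => ∑ᶠ j, ρ j x • c (Fin.cons j s) x) i =
        ∑ j ∈ ρ.finsupport x, ρ j x • altD (contr j fun s => c s x) i := by
      simp only [altD, hfin, Finset.smul_sum]
      rw [Finset.sum_comm]
      refine Finset.sum_congr rfl fun j _ => Finset.sum_congr rfl fun k _ => ?_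
      rw [smul_comm]; rfl
    rw [e1]
    have e2 : ∀ j ∈ ρ.finsupport x, ρ j x • altD (contr j fun s => c s x) i =
        ρ j x • c i x := by
      intro j hj
      congr 1
      have h := hc.2 (Fin.cons j i) x (mem_iInter.2 fun k => by
        refine Fin.cases ?_ (fun k => ?_) k
        · simpa using hρ j (subset_tsupport _ ((ρ.mem_finsupport x).1 hj))
        · simpa using mem_iInter.1 hx k)
      -- The cocycle condition at the tuple with `j` put in front says that the coboundary of `contr
      -- j c` is `c`; averaging over `j` finishes.
      rw [cechD_apply, altD_cons, sub_eq_zero] at h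
      exact h.symm
    rw [Finset.sum_congr rfl e2, ← Finset.sum_smul, ρ.sum_finsupport x (mem_univ x), one_smul]

/-- A lift of a cocycle to the sheaf of smooth functions has an integral coboundary. -/
theorem exists_integral_coboundary {ι : Type*} {U : ι → Set M} {n : ℕ}
    {g : (Fin (n + 1) → ι) → M → Additive ℂˣ} {h : (Fin (n + 1) → ι) → M → ℂ}
    (hg : g ∈ cechCocycles (smoothUnits I M) U n)
    (hh : ∀ i, h i ∈ (smoothFunctions I M).sections (⋂ k, U (i k)))
    (hgh : ∀ i, ∀ x ∈ ⋂ k, U (i k), expUnits (h i x) = g i x) :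
    ∃ c ∈ cechCocycles (constInt M) U (n + 1),
      ∀ i, ∀ x ∈ ⋂ k, U (i k), (c i x : ℂ) = cechD h i x := by
  -- The exponential of `δh` is `δg`, which is trivial, so `δh` is integral on the intersections.
  -- Rounding its real part provides integer values everywhere and does not change it there.
  have key : ∀ i, ∀ x ∈ ⋂ k, U (i k), ((round (cechD h i x).re : ℤ) : ℂ) = cechD h i x := by
    intro i x hx
    have h1 : expUnits (cechD h i x) = 0 := by
      rw [← hg.2 i x hx, cechD_apply, cechD_apply, ← congrFun (altD_map expUnits fun j => h j x) i]
      exact altD_congr (fun j hj => hgh j x (mem_iInter.2 hj)) hx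
    obtain ⟨m, hm⟩ := (expUnits_eq_zero_iff _).1 h1
    rw [hm]; simp
  refine ⟨fun i x => round (cechD h i x).re, ⟨fun i => ?_, fun i x hx => ?_⟩, key⟩
  · exact continuousOn_of_intCast ((contMDiffOn_cechD hh i).continuousOn.congr (key i))
  · have h1 : ((altD (fun j => round (cechD h j x).re) i : ℤ) : ℂ) =
        altD (fun j => ((round (cechD h j x).re : ℤ) : ℂ)) i :=
      (congrFun (altD_map (Int.castAddHom ℂ) fun j => round (cechD h j x).re) i).symm
    rw [altD_congr (fun j hj => key j x (mem_iInter.2 hj)) hx] at h1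
    have h2 : altD (fun j => cechD h j x) i = 0 := congrFun (altD_altD fun j => h j x) i
    rw [h2] at h1
    exact_mod_cast h1

/-- If the coboundary of a lift of `g` is the coboundary of an integral cochain, then `g` is a
coboundary. -/
theorem cechBoundaries_of_integral {ι : Type*} {U : ι → Set M} (hU : ∀ i, IsOpen (U i))
    (ρ : SmoothPartitionOfUnity ι I M univ) (hρ : ρ.IsSubordinate U) {n : ℕ}
    {g : (Fin (n + 2) → ι) → M → Additive ℂˣ} {h : (Fin (n + 2) → ι) → M → ℂ}
    {c : (Fin (n + 3) → ι) → M → ℤ}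
    (hh : ∀ i, h i ∈ (smoothFunctions I M).sections (⋂ k, U (i k)))
    (hgh : ∀ i, ∀ x ∈ ⋂ k, U (i k), expUnits (h i x) = g i x)
    (hch : ∀ i, ∀ x ∈ ⋂ k, U (i k), (c i x : ℂ) = cechD h i x)
    (hc : c ∈ cechBoundaries (constInt M) U (n + 2)) :
    g ∈ cechBoundaries (smoothUnits I M) U (n + 1) := by
  obtain ⟨b, hb, hcb⟩ := hc
  have hbs : ∀ i, (fun x => (b i x : ℂ)) ∈ (smoothFunctions I M).sections (⋂ k, U (i k)) :=
    fun i => contMDiffOn_intCast (isOpen_iInter_of_finite fun k => hU _) (hb i)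
  -- Subtracting `b` does not change the exponential and makes the logarithm a genuine cocycle,
  -- hence the coboundary of some smooth `f`; then `g` is the coboundary of `exp(2πi f)`.
  have hcoc : (fun i x => h i x - b i x) ∈ cechCocycles (smoothFunctions I M) U (n + 1) := by
    refine ⟨fun i => sub_mem (hh i) (hbs i), fun i x hx => ?_⟩
    have e1 : altD (fun j => h j x - b j x) i = altD (fun j => h j x) i -
        altD (fun j => ((b j x : ℤ) : ℂ)) i :=
      congrFun (altD_sub (fun j => h j x) fun j => ((b j x : ℤ) : ℂ)) i
    have e2 : altD (fun j => ((b j x : ℤ) : ℂ)) i = ((altD (fun j => b j x) i : ℤ) : ℂ) :=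
      congrFun (altD_map (Int.castAddHom ℂ) fun j => b j x) i
    rw [cechD_apply, e1, e2, ← cechD_apply, ← cechD_apply, ← hcb i x hx, ← hch i x hx, sub_self]
  obtain ⟨f, hf, hhf⟩ := cechBoundaries_of_partition hU ρ hρ hcoc
  refine ⟨fun i x => expUnits (f i x), fun i => contMDiffOn_expUnits (hf i), fun i x hx => ?_⟩
  have e := hhf i x hx
  rw [cechD_apply] at e
  rw [cechD_apply, congrFun (altD_map expUnits fun j => f j x) i, ← e, map_sub,
    (expUnits_eq_zero_iff _).2 ⟨_, rfl⟩, sub_zero, hgh i x hx]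

/-- On a good cover of a contractible space, integral cocycles become coboundaries after
refinement. -/
theorem exists_refinement_integral_boundary {X : Type*} [TopologicalSpace X] [T2Space X]
    [ParacompactSpace X] [ContractibleSpace X] (𝒲 : PointedCover X) (hW : IsGoodFamily 𝒲.U)
    {n : ℕ} {c : (Fin (n + 2) → X) → X → ℤ} (hc : c ∈ cechCocycles (constInt X) 𝒲.U (n + 1)) :
    ∃ (𝒱 : PointedCover X) (r : X → X), (∀ x, 𝒱.U x ⊆ 𝒲.U (r x)) ∧
      (fun i => c (r ∘ i)) ∈ cechBoundaries (constInt X) 𝒱.U (n + 1) := by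
  obtain ⟨i, G, hG⟩ := exists_star_refinement' 𝒲.U 𝒲.isOpen fun x => ⟨x, 𝒲.mem x⟩
  have hconst : ∀ j : Fin (n + 2) → X, ∀ x ∈ ⋂ k, 𝒲.U (j k), ∀ y ∈ ⋂ k, 𝒲.U (j k),
      c j x = c j y := by
    intro j x hx y hy
    rcases hW (n + 1) j with h | h
    · rw [h] at hx; exact hx.elim
    · exact (isPreconnected_iff_preconnectedSpace.2 inferInstance).constant (hc.1 j) hx hy
  -- The Čech cocycle becomes a function of tuples of points by way of the index map `i`. The
  -- evaluation point `s 0` is immaterial by `hconst`, because small tuples lie in all the cover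
  -- members concerned.
  have hcoc : ∀ a, ∀ t : Fin (n + 3) → X, (∀ k, t k ∈ G.U a) →
      altD (fun s : Fin (n + 2) → X => c (i ∘ s) (s 0)) t = 0 := by
    intro a t ht
    have hmem : ∀ k y, y ∈ G.U a → y ∈ 𝒲.U (i (t k)) := fun k y hy => hG a _ (ht k) hy
    rw [← hc.2 (i ∘ t) (t 0) (mem_iInter.2 fun k => hmem k _ (ht 0)), cechD_apply]
    refine Finset.sum_congr rfl fun k _ => ?_
    congr 1
    exact hconst _ _ (mem_iInter.2 fun l => hmem _ _ (ht _)) _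
      (mem_iInter.2 fun l => hmem _ _ (ht _))
  obtain ⟨G', b, hb⟩ := exists_altD_eq_of_contractible G _ hcoc
  -- A second star refinement is needed to return to Čech cochains: if the members indexed by the `t
  -- k` share a point `x`, then all the points `t k` themselves lie in the set indexed by `i' x`.
  obtain ⟨i', G'', hG''⟩ := exists_star_refinement' (fun x => G'.U x ∩ G.U x)
    (fun x => (G'.isOpen x).inter (G.isOpen x)) fun x => ⟨x, G'.mem x, G.mem x⟩
  refine ⟨⟨fun x => G''.U x ∩ 𝒲.U (i x), fun x => (G''.isOpen x).inter (𝒲.isOpen _),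
    fun x => ⟨G''.mem x, hG x x (G.mem x) (G.mem x)⟩⟩, i, fun x => inter_subset_right,
    fun t _ => b t, fun t => continuousOn_const, fun t x hx => ?_⟩
  have hx' : ∀ k, x ∈ G''.U (t k) ∧ x ∈ 𝒲.U (i (t k)) := mem_iInter.1 hx
  have ht : ∀ k, t k ∈ G'.U (i' x) ∩ G.U (i' x) := fun k => hG'' _ x (hx' k).1 (G''.mem _)
  rw [cechD_apply]
  refine Eq.trans ?_ (hb (i' x) t fun k => (ht k).1).symm
  exact hconst _ _ (mem_iInter.2 fun k => (hx' k).2) _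
    (mem_iInter.2 fun k => hG _ _ (ht k).2 (ht 0).2)

end CechLemmas

/-! ### Vanishing on contractible manifolds -/

section Contractible

open Set

variable {E : Type*} [NormedAddCommGroup E] [NormedSpace ℝ E] {M : Type*} [TopologicalSpace M]
  [ChartedSpace E M]

/-- On a good cover, cochains of nonvanishing functions have logarithms. -/
theorem exists_log_cochain {ι : Type*} {W : ι → Set M} (hWo : ∀ i, IsOpen (W i))
    (hW : IsGoodFamily W) {n : ℕ} {g : (Fin (n + 1) → ι) → M → Additive ℂˣ}
    (hg : ∀ i, g i ∈ (smoothUnits 𝓘(ℝ, E) M).sections (⋂ k, W (i k))) :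
    ∃ h : (Fin (n + 1) → ι) → M → ℂ,
      (∀ i, h i ∈ (smoothFunctions 𝓘(ℝ, E) M).sections (⋂ k, W (i k))) ∧
      ∀ i, ∀ x ∈ ⋂ k, W (i k), expUnits (h i x) = g i x := by
  have : LocallyPathConnectedSpace M := ChartedSpace.locallyPathConnectedSpace E M
  choose h h1 h2 using fun i : Fin (n + 1) → ι => exists_smooth_log (I := 𝓘(ℝ, E)) (f := g i) (W := ⋂ k, W (i k))
    (isOpen_iInter_of_finite fun k => hWo (i k)) (hW n i) (hg i)
  exact ⟨h, h1, h2⟩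

variable [FiniteDimensional ℝ E] [T2Space M] [ParacompactSpace M] [IsManifold 𝓘(ℝ, E) ∞ M]

/-- On a contractible manifold, cocycles of nonvanishing functions of positive degree become
coboundaries after refinement. -/
theorem exists_refinement_boundary [ContractibleSpace M] {ι : Type*} {V : ι → Set M}
    (hV : ∀ i, IsOpen (V i)) (hc : ∀ x, ∃ i, x ∈ V i) {n : ℕ}
    {g : (Fin (n + 2) → ι) → M → Additive ℂˣ}
    (hg : g ∈ cechCocycles (smoothUnits 𝓘(ℝ, E) M) V (n + 1)) :
    ∃ (𝒱 : PointedCover M) (r : M → ι), (∀ x, 𝒱.U x ⊆ V (r x)) ∧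
      (fun i => g (r ∘ i)) ∈ cechBoundaries (smoothUnits 𝓘(ℝ, E) M) 𝒱.U (n + 1) := by
  obtain ⟨𝒲, r, hr, hW⟩ := exists_good_refinement E V hV hc
  have hg' := cechCocycles_comp _ r hr hg
  obtain ⟨h, hh, hgh⟩ := exists_log_cochain 𝒲.isOpen hW hg'.1
  obtain ⟨c, hcc, hch⟩ := exists_integral_coboundary hg' hh hgh
  obtain ⟨𝒱, r', hr', hb⟩ := exists_refinement_integral_boundary 𝒲 hW hcc
  obtain ⟨ρ, hρ⟩ := exists_smoothPartitionOfUnity E 𝒱.U 𝒱.isOpen fun x => ⟨x, 𝒱.mem x⟩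
  have hs : ∀ {m : ℕ} (i : Fin m → M), (⋂ l, 𝒱.U (i l)) ⊆ ⋂ l, 𝒲.U ((r' ∘ i) l) :=
    fun i => iInter_mono fun l => hr' (i l)
  refine ⟨𝒱, r ∘ r', fun x => (hr' x).trans (hr _), ?_⟩
  -- The logarithms are those found on `𝒲`, restricted along `r'`; only their integral coboundary
  -- required the finer cover.
  exact cechBoundaries_of_integral 𝒱.isOpen ρ hρ (h := fun i => h (r' ∘ i))
    (fun i => (smoothFunctions _ M).mono (hs i) (hh _)) (fun i x hx => hgh _ x (hs i hx))
    (fun i x hx => hch _ x (hs i hx)) hb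

end Contractible

/-! ### Smooth functions with values in the group -/

section SmoothUnits

variable {E' : Type*} [NormedAddCommGroup E'] [NormedSpace ℝ E'] {H' : Type*} [TopologicalSpace H']
  {J : ModelWithCorners ℝ E' H'} {K : Type*} [TopologicalSpace K] [ChartedSpace H' K]

/-- Smoothness on a set of a function with values in `ℂˣ`. -/
def SmoothUnitOn (J : ModelWithCorners ℝ E' H') (z : K → ℂˣ) (A : Set K) : Prop :=
  ContMDiffOn J 𝓘(ℝ, ℂ) ∞ (fun k => (z k : ℂ)) A

namespace SmoothUnitOn

variable {z z' : K → ℂˣ} {A A' : Set K}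

theorem mono (h : SmoothUnitOn J z A) (hA : A' ⊆ A) : SmoothUnitOn J z A' :=
  ContMDiffOn.mono h hA

theorem mul (h : SmoothUnitOn J z A) (h' : SmoothUnitOn J z' A) :
    SmoothUnitOn J (fun k => z k * z' k) A := by
  have hm : ContDiff ℝ ∞ (fun p : ℂ × ℂ => p.1 * p.2) := contDiff_fst.mul contDiff_snd
  exact (hm.contMDiff.comp_contMDiffOn (ContMDiffOn.prodMk_space h h')).congr fun k _ => by simp

theorem inv (h : SmoothUnitOn J z A) : SmoothUnitOn J (fun k => (z k)⁻¹) A := by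
  intro x hx
  have hi : ContDiffAt ℝ ∞ (fun z : ℂ => z⁻¹) (z x : ℂ) := contDiffAt_inv ℝ (Units.ne_zero _)
  exact (hi.contMDiffAt.comp_contMDiffWithinAt x (h x hx)).congr (fun y _ => by simp) (by simp)

theorem congr (h : SmoothUnitOn J z A) (hz : ∀ k ∈ A, z' k = z k) : SmoothUnitOn J z' A :=
  ContMDiffOn.congr h fun k hk => by rw [hz k hk]

theorem div (h : SmoothUnitOn J z A) (h' : SmoothUnitOn J z' A) :
    SmoothUnitOn J (fun k => z k / z' k) A :=
  (h.mul h'.inv).congr fun _ _ => div_eq_mul_inv _ _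

theorem of_local (h : ∀ k ∈ A, ∃ O ∈ 𝓝[A] k, SmoothUnitOn J z (A ∩ O)) : SmoothUnitOn J z A := by
  intro k hk
  obtain ⟨O, hO, hz⟩ := h k hk
  exact (hz k ⟨hk, mem_of_mem_nhdsWithin hk hO⟩).mono_of_mem_nhdsWithin
    (Filter.inter_mem self_mem_nhdsWithin hO)

end SmoothUnitOn

end SmoothUnits

/-! ### Smooth sections of bundles along maps -/

section Toolkit

variable {E : Type*} [NormedAddCommGroup E] [NormedSpace ℝ E] {H : Type*} [TopologicalSpace H]
  {I : ModelWithCorners ℝ E H} {N : Type*} [TopologicalSpace N] [ChartedSpace H N]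
  {S : Set N}
  {E' : Type*} [NormedAddCommGroup E'] [NormedSpace ℝ E'] {H' : Type*} [TopologicalSpace H']
  {J : ModelWithCorners ℝ E' H'} {K : Type*} [TopologicalSpace K] [ChartedSpace H' K]

namespace CstarBundle

variable {P : CstarBundle.{w} I S} {c : K → N} {τ τ' : ∀ k, P.Fib (c k)} {A A' : Set K}

theorem SmoothAlong.mono (h : P.SmoothAlong J c τ A) (hA : A' ⊆ A) : P.SmoothAlong J c τ A' :=
  fun f hf => ContMDiffOn.mono (h f hf) (Set.inter_subset_inter_left _ hA)

theorem SmoothAlong.comp {E₂ : Type*} [NormedAddCommGroup E₂] [NormedSpace ℝ E₂] {H₂ : Type*}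
    [TopologicalSpace H₂] {J₂ : ModelWithCorners ℝ E₂ H₂} {K₂ : Type*} [TopologicalSpace K₂]
    [ChartedSpace H₂ K₂] (h : P.SmoothAlong J c τ A) {e : K₂ → K} {A₂ : Set K₂}
    (he : ContMDiffOn J₂ J ∞ e A₂) (hA : Set.MapsTo e A₂ A) :
    P.SmoothAlong J₂ (fun k => c (e k)) (fun k => τ (e k)) A₂ :=
  fun f hf => ContMDiffOn.comp (g := fun k => ((τ k /ₛ f.2 (c k) : ℂˣ) : ℂ)) (h f hf) (he.mono Set.inter_subset_left)
    fun _ hk => ⟨hA hk.1, hk.2⟩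

/-- Frame domains are only relatively open in `S`, so localisation takes place within `A` and uses
that `c` maps `A` into `S`. -/
theorem preimage_frame_mem {f : Set N × (∀ b, P.Fib b)} (hf : f ∈ P.frames)
    (hc : ContinuousOn c A) (hA : Set.MapsTo c A S) {k : K} (hk : k ∈ A) (hkf : c k ∈ f.1) :
    c ⁻¹' f.1 ∈ 𝓝[A] k :=
  (hc k hk).tendsto_nhdsWithin hA (P.frames_nhds f hf _ ⟨hkf, hA hk⟩)

theorem SmoothAlong.of_local (h : ∀ k ∈ A, ∃ O ∈ 𝓝[A] k, P.SmoothAlong J c τ (A ∩ O)) :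
    P.SmoothAlong J c τ A := by
  rintro f hf k ⟨hk, hkf⟩
  obtain ⟨O, hO, hz⟩ := h k hk
  refine (hz f hf k ⟨⟨hk, mem_of_mem_nhdsWithin hk hO⟩, hkf⟩).mono_of_mem_nhdsWithin ?_
  rw [Set.inter_right_comm]
  exact Filter.inter_mem self_mem_nhdsWithin (nhdsWithin_mono _ Set.inter_subset_left hO)

theorem SmoothAlong.of_sdiv (h : P.SmoothAlong J c τ A)
    (hz : SmoothUnitOn J (fun k => τ' k /ₛ τ k) A) : P.SmoothAlong J c τ' A := fun f hf =>
  (hz.mono Set.inter_subset_left |>.mul (h f hf)).congr fun k _ => by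
    rw [sdiv_mul_sdiv_cancel]

theorem SmoothAlong.congr (h : P.SmoothAlong J c τ A) (hz : ∀ k ∈ A, τ' k = τ k) :
    P.SmoothAlong J c τ' A := fun f hf =>
  ContMDiffOn.congr (h f hf) fun k hk => by rw [hz k hk.1]

theorem SmoothAlong.smul (h : P.SmoothAlong J c τ A) {z : K → ℂˣ} (hz : SmoothUnitOn J z A) :
    P.SmoothAlong J c (fun k => z k • τ k) A :=
  h.of_sdiv (hz.congr fun _ _ => smul_sdiv _ _)

/-- Measured against a common frame the two sections are smooth functions, and the frame cancels in
the quotient. All smooth functions read off from bundles below arise this way. -/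
theorem SmoothAlong.sdiv (h : P.SmoothAlong J c τ A) (h' : P.SmoothAlong J c τ' A)
    (hc : ContinuousOn c A) (hA : Set.MapsTo c A S) :
    SmoothUnitOn J (fun k => τ k /ₛ τ' k) A := by
  refine SmoothUnitOn.of_local fun k hk => ?_
  obtain ⟨f, hf, hkf⟩ := P.frames_cover _ (hA hk)
  exact ⟨_, preimage_frame_mem hf hc hA hk hkf,
    (SmoothUnitOn.div (h f hf) (h' f hf)).congr fun k _ => (sdiv_div_sdiv_cancel_right _ _ _).symm⟩

theorem smoothAlong_frame {f : Set N × (∀ b, P.Fib b)} (hf : f ∈ P.frames)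
    (hc : ContMDiffOn J I ∞ c A) (hA : Set.MapsTo c A S) (hAf : Set.MapsTo c A f.1) :
    P.SmoothAlong J c (fun k => f.2 (c k)) A := fun g hg =>
  (P.frames_compat f hf g hg).comp (hc.mono Set.inter_subset_left)
    fun _ hk => ⟨⟨hAf hk.1, hk.2⟩, hA hk.1⟩

end CstarBundle

end Toolkit

/-! ### Calculus in bundle gerbes and trivialisations -/

section GerbeToolkit

variable {EN : Type*} [NormedAddCommGroup EN] [NormedSpace ℝ EN] {HN : Type*} [TopologicalSpace HN]
  {EY : Type*} [NormedAddCommGroup EY] [NormedSpace ℝ EY] {HY : Type*} [TopologicalSpace HY]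
  {IN : ModelWithCorners ℝ EN HN} {N : Type*} [TopologicalSpace N]
  [ChartedSpace HN N] {B : Set N} {IY : ModelWithCorners ℝ EY HY} {Y : Type*}
  [TopologicalSpace Y] [ChartedSpace HY Y]
  {E' : Type*} [NormedAddCommGroup E'] [NormedSpace ℝ E'] {H' : Type*} [TopologicalSpace H']
  {J : ModelWithCorners ℝ E' H'} {K : Type*} [TopologicalSpace K] [ChartedSpace H' K]
  {A : Set K}

namespace BundleGerbe

variable (G : BundleGerbe.{w} IN B IY Y) {y₁ y₂ y₃ : Y}

theorem smul_mul (h₁ : G.proj y₁ = G.proj y₂) (h₂ : G.proj y₂ = G.proj y₃) (z : ℂˣ)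
    (p : G.bundle.Fib (y₂, y₃)) (q : G.bundle.Fib (y₁, y₂)) :
    G.mul (z • p) q = z • G.mul p q := by
  simpa using G.mul_smul h₁ h₂ z 1 p q

theorem mul_smul_right (h₁ : G.proj y₁ = G.proj y₂) (h₂ : G.proj y₂ = G.proj y₃) (z : ℂˣ)
    (p : G.bundle.Fib (y₂, y₃)) (q : G.bundle.Fib (y₁, y₂)) :
    G.mul p (z • q) = z • G.mul p q := by
  simpa using G.mul_smul h₁ h₂ 1 z p q

theorem mul_sdiv_mul_right (h₁ : G.proj y₁ = G.proj y₂) (h₂ : G.proj y₂ = G.proj y₃)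
    (p p' : G.bundle.Fib (y₂, y₃)) (q : G.bundle.Fib (y₁, y₂)) :
    G.mul p q /ₛ G.mul p' q = p /ₛ p' := by
  conv_lhs => rw [← sdiv_smul p p', G.smul_mul h₁ h₂, smul_sdiv]

theorem mul_sdiv_mul_left (h₁ : G.proj y₁ = G.proj y₂) (h₂ : G.proj y₂ = G.proj y₃)
    (p : G.bundle.Fib (y₂, y₃)) (q q' : G.bundle.Fib (y₁, y₂)) :
    G.mul p q /ₛ G.mul p q' = q /ₛ q' := by
  conv_lhs => rw [← sdiv_smul q q', G.mul_smul_right h₁ h₂, smul_sdiv]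

theorem mul_sdiv_mul (h₁ : G.proj y₁ = G.proj y₂) (h₂ : G.proj y₂ = G.proj y₃)
    (p p' : G.bundle.Fib (y₂, y₃)) (q q' : G.bundle.Fib (y₁, y₂)) :
    G.mul p q /ₛ G.mul p' q' = (p /ₛ p') * (q /ₛ q') := by
  conv_lhs => rw [← sdiv_smul p p', ← sdiv_smul q q', G.mul_smul h₁ h₂, smul_sdiv]

theorem mul_right_cancel (h₁ : G.proj y₁ = G.proj y₂) (h₂ : G.proj y₂ = G.proj y₃)
    {p p' : G.bundle.Fib (y₂, y₃)} {q : G.bundle.Fib (y₁, y₂)} (h : G.mul p q = G.mul p' q) :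
    p = p' := by
  rw [← sdiv_eq_one_iff_eq, ← G.mul_sdiv_mul_right h₁ h₂ p p' q, h, sdiv_self]

theorem mul_left_cancel (h₁ : G.proj y₁ = G.proj y₂) (h₂ : G.proj y₂ = G.proj y₃)
    {p : G.bundle.Fib (y₂, y₃)} {q q' : G.bundle.Fib (y₁, y₂)} (h : G.mul p q = G.mul p q') :
    q = q' := by
  rw [← sdiv_eq_one_iff_eq, ← G.mul_sdiv_mul_left h₁ h₂ p q q', h, sdiv_self]

theorem exists_mul_eq (h₁ : G.proj y₁ = G.proj y₂) (h₂ : G.proj y₂ = G.proj y₃)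
    (q : G.bundle.Fib (y₁, y₂)) (r : G.bundle.Fib (y₁, y₃)) :
    ∃ p : G.bundle.Fib (y₂, y₃), G.mul p q = r := by
  let p₀ : G.bundle.Fib (y₂, y₃) := Classical.arbitrary _
  exact ⟨(r /ₛ G.mul p₀ q) • p₀, by rw [G.smul_mul h₁ h₂, sdiv_smul]⟩

theorem unit_mul_unit (y : Y) : G.mul (G.unit y) (G.unit y) = G.unit y := by
  have h : ∀ p : G.bundle.Fib (y, y), G.mul ((p /ₛ G.mul p p) • p) ((p /ₛ G.mul p p) • p) =
      (p /ₛ G.mul p p) • p := by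
    intro p
    rw [G.mul_smul rfl rfl, ← smul_smul, sdiv_smul]
  exact h _

/-- The unit is idempotent by its normalisation, and equivariance allows cancellation on the right.
-/
theorem mul_unit (h : G.proj y₁ = G.proj y₂) (p : G.bundle.Fib (y₁, y₂)) :
    G.mul p (G.unit y₁) = p := by
  refine G.mul_right_cancel (q := G.unit y₁) rfl h ?_
  rw [← G.mul_assoc rfl rfl h, unit_mul_unit]

variable {G} {η₁ η₂ η₃ : K → Y}

theorem mapsTo_pair {K : Type*} {A : Set K} {η₁ η₂ : K → Y}
    (h : ∀ k ∈ A, G.proj (η₁ k) = G.proj (η₂ k)) :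
    Set.MapsTo (fun k => (η₁ k, η₂ k)) A {z : Y × Y | G.proj z.1 = G.proj z.2} := h

/-- The product of smooth sections is smooth. -/
theorem smoothAlong_mul (s₁ : ContMDiffOn J IY ∞ η₁ A) (s₂ : ContMDiffOn J IY ∞ η₂ A)
    (s₃ : ContMDiffOn J IY ∞ η₃ A) (h₁ : ∀ k ∈ A, G.proj (η₁ k) = G.proj (η₂ k))
    (h₂ : ∀ k ∈ A, G.proj (η₂ k) = G.proj (η₃ k)) {p : ∀ k, G.bundle.Fib (η₂ k, η₃ k)}
    {q : ∀ k, G.bundle.Fib (η₁ k, η₂ k)}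
    (hp : G.bundle.SmoothAlong J (fun k => (η₂ k, η₃ k)) p A)
    (hq : G.bundle.SmoothAlong J (fun k => (η₁ k, η₂ k)) q A) :
    G.bundle.SmoothAlong J (fun k => (η₁ k, η₃ k)) (fun k => G.mul (p k) (q k)) A := by
  refine CstarBundle.SmoothAlong.of_local fun k hk => ?_
  obtain ⟨f, hf, hkf⟩ := G.bundle.frames_cover (η₂ k, η₃ k) (h₂ k hk)
  obtain ⟨g, hg, hkg⟩ := G.bundle.frames_cover (η₁ k, η₂ k) (h₁ k hk)
  refine ⟨_, Filter.inter_mem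
    (CstarBundle.preimage_frame_mem hf (s₂.prodMk s₃).continuousOn (mapsTo_pair h₂) hk hkf)
    (CstarBundle.preimage_frame_mem hg (s₁.prodMk s₂).continuousOn (mapsTo_pair h₁) hk hkg), ?_⟩
  have h := (G.mul_smooth f hf g hg).comp
    ((s₁.prodMk (s₂.prodMk s₃)).mono (Set.inter_subset_left))
    (fun k' (hk' : k' ∈ A ∩ ((fun k => (η₂ k, η₃ k)) ⁻¹' f.1 ∩
      (fun k => (η₁ k, η₂ k)) ⁻¹' g.1)) => ⟨h₁ k' hk'.1, h₂ k' hk'.1, hk'.2.1, hk'.2.2⟩)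
  refine h.of_sdiv ?_
  refine SmoothUnitOn.congr (SmoothUnitOn.mul (ContMDiffOn.mono (hp f hf) ?_)
    (ContMDiffOn.mono (hq g hg) ?_)) fun k' hk' => G.mul_sdiv_mul (h₁ k' hk'.1) (h₂ k' hk'.1) _ _ _ _
  · exact fun k' hk' => ⟨hk'.1, hk'.2.1⟩
  · exact fun k' hk' => ⟨hk'.1, hk'.2.2⟩

/-- Division is smooth: if `f` is a local frame, then `p / f` equals `(p q) / (f q)`, a quotient of
smooth sections. -/
theorem smoothAlong_of_mul (s₁ : ContMDiffOn J IY ∞ η₁ A) (s₂ : ContMDiffOn J IY ∞ η₂ A)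
    (s₃ : ContMDiffOn J IY ∞ η₃ A) (h₁ : ∀ k ∈ A, G.proj (η₁ k) = G.proj (η₂ k))
    (h₂ : ∀ k ∈ A, G.proj (η₂ k) = G.proj (η₃ k)) {p : ∀ k, G.bundle.Fib (η₂ k, η₃ k)}
    {q : ∀ k, G.bundle.Fib (η₁ k, η₂ k)}
    (hpq : G.bundle.SmoothAlong J (fun k => (η₁ k, η₃ k)) (fun k => G.mul (p k) (q k)) A)
    (hq : G.bundle.SmoothAlong J (fun k => (η₁ k, η₂ k)) q A) :
    G.bundle.SmoothAlong J (fun k => (η₂ k, η₃ k)) p A := by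
  refine CstarBundle.SmoothAlong.of_local fun k hk => ?_
  obtain ⟨f, hf, hkf⟩ := G.bundle.frames_cover (η₂ k, η₃ k) (h₂ k hk)
  refine ⟨_, CstarBundle.preimage_frame_mem hf (s₂.prodMk s₃).continuousOn (mapsTo_pair h₂) hk hkf,
    ?_⟩
  have hl : A ∩ (fun k => (η₂ k, η₃ k)) ⁻¹' f.1 ⊆ A := Set.inter_subset_left
  have hfs := CstarBundle.smoothAlong_frame hf ((s₂.prodMk s₃).mono hl)
    (fun k' hk' => h₂ k' hk'.1) (fun k' hk' => hk'.2)
  have hfq := smoothAlong_mul (s₁.mono hl) (s₂.mono hl) (s₃.mono hl) (fun k' hk' => h₁ k' hk'.1)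
    (fun k' hk' => h₂ k' hk'.1) hfs (hq.mono hl)
  refine hfs.of_sdiv (((hpq.mono hl).sdiv hfq ((s₁.prodMk s₃).mono hl).continuousOn
    fun k' hk' => (h₁ k' hk'.1).trans (h₂ k' hk'.1)).congr fun k' hk' => ?_)
  exact (G.mul_sdiv_mul_right (h₁ k' hk'.1) (h₂ k' hk'.1) _ _ _).symm

end BundleGerbe

namespace BundleGerbe.Trivialisation

variable {G : BundleGerbe.{w} IN B IY Y} {T : Set Y} (t : G.Trivialisation T) {y y' : Y}

theorem φ_sdiv_φ (hy : y ∈ T) (hy' : y' ∈ T) (h : G.proj y = G.proj y') (u' v' : t.L.Fib y')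
    (u v : t.L.Fib y) : t.φ u' u /ₛ t.φ v' v = (u' /ₛ v') / (u /ₛ v) := by
  conv_lhs => rw [← sdiv_smul u' v', ← sdiv_smul u v, t.φ_smul hy hy' h, smul_sdiv]
  rw [div_eq_mul_inv]

/-- Compatibility with products makes `φ u u` idempotent, and the unit is the only idempotent. -/
theorem φ_self (hy : y ∈ T) (u : t.L.Fib y) : t.φ u u = G.unit y := by
  refine G.mul_left_cancel (p := t.φ u u) rfl rfl ?_
  rw [t.φ_mul hy hy hy rfl rfl, G.mul_unit rfl]

variable {t} {η η' : K → Y}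

/-- The isomorphism of a trivialisation takes smooth sections to smooth sections. -/
theorem smoothAlong_φ (s : ContMDiffOn J IY ∞ η A) (s' : ContMDiffOn J IY ∞ η' A)
    (hT : Set.MapsTo η A T) (hT' : Set.MapsTo η' A T)
    (h : ∀ k ∈ A, G.proj (η k) = G.proj (η' k)) {u' : ∀ k, t.L.Fib (η' k)} {u : ∀ k, t.L.Fib (η k)}
    (hu' : t.L.SmoothAlong J η' u' A) (hu : t.L.SmoothAlong J η u A) :
    G.bundle.SmoothAlong J (fun k => (η k, η' k)) (fun k => t.φ (u' k) (u k)) A := by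
  refine CstarBundle.SmoothAlong.of_local fun k hk => ?_
  obtain ⟨f, hf, hkf⟩ := t.L.frames_cover (η' k) (hT' hk)
  obtain ⟨g, hg, hkg⟩ := t.L.frames_cover (η k) (hT hk)
  refine ⟨_, Filter.inter_mem
    (CstarBundle.preimage_frame_mem hf s'.continuousOn hT' hk hkf)
    (CstarBundle.preimage_frame_mem hg s.continuousOn hT hk hkg), ?_⟩
  have h' := (t.φ_smooth f hf g hg).comp ((s.prodMk s').mono (Set.inter_subset_left))
    (fun k' (hk' : k' ∈ A ∩ (η' ⁻¹' f.1 ∩ η ⁻¹' g.1)) => ⟨hT hk'.1, hT' hk'.1, h k' hk'.1, hk'.2.1, hk'.2.2⟩)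
  refine h'.of_sdiv ?_
  refine SmoothUnitOn.congr (SmoothUnitOn.div (ContMDiffOn.mono (hu' f hf) ?_)
    (ContMDiffOn.mono (hu g hg) ?_)) fun k' hk' =>
      t.φ_sdiv_φ (hT hk'.1) (hT' hk'.1) (h k' hk'.1) _ _ _ _
  · exact fun k' hk' => ⟨hk'.1, hk'.2.1⟩
  · exact fun k' hk' => ⟨hk'.1, hk'.2.2⟩

end BundleGerbe.Trivialisation

end GerbeToolkit

/-! ### Vanishing in degrees one and two, and sections of bundles -/

section LowDegrees

open Set TopologicalSpace

variable {E : Type*} [NormedAddCommGroup E] [NormedSpace ℝ E] [FiniteDimensional ℝ E]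
  {M : Type*} [TopologicalSpace M] [T2Space M] [ParacompactSpace M] [ChartedSpace E M]
  [IsManifold 𝓘(ℝ, E) ∞ M]

theorem cechD_fin_one {ι M A : Type*} [AddCommGroup A] (f : (Fin 1 → ι) → M → A) (i : Fin 2 → ι)
    (x : M) : cechD f i x = f (fun _ => i 1) x - f (fun _ => i 0) x := by
  have h0 : i ∘ Fin.succAbove 0 = fun _ => i 1 := by
    funext j; rw [Subsingleton.elim j 0]; rfl
  have h1 : i ∘ Fin.succAbove 1 = fun _ => i 0 := by
    funext j; rw [Subsingleton.elim j 0]; rfl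
  rw [cechD, Fin.sum_univ_two, h0, h1]
  simp [sub_eq_add_neg]

theorem cechD_fin_two {ι M A : Type*} [AddCommGroup A] (f : ι → ι → M → A) (i : Fin 3 → ι)
    (x : M) : cechD (fun j : Fin 2 → ι => f (j 0) (j 1)) i x =
      f (i 1) (i 2) x - f (i 0) (i 2) x + f (i 0) (i 1) x := by
  simp [cechD, Fin.sum_univ_three, Fin.succAbove, sub_eq_add_neg]

theorem cechD_fin_three {ι M A : Type*} [AddCommGroup A] (f : ι → ι → ι → M → A) (i : Fin 4 → ι)
    (x : M) : cechD (fun j : Fin 3 → ι => f (j 0) (j 1) (j 2)) i x =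
      f (i 1) (i 2) (i 3) x - f (i 0) (i 2) (i 3) x + f (i 0) (i 1) (i 3) x -
        f (i 0) (i 1) (i 2) x := by
  have : cechD (fun j : Fin 3 → ι => f (j 0) (j 1) (j 2)) i x =
      (-1 : ℤ) ^ 0 • f (i 1) (i 2) (i 3) x + (-1 : ℤ) ^ 1 • f (i 0) (i 2) (i 3) x +
        (-1 : ℤ) ^ 2 • f (i 0) (i 1) (i 3) x + (-1 : ℤ) ^ 3 • f (i 0) (i 1) (i 2) x := by
    rw [cechD, Fin.sum_univ_four]; rfl
  rw [this]
  simp [sub_eq_add_neg, pow_succ]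

/-- The degree 1 vanishing in multiplicative form; it is applied to the transition functions of a
bundle. -/
theorem exists_refinement_deg_one [ContractibleSpace M] {ι : Type*} {V : ι → Set M}
    (hV : ∀ i, IsOpen (V i)) (hc : ∀ x, ∃ i, x ∈ V i) {g : ι → ι → M → ℂˣ}
    (hs : ∀ a b, SmoothUnitOn 𝓘(ℝ, E) (g a b) (V a ∩ V b))
    (hg : ∀ a b c, ∀ x ∈ V a, x ∈ V b → x ∈ V c → g b c x * g a b x = g a c x) :
    ∃ (𝒱 : PointedCover M) (r : M → ι) (z : M → M → ℂˣ), (∀ x, 𝒱.U x ⊆ V (r x)) ∧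
      (∀ x, SmoothUnitOn 𝓘(ℝ, E) (z x) (𝒱.U x)) ∧
      ∀ x y, ∀ w ∈ 𝒱.U x, w ∈ 𝒱.U y → g (r x) (r y) w = z y w / z x w := by
  have hcoc : (fun (i : Fin 2 → ι) x => Additive.ofMul (g (i 0) (i 1) x)) ∈
      cechCocycles (smoothUnits 𝓘(ℝ, E) M) V 1 := by
    refine ⟨fun i => ?_, fun i x hx => ?_⟩
    · exact ContMDiffOn.mono (hs (i 0) (i 1)) fun x hx => ⟨mem_iInter.1 hx 0, mem_iInter.1 hx 1⟩
    · have hx := mem_iInter.1 hx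
      rw [cechD_fin_two fun a b x => Additive.ofMul (g a b x), ← hg (i 0) (i 1) (i 2) x (hx 0)
        (hx 1) (hx 2), ofMul_mul]
      abel
  obtain ⟨𝒱, r, hr, f, hf, hgf⟩ := exists_refinement_boundary hV hc hcoc
  refine ⟨𝒱, r, fun x w => (f (fun _ => x) w).toMul, hr, fun x => ?_, fun x y w hx hy => ?_⟩
  · exact ContMDiffOn.mono (hf fun _ => x) fun w hw => mem_iInter.2 fun _ => hw
  · have := hgf ![x, y] w (mem_iInter.2 fun k => by fin_cases k <;> assumption)
    rw [cechD_fin_one] at this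
    exact congrArg Additive.toMul this

/-- The degree 2 vanishing in multiplicative form; it is applied to the failure of coherence between
local isomorphisms in a bundle gerbe. -/
theorem exists_refinement_deg_two [ContractibleSpace M] {ι : Type*} {V : ι → Set M}
    (hV : ∀ i, IsOpen (V i)) (hc : ∀ x, ∃ i, x ∈ V i) {g : ι → ι → ι → M → ℂˣ}
    (hs : ∀ a b c, SmoothUnitOn 𝓘(ℝ, E) (g a b c) (V a ∩ V b ∩ V c))
    (hg : ∀ a b c d, ∀ x ∈ V a, x ∈ V b → x ∈ V c → x ∈ V d →
      g a b c x * g a c d x = g b c d x * g a b d x) :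
    ∃ (𝒱 : PointedCover M) (r : M → ι) (z : M → M → M → ℂˣ), (∀ x, 𝒱.U x ⊆ V (r x)) ∧
      (∀ x y, SmoothUnitOn 𝓘(ℝ, E) (z x y) (𝒱.U x ∩ 𝒱.U y)) ∧
      ∀ x y t, ∀ w ∈ 𝒱.U x, w ∈ 𝒱.U y → w ∈ 𝒱.U t →
        g (r x) (r y) (r t) w * z x t w = z y t w * z x y w := by
  have hcoc : (fun (i : Fin 3 → ι) x => Additive.ofMul (g (i 0) (i 1) (i 2) x)) ∈
      cechCocycles (smoothUnits 𝓘(ℝ, E) M) V 2 := by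
    refine ⟨fun i => ?_, fun i x hx => ?_⟩
    · exact ContMDiffOn.mono (hs (i 0) (i 1) (i 2))
        fun x hx => ⟨⟨mem_iInter.1 hx 0, mem_iInter.1 hx 1⟩, mem_iInter.1 hx 2⟩
    · have hx := mem_iInter.1 hx
      have := congrArg Additive.ofMul (hg (i 0) (i 1) (i 2) (i 3) x (hx 0) (hx 1) (hx 2) (hx 3))
      rw [ofMul_mul, ofMul_mul] at this
      rw [cechD_fin_three fun a b c x => Additive.ofMul (g a b c x), sub_eq_zero,
        sub_add_eq_add_sub, sub_eq_iff_eq_add, ← this]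
  obtain ⟨𝒱, r, hr, f, hf, hgf⟩ := exists_refinement_boundary hV hc hcoc
  refine ⟨𝒱, r, fun x y w => (f ![x, y] w).toMul, hr, fun x y => ?_,
    fun x y t w hx hy ht => ?_⟩
  · exact ContMDiffOn.mono (hf ![x, y]) fun w hw => mem_iInter.2 fun k => by
      fin_cases k
      exacts [hw.1, hw.2]
  · have := hgf ![x, y, t] w (mem_iInter.2 fun k => by fin_cases k <;> assumption)
    have e : f = fun j => (fun a b => f ![a, b]) (j 0) (j 1) := by
      funext j
      exact congrArg f (by funext k; fin_cases k <;> rfl)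
    rw [e, cechD_fin_two fun a b => f ![a, b]] at this
    have h2 : Additive.ofMul (g (r x) (r y) (r t) w) =
      f ![y, t] w - f ![x, t] w + f ![x, y] w := this
    have h3 : Additive.ofMul (g (r x) (r y) (r t) w) + f ![x, t] w = f ![y, t] w + f ![x, y] w := by
      rw [h2]; abel
    exact congrArg Additive.toMul h3

/-- A `ℂˣ`-bundle has a smooth section over a contractible open set. -/
theorem CstarBundle.exists_smoothAlong {E' : Type*} [NormedAddCommGroup E'] [NormedSpace ℝ E']
    {H : Type*} [TopologicalSpace H] {I : ModelWithCorners ℝ E' H} {N : Type*} [TopologicalSpace N]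
    [ChartedSpace H N] {S : Set N} (P : CstarBundle.{w} I S) {U : Set M} (hU : IsOpen U)
    (hUc : U = ∅ ∨ ContractibleSpace U) {c : M → N} (hc : ContMDiffOn 𝓘(ℝ, E) I ∞ c U)
    (hcS : MapsTo c U S) :
    ∃ τ : ∀ k, P.Fib (c k), P.SmoothAlong 𝓘(ℝ, E) c τ U := by
  classical
  rcases hUc with rfl | hUc
  · exact ⟨fun k => Classical.arbitrary _, fun f _ k hk => hk.1.elim⟩
  let D : Opens M := ⟨U, hU⟩
  have : ContractibleSpace D := hUc
  have : ParacompactSpace D := paracompactSpace_of_isPreconnected E D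
    (isPreconnected_iff_preconnectedSpace.2 (inferInstanceAs (PreconnectedSpace D)))
  choose f hf hxf using fun x : D => P.frames_cover (c x) (hcS x.2)
  have hmem : ∀ x : D, ∀ y ∈ U, c y ∈ (f x).1 → c ⁻¹' (f x).1 ∈ 𝓝[U] y := fun x y hy hyf =>
    preimage_frame_mem (hf x) hc.continuousOn hcS hy hyf
  let V : D → Set D := fun x => {y | c y ∈ (f x).1}
  have hV : ∀ x, IsOpen (V x) := by
    intro x
    refine isOpen_iff_mem_nhds.2 fun y hy => ?_
    have := hmem x y y.2 hy
    rw [hU.nhdsWithin_eq y.2] at this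
    exact continuous_subtype_val.continuousAt.preimage_mem_nhds this
  have hfr : ∀ x, P.SmoothAlong 𝓘(ℝ, E) (fun y : D => c y) (fun y => (f x).2 (c y)) (V x) := by
    intro x
    refine smoothAlong_frame (hf x) ?_ (fun y _ => hcS y.2) fun y hy => hy
    exact hc.comp contMDiff_subtype_val.contMDiffOn fun y _ => y.2
  have hcD : ContinuousOn (fun y : D => c y) univ :=
    hc.continuousOn.comp continuous_subtype_val.continuousOn fun y _ => y.2
  obtain ⟨𝒱, r, z, hr, hz, hgz⟩ := exists_refinement_deg_one (E := E) hV
    (fun x => ⟨x, hxf x⟩) (g := fun a b y => (f b).2 (c y) /ₛ (f a).2 (c y)) (fun a b =>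
      ((hfr b).mono inter_subset_right).sdiv ((hfr a).mono inter_subset_left)
        (hcD.mono (subset_univ _)) fun y _ => hcS y.2)
    (fun a b d x _ _ _ => sdiv_mul_sdiv_cancel _ _ _)
  -- Each point uses the frame attached to itself as an index, corrected by its own `z`. The
  -- coboundary relation shows in `hτ` that any other index whose member contains the point gives
  -- the same element, so near `x` the section is a smooth multiple of one frame.
  let τ : ∀ k, P.Fib (c k) := fun k =>
    if h : k ∈ U then (z ⟨k, h⟩ ⟨k, h⟩)⁻¹ • (f (r ⟨k, h⟩)).2 (c k) else Classical.arbitrary _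
  have hτ : ∀ x y : D, y ∈ 𝒱.U x → τ y = (z x y)⁻¹ • (f (r x)).2 (c y) := by
    intro x y hy
    have h1 : τ y = (z y y)⁻¹ • (f (r y)).2 (c y) := dif_pos y.2
    have h2 := hgz x y y hy (𝒱.mem y)
    rw [h1, ← sdiv_smul ((f (r y)).2 (c y)) ((f (r x)).2 (c y)), h2, smul_smul]
    congr 1
    rw [inv_mul_eq_iff_eq_mul, div_eq_mul_inv]
  refine ⟨τ, SmoothAlong.of_local fun k hk => ?_⟩
  let x : D := ⟨k, hk⟩
  refine ⟨Subtype.val '' 𝒱.U x, mem_nhdsWithin_of_mem_nhds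
    ((hU.isOpenMap_subtype_val _ (𝒱.isOpen x)).mem_nhds ⟨x, 𝒱.mem x, rfl⟩), ?_⟩
  have hsub : U ∩ Subtype.val '' 𝒱.U x ⊆ U := inter_subset_left
  refine (smoothAlong_frame (hf (r x)) (hc.mono hsub) (hcS.mono_left hsub) ?_).of_sdiv ?_
  · rintro _ ⟨-, y, hy, rfl⟩
    exact hr x hy
  · rintro _ ⟨-, y, hy, rfl⟩
    refine ContMDiffAt.contMDiffWithinAt ((contMDiffAt_subtype_iff (U := D)).1 ?_)
    have h1 := ((hz x).inv y hy).contMDiffAt ((𝒱.isOpen x).mem_nhds hy)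
    refine h1.congr_of_eventuallyEq ?_
    filter_upwards [(𝒱.isOpen x).mem_nhds hy] with y' hy'
    rw [hτ x y' hy', smul_sdiv]

end LowDegrees

/-! ### Trivialising bundle gerbes over contractible manifolds -/

section Trivialisations

open Set TopologicalSpace

/-- Glued bundles take the lifted group itself as every fibre, in the required universe; the whole
geometry sits in their frames. -/
instance : Torsor ℂˣ (ULift.{w} ℂˣ) :=
  { (inferInstance : MulAction ℂˣ (ULift.{w} ℂˣ)) with
    sdiv := fun u v => u.down / v.down
    nonempty := ⟨⟨1⟩⟩
    sdiv_smul' := fun _ _ => ULift.ext _ _ (div_mul_cancel _ _)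
    smul_sdiv' := fun _ _ => mul_div_cancel_right _ _ }

theorem ulift_sdiv (u v : ULift.{w} ℂˣ) : u /ₛ v = u.down / v.down := rfl

variable {EN : Type*} [NormedAddCommGroup EN] [NormedSpace ℝ EN] {HN : Type*} [TopologicalSpace HN]
  {EY : Type*} [NormedAddCommGroup EY] [NormedSpace ℝ EY] {HY : Type*} [TopologicalSpace HY]
  {IN : ModelWithCorners ℝ EN HN} {N : Type*} [TopologicalSpace N]
  [ChartedSpace HN N] {B : Set N} {IY : ModelWithCorners ℝ EY HY} {Y : Type*}
  [TopologicalSpace Y] [ChartedSpace HY Y]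
  {E : Type*} [NormedAddCommGroup E] [NormedSpace ℝ E] {D : Type*} [TopologicalSpace D]
  [ChartedSpace E D]

/-- A trivialisation of a bundle gerbe, glued from local sections `η α` of `Y` and a coherent
family `p` of isomorphisms between them. -/
theorem BundleGerbe.nonempty_trivialisation_of_descent (G : BundleGerbe.{w} IN B IY Y) {s : D → N}
    (hsi : Function.Injective s) {T : Set Y} {q : Y → D}
    (hT : ∀ y ∈ T, G.proj y = s (q y)) (hq : ContMDiffOn IY 𝓘(ℝ, E) ∞ q T) (𝒱 : PointedCover D)
    (η : D → D → Y) (hη : ∀ α, ContMDiffOn 𝓘(ℝ, E) IY ∞ (η α) (𝒱.U α))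
    (hηs : ∀ α, ∀ x ∈ 𝒱.U α, G.proj (η α x) = s x)
    (p : ∀ α β x, G.bundle.Fib (η α x, η β x))
    (hp : ∀ α β, G.bundle.SmoothAlong 𝓘(ℝ, E) (fun x => (η α x, η β x)) (p α β)
      (𝒱.U α ∩ 𝒱.U β))
    (hpp : ∀ α β γ, ∀ x ∈ 𝒱.U α, x ∈ 𝒱.U β → x ∈ 𝒱.U γ →
      G.mul (p β γ x) (p α β x) = p α γ x) : Nonempty (G.Trivialisation T) := by
  rcases T.eq_empty_or_nonempty with rfl | ⟨yT, hyT⟩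
  · refine ⟨⟨⟨fun _ => ULift.{w} ℂˣ, ∅, ?_, ?_, ?_⟩, fun _ _ => Classical.arbitrary _,
      ?_, ?_, ?_⟩⟩
    · exact fun _ h => h.elim
    · exact fun _ h => h.elim
    · exact fun _ h => h.elim
    · exact fun h => h.elim
    · exact fun _ h => h.elim
    · exact fun h => h.elim
  have hB : ∀ x, ∃ y, G.proj y = s x := fun x => ⟨η x x, hηs x x (𝒱.mem x)⟩
  choose y₀ hy₀ using hB
  -- The fibre of the glued bundle at `y` should be the fibre of `P` at `(y₀ (q y), y)`. The
  -- reference elements `b` identify it with the group; they are chosen pointwise without smoothness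
  -- and cancel from every quotient of frames.
  obtain ⟨b⟩ : Nonempty (∀ (x : D) (y : Y), G.bundle.Fib (y₀ x, y)) :=
    ⟨fun _ _ => Classical.arbitrary _⟩
  -- These connect the reference point to the local sections. Routing them through the index `x`
  -- itself makes them compatible with `p`, by coherence.
  let c : ∀ α x, G.bundle.Fib (y₀ x, η α x) := fun α x => G.mul (p x α x) (b x (η x x))
  have hc : ∀ α β, ∀ x ∈ 𝒱.U α, x ∈ 𝒱.U β → c β x = G.mul (p α β x) (c α x) := by
    intro α β x hα hβ
    have hx := 𝒱.mem x
    simp only [c]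
    rw [G.mul_assoc ((hy₀ x).trans (hηs x x hx).symm) ((hηs x x hx).trans (hηs α x hα).symm)
      ((hηs α x hα).trans (hηs β x hβ).symm), hpp x α β x hx hα hβ]
  let F : D → (Set (Y × Y) × (∀ z, G.bundle.Fib z)) → ∀ _ : Y, ULift.{w} ℂˣ := fun α f y =>
    ⟨G.mul (f.2 (η α (q y), y)) (c α (q y)) /ₛ b (q y) y⟩
  let V : D → (Set (Y × Y) × (∀ z, G.bundle.Fib z)) → Set Y := fun α f =>
    {y | q y ∈ 𝒱.U α ∧ (η α (q y), y) ∈ f.1}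
  have hηq : ∀ α, ContMDiffOn IY IY ∞ (fun y => η α (q y)) (T ∩ q ⁻¹' 𝒱.U α) := fun α =>
    (hη α).comp (hq.mono inter_subset_left) fun y hy => hy.2
  have hηT : ∀ α y, y ∈ T → q y ∈ 𝒱.U α → G.proj (η α (q y)) = G.proj y := fun α y hy hα =>
    (hηs α _ hα).trans (hT y hy).symm
  -- the isomorphisms between the fibres
  have hΘ : ∀ y y' : Y, ∃ θ : G.bundle.Fib (y, y'), ∀ x, G.proj y = s x → G.proj y' = s x →
      G.mul θ (b x y) = b x y' := by
    intro y y'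
    by_cases h : ∃ x, G.proj y = s x ∧ G.proj y' = s x
    · obtain ⟨x, hx, hx'⟩ := h
      obtain ⟨θ, hθ⟩ := G.exists_mul_eq ((hy₀ x).trans hx.symm) (hx.trans hx'.symm) (b x y) (b x y')
      refine ⟨θ, fun x' h' _ => ?_⟩
      obtain rfl : x = x' := hsi (hx.symm.trans h')
      exact hθ
    · exact ⟨Classical.arbitrary _, fun x hx hx' => (h ⟨x, hx, hx'⟩).elim⟩
  choose Θ hΘ using hΘ
  have hsmooth : ∀ α β, ∀ f ∈ G.bundle.frames, ∀ g ∈ G.bundle.frames,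
      SmoothUnitOn IY (fun y => F α f y /ₛ F β g y) (V α f ∩ V β g ∩ T) := by
    intro α β f hf g hg
    have hα : V α f ∩ V β g ∩ T ⊆ T ∩ q ⁻¹' 𝒱.U α := fun y hy => ⟨hy.2, hy.1.1.1⟩
    have hβ : V α f ∩ V β g ∩ T ⊆ T ∩ q ⁻¹' 𝒱.U β := fun y hy => ⟨hy.2, hy.1.2.1⟩
    have s1 := (hηq α).mono hα
    have s2 := (hηq β).mono hβ
    have s3 : ContMDiffOn IY IY ∞ (fun y : Y => y) (V α f ∩ V β g ∩ T) := contMDiffOn_id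
    have e1 : ∀ y ∈ V α f ∩ V β g ∩ T, G.proj (η α (q y)) = G.proj y := fun y hy =>
      hηT α y hy.2 hy.1.1.1
    have e2 : ∀ y ∈ V α f ∩ V β g ∩ T, G.proj (η β (q y)) = G.proj y := fun y hy =>
      hηT β y hy.2 hy.1.2.1
    have h12 := fun y hy => (e1 y hy).trans (e2 y hy).symm
    have hfs := CstarBundle.smoothAlong_frame hf (s1.prodMk s3) (mapsTo_pair e1)
      fun y hy => hy.1.1.2
    have hgs := CstarBundle.smoothAlong_frame hg (s2.prodMk s3) (mapsTo_pair e2)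
      fun y hy => hy.1.2.2
    have hps : G.bundle.SmoothAlong IY (fun y => (η α (q y), η β (q y)))
        (fun y => p α β (q y)) (V α f ∩ V β g ∩ T) :=
      (hp α β).comp (hq.mono inter_subset_right) fun y hy => ⟨hy.1.1.1, hy.1.2.1⟩
    -- In the quotient of two frames both `b` and `c α` cancel; what remains is `f` divided by `g ·
    -- p`, formed from smooth sections only.
    refine (hfs.sdiv (smoothAlong_mul s1 s2 s3 h12 e2 hgs hps) (s1.prodMk s3).continuousOn
      (mapsTo_pair e1)).congr fun y hy => ?_
    have e0 : G.proj (y₀ (q y)) = G.proj (η α (q y)) :=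
      (hy₀ _).trans ((hT y hy.2).symm.trans (e1 y hy).symm)
    rw [ulift_sdiv]
    simp only [F]
    rw [sdiv_div_sdiv_cancel_right, hc α β _ hy.1.1.1 hy.1.2.1, G.mul_assoc e0 (h12 y hy) (e2 y hy),
      G.mul_sdiv_mul_right e0 (e1 y hy)]
  refine ⟨⟨⟨fun _ => ULift.{w} ℂˣ, {φ | ∃ α, ∃ f ∈ G.bundle.frames, φ = (V α f, F α f)}, ?_, ?_, ?_⟩,
    fun {y y'} u' u => (u' /ₛ u) • Θ y y', ?_, ?_, ?_⟩⟩
  · rintro _ ⟨α, f, hf, rfl⟩ y ⟨⟨hyα, hyf⟩, hyT⟩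
    have h1 : q ⁻¹' 𝒱.U α ∈ 𝓝[T] y := (hq.continuousOn y hyT) ((𝒱.isOpen α).mem_nhds hyα)
    have h2 := CstarBundle.preimage_frame_mem hf ((hηq α).prodMk contMDiffOn_id).continuousOn
      (mapsTo_pair (η₂ := fun y => y) fun y hy => hηT α y hy.1 hy.2) ⟨hyT, hyα⟩ hyf
    rw [Set.inter_comm, nhdsWithin_inter_of_mem h1] at h2
    exact Filter.inter_mem h1 h2
  · intro y hy
    obtain ⟨f, hf, hyf⟩ := G.bundle.frames_cover (η (q y) (q y), y) (hηT _ y hy (𝒱.mem _))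
    exact ⟨_, ⟨q y, f, hf, rfl⟩, 𝒱.mem _, hyf⟩
  · rintro _ ⟨α, f, hf, rfl⟩ _ ⟨β, g, hg, rfl⟩
    exact hsmooth α β f hf g hg
  · intro y y' _ _ _ z z' u' u
    rw [smul_sdiv_assoc, sdiv_smul_eq_sdiv_div, smul_smul]
    congr 1
    rw [div_eq_mul_inv, _root_.mul_assoc, mul_comm (u' /ₛ u)]
  · rintro _ ⟨β, g, hg, rfl⟩ _ ⟨α, f, hf, rfl⟩
    set A : Set (Y × Y) := {t | t.1 ∈ T ∧ t.2 ∈ T ∧ G.proj t.1 = G.proj t.2 ∧ t.2 ∈ V β g ∧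
      t.1 ∈ V α f} with hA
    have hqq : ∀ t ∈ A, q t.2 = q t.1 := fun t ht =>
      hsi ((hT _ ht.2.1).symm.trans (ht.2.2.1.symm.trans (hT _ ht.1)))
    have sf : ContMDiffOn (IY.prod IY) IY ∞ (Prod.fst : Y × Y → Y) A := contMDiffOn_fst
    have ss : ContMDiffOn (IY.prod IY) IY ∞ (Prod.snd : Y × Y → Y) A := contMDiffOn_snd
    have s1 : ContMDiffOn (IY.prod IY) IY ∞ (fun t : Y × Y => η α (q t.1)) A :=
      (hηq α).comp sf fun t ht => ⟨ht.1, ht.2.2.2.2.1⟩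
    have s2 : ContMDiffOn (IY.prod IY) IY ∞ (fun t : Y × Y => η β (q t.2)) A :=
      (hηq β).comp ss fun t ht => ⟨ht.2.1, ht.2.2.2.1.1⟩
    have e1 : ∀ t ∈ A, G.proj (η α (q t.1)) = G.proj t.1 := fun t ht =>
      hηT α t.1 ht.1 ht.2.2.2.2.1
    have e2 : ∀ t ∈ A, G.proj (η β (q t.2)) = G.proj t.2 := fun t ht =>
      hηT β t.2 ht.2.1 ht.2.2.2.1.1
    have e3 : ∀ t ∈ A, G.proj t.1 = G.proj t.2 := fun t ht => ht.2.2.1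
    have hfs := CstarBundle.smoothAlong_frame hf (s1.prodMk sf) (mapsTo_pair e1)
      fun t ht => ht.2.2.2.2.2
    have hgs := CstarBundle.smoothAlong_frame hg (s2.prodMk ss) (mapsTo_pair e2)
      fun t ht => ht.2.2.2.1.2
    have hps : G.bundle.SmoothAlong (IY.prod IY) (fun t : Y × Y => (η α (q t.1), η β (q t.1)))
        (fun t => p α β (q t.1)) A :=
      (hp α β).comp (hq.comp sf fun t ht => ht.1)
        fun t ht => ⟨ht.2.2.2.2.1, hqq t ht ▸ ht.2.2.2.1.1⟩
    have s2' : ContMDiffOn (IY.prod IY) IY ∞ (fun t : Y × Y => η β (q t.1)) A :=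
      s2.congr fun t ht => by rw [hqq t ht]
    have e2' : ∀ t ∈ A, G.proj (η β (q t.1)) = G.proj t.2 := fun t ht => by
      rw [← hqq t ht]; exact e2 t ht
    have hgs' : G.bundle.SmoothAlong (IY.prod IY) (fun t : Y × Y => (η β (q t.1), t.2))
        (fun t => g.2 (η β (q t.1), t.2)) A :=
      CstarBundle.smoothAlong_frame hg (s2'.prodMk ss) (mapsTo_pair e2')
        fun t ht => by
          have h := ht.2.2.2.1.2
          rw [hqq t ht] at h
          exact h
    have hmul := smoothAlong_mul s1 s2' ss
      (fun t ht => (e1 t ht).trans ((e3 t ht).trans (e2' t ht).symm)) e2' hgs' hps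
    -- Multiplying `φ` of the two frames by the smooth section `f` gives `g · p`, so `φ` is smooth
    -- by division. The identity itself is checked after composing with `c α`, where the non-smooth
    -- references drop out.
    refine smoothAlong_of_mul s1 sf ss e1 e3 (hmul.congr fun t ht => ?_) hfs
    have hx : ∀ x, q t.2 = x → F β g t.2 =
        ⟨G.mul (g.2 (η β x, t.2)) (c β x) /ₛ b x t.2⟩ := by
      rintro _ rfl; rfl
    have h0 : G.proj (y₀ (q t.1)) = G.proj t.1 := (hy₀ _).trans (hT _ ht.1).symm
    have hxβ : q t.1 ∈ 𝒱.U β := hqq t ht ▸ ht.2.2.2.1.1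
    refine G.mul_right_cancel (q := c α (q t.1)) (h0.trans (e1 t ht).symm)
      ((e1 t ht).trans (e3 t ht)) ?_
    rw [← G.mul_assoc (h0.trans (e1 t ht).symm) (e1 t ht) (e3 t ht),
      ← G.mul_assoc (h0.trans (e1 t ht).symm) ((e1 t ht).trans ((e3 t ht).trans (e2' t ht).symm))
        (e2' t ht), ← hc α β _ ht.2.2.2.2.1 hxβ, G.smul_mul h0 (e3 t ht)]
    change (F β g t.2 /ₛ F α f t.1) • _ = _
    rw [hx _ (hqq t ht),
      ← sdiv_smul (G.mul (f.2 (η α (q t.1), t.1)) (c α (q t.1))) (b (q t.1) t.1),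
      G.mul_smul_right h0 (e3 t ht), hΘ t.1 t.2 _ (hT _ ht.1) ((e3 t ht).symm.trans (hT _ ht.1)),
      smul_smul, ulift_sdiv]
    simp only [F]
    rw [div_mul_cancel, sdiv_smul]
  · intro y₁ y₂ y₃ h₁ h₂ h₃ h₁₂ h₂₃ u₃ u₂ u₁
    rw [G.mul_smul h₁₂ h₂₃, sdiv_mul_sdiv_cancel]
    congr 1
    have hx := hT _ h₁
    have h0 : G.proj (y₀ (q y₁)) = G.proj y₁ := (hy₀ _).trans hx.symm
    refine G.mul_right_cancel (q := b (q y₁) y₁) h0 (h₁₂.trans h₂₃) ?_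
    rw [← G.mul_assoc h0 h₁₂ h₂₃, hΘ y₁ y₂ _ hx (h₁₂.symm.trans hx),
      hΘ y₂ y₃ _ (h₁₂.symm.trans hx) (h₂₃.symm.trans (h₁₂.symm.trans hx)),
      hΘ y₁ y₃ _ hx (h₂₃.symm.trans (h₁₂.symm.trans hx))]

theorem IsGoodFamily.inter {X ι : Type*} [TopologicalSpace X] {U : ι → Set X} (h : IsGoodFamily U)
    (i j : ι) : U i ∩ U j = ∅ ∨ ContractibleSpace ↥(U i ∩ U j) := by
  have e : ⋂ k, U (![i, j] k) = U i ∩ U j := by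
    ext x; simp [Fin.forall_fin_two]
  rw [← e]
  exact h 1 ![i, j]

theorem IsGoodFamily.inter₃ {X ι : Type*} [TopologicalSpace X] {U : ι → Set X}
    (h : IsGoodFamily U) (i j k : ι) :
    U i ∩ U j ∩ U k = ∅ ∨ ContractibleSpace ↥(U i ∩ U j ∩ U k) := by
  have e : ⋂ l, U (![i, j, k] l) = U i ∩ U j ∩ U k := by
    ext x; simp [Fin.forall_fin_succ, and_assoc]
  rw [← e]
  exact h 2 ![i, j, k]

/-- A bundle gerbe over a contractible manifold has a trivialisation. -/
theorem BundleGerbe.nonempty_trivialisation [FiniteDimensional ℝ E] [T2Space D] [ParacompactSpace D]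
    [IsManifold 𝓘(ℝ, E) ∞ D] [ContractibleSpace D] (G : BundleGerbe.{w} IN B IY Y) {s : D → N}
    (hs : ContMDiff 𝓘(ℝ, E) IN ∞ s) (hsB : ∀ x, s x ∈ B) (hsi : Function.Injective s) {T : Set Y}
    {q : Y → D} (hT : ∀ y ∈ T, G.proj y = s (q y)) (hq : ContMDiffOn IY 𝓘(ℝ, E) ∞ q T) :
    Nonempty (G.Trivialisation T) := by
  choose V hV t ht htp using fun x => G.local_sections (s x) (hsB x)
  have hsV : ∀ x, s ⁻¹' V x ∈ 𝓝 x := fun x => by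
    have := hs.continuous.continuousAt.continuousWithinAt.tendsto_nhdsWithin
      (s := univ) (x := x) (t := B) (fun y _ => hsB y)
    rw [nhdsWithin_univ] at this
    exact this (hV x)
  obtain ⟨𝒲, r, hr, hW⟩ := exists_good_refinement E (fun x => interior (s ⁻¹' V x))
    (fun _ => isOpen_interior) fun x => ⟨x, mem_interior_iff_mem_nhds.2 (hsV x)⟩
  let η : D → D → Y := fun x y => t (r x) (s y)
  have hrV : ∀ x, ∀ y ∈ 𝒲.U x, s y ∈ V (r x) ∩ B := fun x y hy =>
    ⟨(interior_subset (hr x hy) : y ∈ s ⁻¹' V (r x)), hsB y⟩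
  have hη : ∀ x, ContMDiffOn 𝓘(ℝ, E) IY ∞ (η x) (𝒲.U x) := fun x =>
    (ht (r x)).comp hs.contMDiffOn (hrV x)
  have hηs : ∀ x, ∀ y ∈ 𝒲.U x, G.proj (η x y) = s y := fun x y hy => htp _ _ (hrV x y hy)
  have hpr : ∀ x y, ∀ k ∈ 𝒲.U x ∩ 𝒲.U y, G.proj (η x k) = G.proj (η y k) := fun x y k hk =>
    (hηs x k hk.1).trans (hηs y k hk.2).symm
  -- Degree 1 is used here: over the contractible double intersections the bundle has smooth
  -- sections, which compare the local sections `η` but need not be coherent.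
  choose p hp using fun x y => G.bundle.exists_smoothAlong (E := E)
    ((𝒲.isOpen x).inter (𝒲.isOpen y)) (hW.inter x y)
    (((hη x).mono inter_subset_left).prodMk ((hη y).mono inter_subset_right))
    (mapsTo_pair (hpr x y))
  let g : D → D → D → D → ℂˣ := fun x y z k => G.mul (p y z k) (p x y k) /ₛ p x z k
  have hg : ∀ x y z k, G.mul (p y z k) (p x y k) = g x y z k • p x z k :=
    fun x y z k => (sdiv_smul _ _).symm
  obtain ⟨𝒱, ρ, z, hρ, hz, hgz⟩ := exists_refinement_deg_two (E := E) 𝒲.isOpen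
    (fun x => ⟨x, 𝒲.mem x⟩) (g := g) (fun a b c => by
      have h1 : 𝒲.U a ∩ 𝒲.U b ∩ 𝒲.U c ⊆ 𝒲.U a := fun x hx => hx.1.1
      have h2 : 𝒲.U a ∩ 𝒲.U b ∩ 𝒲.U c ⊆ 𝒲.U b := fun x hx => hx.1.2
      have h3 : 𝒲.U a ∩ 𝒲.U b ∩ 𝒲.U c ⊆ 𝒲.U c := fun x hx => hx.2
      exact (smoothAlong_mul ((hη a).mono h1) ((hη b).mono h2) ((hη c).mono h3)
        (fun k hk => hpr a b k hk.1) (fun k hk => hpr b c k ⟨hk.1.2, hk.2⟩)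
        ((hp b c).mono fun k hk => ⟨hk.1.2, hk.2⟩) ((hp a b).mono inter_subset_left)).sdiv
        ((hp a c).mono fun k hk => ⟨hk.1.1, hk.2⟩)
        (((hη a).mono h1).prodMk ((hη c).mono h3)).continuousOn
        (mapsTo_pair fun k hk => hpr a c k ⟨hk.1.1, hk.2⟩))
    -- Associativity of the product, applied to a triple composition of the `p`, is the 2-cocycle
    -- condition for the defect `g`.
    (fun a b c d x ha hb hc hd => by
      have h := G.mul_assoc (hpr a b x ⟨ha, hb⟩) (hpr b c x ⟨hb, hc⟩) (hpr c d x ⟨hc, hd⟩)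
        (p c d x) (p b c x) (p a b x)
      rw [hg a b c, hg b c d, G.mul_smul_right (hpr a c x ⟨ha, hc⟩) (hpr c d x ⟨hc, hd⟩),
        G.smul_mul (hpr a b x ⟨ha, hb⟩) (hpr b d x ⟨hb, hd⟩), hg a c d, hg a b d, smul_smul,
        smul_smul] at h
      exact smul_right_cancel _ h)
  refine G.nonempty_trivialisation_of_descent hsi hT hq 𝒱 (fun x => η (ρ x))
    (fun x => (hη _).mono (hρ x)) (fun x y hy => hηs _ y (hρ x hy))
    -- Dividing by the cochain that bounds the defect makes the comparison isomorphisms coherent.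
    (fun a b x => (z a b x)⁻¹ • p (ρ a) (ρ b) x)
    (fun a b => ((hp _ _).mono (inter_subset_inter (hρ a) (hρ b))).smul (hz a b).inv)
    fun a b c x ha hb hc => ?_
  have ha' := hρ a ha
  have hb' := hρ b hb
  have hc' := hρ c hc
  rw [G.mul_smul (hpr _ _ x ⟨ha', hb'⟩) (hpr _ _ x ⟨hb', hc'⟩), hg, smul_smul]
  congr 1
  have := hgz a b c x ha hb hc
  rw [← mul_inv, inv_mul_eq_iff_eq_mul, ← this, mul_inv_cancel_right]

end Trivialisations

/-! ### Calculus with descended bundles -/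

section TwoGerbeToolkit

open Set TopologicalSpace

/-- The base maps agree only on `A`, so the fibres over `c k` and `c' k` may differ elsewhere; a
family `τ k` defined on all fibres avoids transporting elements. -/
theorem CstarBundle.SmoothAlong.congr_base {E : Type*} [NormedAddCommGroup E] [NormedSpace ℝ E]
    {H : Type*} [TopologicalSpace H] {I : ModelWithCorners ℝ E H} {N : Type*} [TopologicalSpace N]
    [ChartedSpace H N] {S : Set N} {E' : Type*} [NormedAddCommGroup E'] [NormedSpace ℝ E']
    {H' : Type*} [TopologicalSpace H'] {J : ModelWithCorners ℝ E' H'} {K : Type*}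
    [TopologicalSpace K] [ChartedSpace H' K] {P : CstarBundle.{w} I S} {c c' : K → N} {A : Set K}
    {τ : ∀ (_ : K) (b : N), P.Fib b} (h : P.SmoothAlong J c (fun k => τ k (c k)) A)
    (hc : ∀ k ∈ A, c' k = c k) : P.SmoothAlong J c' (fun k => τ k (c' k)) A := by
  intro f hf
  have e : A ∩ c' ⁻¹' f.1 = A ∩ c ⁻¹' f.1 := by
    ext k
    exact and_congr_right fun hk => by rw [mem_preimage, mem_preimage, hc k hk]
  rw [e]
  refine ContMDiffOn.congr (h f hf) fun k hk => ?_
  have : ∀ x y, x = y → (τ k x /ₛ f.2 x) = (τ k y /ₛ f.2 y) := by rintro x _ rfl; rfl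
  rw [this _ _ (hc k hk.1)]

variable {EM : Type*} [NormedAddCommGroup EM] [NormedSpace ℝ EM] {HM : Type*} [TopologicalSpace HM]
  {EX : Type*} [NormedAddCommGroup EX] [NormedSpace ℝ EX] {HX : Type*} [TopologicalSpace HX]
  {EY : Type*} [NormedAddCommGroup EY] [NormedSpace ℝ EY] {HY : Type*} [TopologicalSpace HY]
  {IM : ModelWithCorners ℝ EM HM} {M : Type u} [TopologicalSpace M] [ChartedSpace HM M]
  {IX : ModelWithCorners ℝ EX HX} {X : Type uX} [TopologicalSpace X] [ChartedSpace HX X]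
  {IY : ModelWithCorners ℝ EY HY} {Y : Type uY} [TopologicalSpace Y] [ChartedSpace HY Y]
  {E' : Type*} [NormedAddCommGroup E'] [NormedSpace ℝ E'] {H' : Type*} [TopologicalSpace H']
  {J : ModelWithCorners ℝ E' H'} {K : Type*} [TopologicalSpace K] [ChartedSpace H' K]
  {A : Set K}

namespace Bundle2Gerbe

variable {𝒢 : Bundle2Gerbe.{u, uX, uY, w} IM M IX X IY Y}

theorem mHat_sdiv_mHat {y₂₃ y₂₃' y₁₂ y₁₂' : Y} (h₁ : 𝒢.gerbe.proj y₂₃ = 𝒢.gerbe.proj y₂₃')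
    (h₂ : 𝒢.gerbe.proj y₁₂ = 𝒢.gerbe.proj y₁₂')
    (h : (𝒢.gerbe.proj y₁₂).2 = (𝒢.gerbe.proj y₂₃).1)
    (p p' : 𝒢.gerbe.bundle.Fib (y₂₃, y₂₃')) (q q' : 𝒢.gerbe.bundle.Fib (y₁₂, y₁₂')) :
    𝒢.mHat p q /ₛ 𝒢.mHat p' q' = (p /ₛ p') * (q /ₛ q') := by
  conv_lhs => rw [← sdiv_smul p p', ← sdiv_smul q q', 𝒢.mHat_smul h₁ h₂ h, smul_sdiv]

theorem contMDiffOn_m {η₂₃ η₁₂ : K → Y} (s₂₃ : ContMDiffOn J IY ∞ η₂₃ A)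
    (s₁₂ : ContMDiffOn J IY ∞ η₁₂ A)
    (h : ∀ k ∈ A, (𝒢.gerbe.proj (η₁₂ k)).2 = (𝒢.gerbe.proj (η₂₃ k)).1) :
    ContMDiffOn J IY ∞ (fun k => 𝒢.m (η₂₃ k) (η₁₂ k)) A :=
  𝒢.m_smooth.comp (s₂₃.prodMk s₁₂) h

theorem smoothAlong_mHat {η₂₃ η₂₃' η₁₂ η₁₂' : K → Y} (s₂₃ : ContMDiffOn J IY ∞ η₂₃ A)
    (s₂₃' : ContMDiffOn J IY ∞ η₂₃' A) (s₁₂ : ContMDiffOn J IY ∞ η₁₂ A)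
    (s₁₂' : ContMDiffOn J IY ∞ η₁₂' A)
    (h₁ : ∀ k ∈ A, 𝒢.gerbe.proj (η₂₃ k) = 𝒢.gerbe.proj (η₂₃' k))
    (h₂ : ∀ k ∈ A, 𝒢.gerbe.proj (η₁₂ k) = 𝒢.gerbe.proj (η₁₂' k))
    (h : ∀ k ∈ A, (𝒢.gerbe.proj (η₁₂ k)).2 = (𝒢.gerbe.proj (η₂₃ k)).1)
    {p : ∀ k, 𝒢.gerbe.bundle.Fib (η₂₃ k, η₂₃' k)} {q : ∀ k, 𝒢.gerbe.bundle.Fib (η₁₂ k, η₁₂' k)}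
    (hp : 𝒢.gerbe.bundle.SmoothAlong J (fun k => (η₂₃ k, η₂₃' k)) p A)
    (hq : 𝒢.gerbe.bundle.SmoothAlong J (fun k => (η₁₂ k, η₁₂' k)) q A) :
    𝒢.gerbe.bundle.SmoothAlong J (fun k => (𝒢.m (η₂₃ k) (η₁₂ k), 𝒢.m (η₂₃' k) (η₁₂' k)))
      (fun k => 𝒢.mHat (p k) (q k)) A := by
  refine CstarBundle.SmoothAlong.of_local fun k hk => ?_
  obtain ⟨f, hf, hkf⟩ := 𝒢.gerbe.bundle.frames_cover (η₂₃ k, η₂₃' k) (h₁ k hk)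
  obtain ⟨g, hg, hkg⟩ := 𝒢.gerbe.bundle.frames_cover (η₁₂ k, η₁₂' k) (h₂ k hk)
  refine ⟨_, Filter.inter_mem
    (CstarBundle.preimage_frame_mem hf (s₂₃.prodMk s₂₃').continuousOn
      (BundleGerbe.mapsTo_pair h₁) hk hkf)
    (CstarBundle.preimage_frame_mem hg (s₁₂.prodMk s₁₂').continuousOn
      (BundleGerbe.mapsTo_pair h₂) hk hkg), ?_⟩
  have h' := (𝒢.mHat_smooth f hf g hg).comp
    (((s₂₃.prodMk s₂₃').prodMk (s₁₂.prodMk s₁₂')).mono inter_subset_left)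
    (fun k' (hk' : k' ∈ A ∩ ((fun k => (η₂₃ k, η₂₃' k)) ⁻¹' f.1 ∩
      (fun k => (η₁₂ k, η₁₂' k)) ⁻¹' g.1)) =>
        ⟨h₁ k' hk'.1, h₂ k' hk'.1, h k' hk'.1, hk'.2.1, hk'.2.2⟩)
  refine h'.of_sdiv ?_
  refine SmoothUnitOn.congr (SmoothUnitOn.mul (ContMDiffOn.mono (hp f hf) ?_)
    (ContMDiffOn.mono (hq g hg) ?_)) fun k' hk' =>
      mHat_sdiv_mHat (h₁ k' hk'.1) (h₂ k' hk'.1) (h k' hk'.1) _ _ _ _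
  · exact fun k' hk' => ⟨hk'.1, hk'.2.1⟩
  · exact fun k' hk' => ⟨hk'.1, hk'.2.2⟩

namespace GoodCover

variable {c : 𝒢.GoodCover} {i j k l : c.ι} {x : M} {y y' y₁₂ y₁₂' y₂₃ y₂₃' y₃₄ : Y}

theorem Over.proj_eq (h : c.Over i j x y) (h' : c.Over i j x y') :
    𝒢.gerbe.proj y = 𝒢.gerbe.proj y' :=
  h.2.2.trans h'.2.2.symm

theorem Over.mem (h : c.Over i j x y) : y ∈ c.YSet i j := ⟨x, h⟩

theorem Over.base (h : c.Over i j x y) : 𝒢.π (𝒢.gerbe.proj y).1 = x := by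
  rw [h.2.2]; exact c.s_section i x h.1

theorem Over.snd_eq_fst (h : c.Over j k x y₂₃) (h' : c.Over i j x y₁₂) :
    (𝒢.gerbe.proj y₁₂).2 = (𝒢.gerbe.proj y₂₃).1 := by
  rw [h.2.2, h'.2.2]

theorem Over.m (h : c.Over j k x y₂₃) (h' : c.Over i j x y₁₂) :
    c.Over i k x (𝒢.m y₂₃ y₁₂) :=
  ⟨h'.1, h.2.1, by rw [𝒢.proj_m _ _ (h.snd_eq_fst h'), h.2.2, h'.2.2]⟩

theorem pair_mem (hi : x ∈ c.U i) (hj : x ∈ c.U j) :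
    (c.s i x, c.s j x) ∈ {q : X × X | 𝒢.π q.1 = 𝒢.π q.2} :=
  (c.s_section i x hi).trans (c.s_section j x hj).symm

theorem exists_over (hi : x ∈ c.U i) (hj : x ∈ c.U j) : ∃ y, c.Over i j x y :=
  (𝒢.gerbe.proj_surj _ (pair_mem hi hj)).imp fun _ hy => ⟨hi, hj, hy⟩

theorem exists_local_section (hi : x ∈ c.U i) (hj : x ∈ c.U j) :
    ∃ V : Set M, IsOpen V ∧ x ∈ V ∧ ∃ η : M → Y, ContMDiffOn IM IY ∞ η V ∧
      ∀ x' ∈ V, c.Over i j x' (η x') := by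
  obtain ⟨V, hV, t, ht, htp⟩ := 𝒢.gerbe.local_sections _ (pair_mem hi hj)
  have hs : ContMDiffOn IM (IX.prod IX) ∞ (fun x => (c.s i x, c.s j x)) (c.U i ∩ c.U j) :=
    ((c.s_smooth i).mono inter_subset_left).prodMk ((c.s_smooth j).mono inter_subset_right)
  have hm : MapsTo (fun x => (c.s i x, c.s j x)) (c.U i ∩ c.U j)
    {q : X × X | 𝒢.π q.1 = 𝒢.π q.2} := fun x hx => pair_mem hx.1 hx.2
  have ho : IsOpen (c.U i ∩ c.U j) := (c.isOpen i).inter (c.isOpen j)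
  have hn := ((hs.continuousOn x ⟨hi, hj⟩).tendsto_nhdsWithin hm) hV
  rw [ho.nhdsWithin_eq ⟨hi, hj⟩] at hn
  obtain ⟨O, hO, hOo, hxO⟩ := mem_nhds_iff.1 hn
  refine ⟨O ∩ (c.U i ∩ c.U j), hOo.inter ho, ⟨hxO, hi, hj⟩, fun x => t (c.s i x, c.s j x),
    ht.comp (hs.mono inter_subset_right) fun x hx => ⟨hO hx.1, hm hx.2⟩,
    fun x' hx' => ⟨hx'.2.1, hx'.2.2, htp _ ⟨hO hx'.1, hm hx'.2⟩⟩⟩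

end GoodCover

open GoodCover

variable {c : 𝒢.GoodCover} {t : c.Trivs} {i j k l : c.ι} {x : M} {y₂₃ y₂₃' y₁₂ y₁₂' : Y}

/-- The smoothness of the descent isomorphism of `L_jk ⊗ m⁻¹ L_ik* ⊗ L_ij`. -/
theorem smoothUnitOn_descent {b : K → M} {η₂₃ η₂₃' η₁₂ η₁₂' : K → Y}
    (s₂₃ : ContMDiffOn J IY ∞ η₂₃ A) (s₂₃' : ContMDiffOn J IY ∞ η₂₃' A)
    (s₁₂ : ContMDiffOn J IY ∞ η₁₂ A) (s₁₂' : ContMDiffOn J IY ∞ η₁₂' A)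
    (h₂₃ : ∀ a ∈ A, c.Over j k (b a) (η₂₃ a)) (h₂₃' : ∀ a ∈ A, c.Over j k (b a) (η₂₃' a))
    (h₁₂ : ∀ a ∈ A, c.Over i j (b a) (η₁₂ a)) (h₁₂' : ∀ a ∈ A, c.Over i j (b a) (η₁₂' a))
    {u : ∀ a, (t j k).L.Fib (η₂₃ a)} {u' : ∀ a, (t j k).L.Fib (η₂₃' a)}
    {v : ∀ a, (t i k).L.Fib (𝒢.m (η₂₃ a) (η₁₂ a))}
    {v' : ∀ a, (t i k).L.Fib (𝒢.m (η₂₃' a) (η₁₂' a))}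
    {w : ∀ a, (t i j).L.Fib (η₁₂ a)} {w' : ∀ a, (t i j).L.Fib (η₁₂' a)}
    (hu : (t j k).L.SmoothAlong J η₂₃ u A) (hu' : (t j k).L.SmoothAlong J η₂₃' u' A)
    (hv : (t i k).L.SmoothAlong J (fun a => 𝒢.m (η₂₃ a) (η₁₂ a)) v A)
    (hv' : (t i k).L.SmoothAlong J (fun a => 𝒢.m (η₂₃' a) (η₁₂' a)) v' A)
    (hw : (t i j).L.SmoothAlong J η₁₂ w A) (hw' : (t i j).L.SmoothAlong J η₁₂' w' A) :
    SmoothUnitOn J (fun a => 𝒢.mHat ((t j k).φ (u' a) (u a)) ((t i j).φ (w' a) (w a)) /ₛ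
      (t i k).φ (v' a) (v a)) A := by
  have p₂₃ := fun a ha => (h₂₃ a ha).proj_eq (h₂₃' a ha)
  have p₁₂ := fun a ha => (h₁₂ a ha).proj_eq (h₁₂' a ha)
  have q := fun a ha => (h₂₃ a ha).snd_eq_fst (h₁₂ a ha)
  have sm := contMDiffOn_m s₂₃ s₁₂ q
  have sm' := contMDiffOn_m s₂₃' s₁₂' fun a ha => (h₂₃' a ha).snd_eq_fst (h₁₂' a ha)
  have pm := fun a ha => ((h₂₃ a ha).m (h₁₂ a ha)).proj_eq ((h₂₃' a ha).m (h₁₂' a ha))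
  exact (smoothAlong_mHat s₂₃ s₂₃' s₁₂ s₁₂' p₂₃ p₁₂ q
    (BundleGerbe.Trivialisation.smoothAlong_φ s₂₃ s₂₃' (fun a ha => (h₂₃ a ha).mem)
      (fun a ha => (h₂₃' a ha).mem) p₂₃ hu' hu)
    (BundleGerbe.Trivialisation.smoothAlong_φ s₁₂ s₁₂' (fun a ha => (h₁₂ a ha).mem)
      (fun a ha => (h₁₂' a ha).mem) p₁₂ hw' hw)).sdiv
    (BundleGerbe.Trivialisation.smoothAlong_φ sm sm' (fun a ha => ((h₂₃ a ha).m (h₁₂ a ha)).mem)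
      (fun a ha => ((h₂₃' a ha).m (h₁₂' a ha)).mem) pm hv' hv)
    (sm.prodMk sm').continuousOn (BundleGerbe.mapsTo_pair pm)

namespace Descended

variable (d : Descended c t i j k)

/-- The descent axiom applies only when the two sides match exactly. Rescaling `v'` by their ratio
`z` makes them match, and the weight `-1` of `D` in that variable turns the axiom into a formula for
arbitrary elements. -/
theorem D_sdiv_D (h₂₃ : c.Over j k x y₂₃) (h₂₃' : c.Over j k x y₂₃') (h₁₂ : c.Over i j x y₁₂)
    (h₁₂' : c.Over i j x y₁₂') (u : (t j k).L.Fib y₂₃) (u' : (t j k).L.Fib y₂₃')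
    (v : (t i k).L.Fib (𝒢.m y₂₃ y₁₂)) (v' : (t i k).L.Fib (𝒢.m y₂₃' y₁₂'))
    (w : (t i j).L.Fib y₁₂) (w' : (t i j).L.Fib y₁₂') :
    d.D x u' v' w' /ₛ d.D x u v w =
      𝒢.mHat ((t j k).φ u' u) ((t i j).φ w' w) /ₛ (t i k).φ v' v := by
  set z : ℂˣ := 𝒢.mHat ((t j k).φ u' u) ((t i j).φ w' w) /ₛ (t i k).φ v' v with hz
  have h := d.D_descent h₂₃ h₂₃' h₁₂ h₁₂' u u' v (z • v') w w' (by
    have := (t i k).φ_smul (h₂₃.m h₁₂).mem (h₂₃'.m h₁₂').mem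
      ((h₂₃.m h₁₂).proj_eq (h₂₃'.m h₁₂')) z 1 v' v
    rw [one_smul, inv_one, mul_one] at this
    rw [this, hz, sdiv_smul])
  have h' := d.D_smul h₂₃' h₁₂' 1 z 1 u' v' w'
  simp only [one_smul, one_mul, mul_one] at h'
  rw [← h, h', sdiv_smul_eq_sdiv_div, sdiv_self, one_div, inv_inv]

theorem D_sdiv_D_same (h₂₃ : c.Over j k x y₂₃) (h₁₂ : c.Over i j x y₁₂)
    (u u' : (t j k).L.Fib y₂₃) (v v' : (t i k).L.Fib (𝒢.m y₂₃ y₁₂)) (w w' : (t i j).L.Fib y₁₂) :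
    d.D x u' v' w' /ₛ d.D x u v w = (u' /ₛ u) * (v' /ₛ v)⁻¹ * (w' /ₛ w) := by
  conv_lhs => rw [← sdiv_smul u' u, ← sdiv_smul v' v, ← sdiv_smul w' w, d.D_smul h₂₃ h₁₂, smul_sdiv]

/-- Locally the three sections are smooth multiples of frames, for which smoothness is an axiom.
That axiom recomputes the base point from `y₁₂`, so it has to be replaced by `b`. -/
theorem smoothAlong_D {b : K → M} {η₂₃ η₁₂ : K → Y} (s₂₃ : ContMDiffOn J IY ∞ η₂₃ A)
    (s₁₂ : ContMDiffOn J IY ∞ η₁₂ A) (h₂₃ : ∀ a ∈ A, c.Over j k (b a) (η₂₃ a))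
    (h₁₂ : ∀ a ∈ A, c.Over i j (b a) (η₁₂ a)) {u : ∀ a, (t j k).L.Fib (η₂₃ a)}
    {v : ∀ a, (t i k).L.Fib (𝒢.m (η₂₃ a) (η₁₂ a))} {w : ∀ a, (t i j).L.Fib (η₁₂ a)}
    (hu : (t j k).L.SmoothAlong J η₂₃ u A)
    (hv : (t i k).L.SmoothAlong J (fun a => 𝒢.m (η₂₃ a) (η₁₂ a)) v A)
    (hw : (t i j).L.SmoothAlong J η₁₂ w A) :
    d.L.SmoothAlong J b (fun a => d.D (b a) (u a) (v a) (w a)) A := by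
  refine CstarBundle.SmoothAlong.of_local fun a ha => ?_
  have sm := contMDiffOn_m s₂₃ s₁₂ fun a ha => (h₂₃ a ha).snd_eq_fst (h₁₂ a ha)
  have m₂₃ : MapsTo η₂₃ A (c.YSet j k) := fun a ha => (h₂₃ a ha).mem
  have m₁₂ : MapsTo η₁₂ A (c.YSet i j) := fun a ha => (h₁₂ a ha).mem
  have mm : MapsTo (fun a => 𝒢.m (η₂₃ a) (η₁₂ a)) A (c.YSet i k) :=
    fun a ha => ((h₂₃ a ha).m (h₁₂ a ha)).mem
  obtain ⟨f, hf, haf⟩ := (t j k).L.frames_cover _ (m₂₃ ha)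
  obtain ⟨g, hg, hag⟩ := (t i k).L.frames_cover _ (mm ha)
  obtain ⟨h, hh, hah⟩ := (t i j).L.frames_cover _ (m₁₂ ha)
  refine ⟨_, Filter.inter_mem (CstarBundle.preimage_frame_mem hf s₂₃.continuousOn m₂₃ ha haf)
    (Filter.inter_mem (CstarBundle.preimage_frame_mem hg sm.continuousOn mm ha hag)
      (CstarBundle.preimage_frame_mem hh s₁₂.continuousOn m₁₂ ha hah)), ?_⟩
  set A' := A ∩ (η₂₃ ⁻¹' f.1 ∩ ((fun a => 𝒢.m (η₂₃ a) (η₁₂ a)) ⁻¹' g.1 ∩ η₁₂ ⁻¹' h.1)) with hA'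
  have h' := (d.D_smooth f hf g hg h hh).comp ((s₂₃.prodMk s₁₂).mono inter_subset_left)
    (fun a (ha : a ∈ A') => ⟨⟨b a, h₂₃ a ha.1, h₁₂ a ha.1⟩, ha.2.1, ha.2.2.1, ha.2.2.2⟩)
  have h'' := CstarBundle.SmoothAlong.congr_base (c' := b)
    (τ := fun a x => d.D x (f.2 (η₂₃ a)) (g.2 (𝒢.m (η₂₃ a) (η₁₂ a))) (h.2 (η₁₂ a))) h'
    fun a ha => (h₁₂ a ha.1).base.symm
  refine h''.of_sdiv (SmoothUnitOn.congr (SmoothUnitOn.mul (SmoothUnitOn.mul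
    (ContMDiffOn.mono (hu f hf) ?_) (SmoothUnitOn.inv (ContMDiffOn.mono (hv g hg) ?_)))
    (ContMDiffOn.mono (hw h hh) ?_)) fun a ha => d.D_sdiv_D_same (h₂₃ a ha.1) (h₁₂ a ha.1) _ _ _ _ _ _)
  · exact fun a ha => ⟨ha.1, ha.2.1⟩
  · exact fun a ha => ⟨ha.1, ha.2.2.1⟩
  · exact fun a ha => ⟨ha.1, ha.2.2.2⟩

end Descended

end Bundle2Gerbe

end TwoGerbeToolkit

/-! ### Existence of the choices -/

section ExistenceOfChoices

open Set TopologicalSpace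

namespace Bundle2Gerbe

section Descent

variable {EM : Type*} [NormedAddCommGroup EM] [NormedSpace ℝ EM] {HM : Type*} [TopologicalSpace HM]
  {EX : Type*} [NormedAddCommGroup EX] [NormedSpace ℝ EX] {HX : Type*} [TopologicalSpace HX]
  {EY : Type*} [NormedAddCommGroup EY] [NormedSpace ℝ EY] {HY : Type*} [TopologicalSpace HY]
  {IM : ModelWithCorners ℝ EM HM} {M : Type u} [TopologicalSpace M] [ChartedSpace HM M]
  {IX : ModelWithCorners ℝ EX HX} {X : Type uX} [TopologicalSpace X] [ChartedSpace HX X]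
  {IY : ModelWithCorners ℝ EY HY} {Y : Type uY} [TopologicalSpace Y] [ChartedSpace HY Y]
  {𝒢 : Bundle2Gerbe.{u, uX, uY, w} IM M IX X IY Y}

open GoodCover

theorem GoodCover.isGoodFamily (c : 𝒢.GoodCover) : IsGoodFamily c.U := c.good

/-- Reference points of `Y` and reference elements of the three bundles over each `x`, chosen
without smoothness, turn `D` into a number. Its ratios are given by the descent isomorphism and no
longer involve the references, so its values along smooth local sections serve as frames.
Contractibility plays no role. -/
theorem nonempty_descended (c : 𝒢.GoodCover) (t : c.Trivs) (i j k : c.ι) :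
    Nonempty (Descended c t i j k) := by
  rcases (c.U i ∩ c.U j ∩ c.U k).eq_empty_or_nonempty with hU | ⟨x₀, hx₀⟩
  · have hO : ∀ {x : M} {y₂₃ y₁₂ : Y}, c.Over j k x y₂₃ → c.Over i j x y₁₂ → False :=
      fun {x} _ _ h h' => (hU ▸ ⟨⟨h'.1, h'.2.1⟩, h.2.1⟩ : x ∈ (∅ : Set M))
    refine ⟨⟨⟨fun _ => ULift.{w} ℂˣ, ∅, ?_, ?_, ?_⟩, fun _ _ _ _ _ _ => ⟨1⟩, ?_, ?_, ?_⟩⟩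
    · exact fun _ h => h.elim
    · rw [hU]; exact fun _ h => h.elim
    · exact fun _ h => h.elim
    · exact fun h h' => (hO h h').elim
    · exact fun _ _ _ _ _ _ _ h => h.elim
    · exact fun h _ h' => (hO h h').elim
  obtain ⟨yx, -⟩ := exists_over hx₀.1.1 hx₀.1.2
  have hex : ∀ i j (x : M), ∃ y : Y, x ∈ c.U i → x ∈ c.U j → c.Over i j x y := by
    intro i j x
    by_cases h : x ∈ c.U i ∧ x ∈ c.U j
    · exact (exists_over h.1 h.2).imp fun _ hy _ _ => hy
    · exact ⟨yx, fun h₁ h₂ => (h ⟨h₁, h₂⟩).elim⟩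
  choose y₁ hy₁ using hex i j
  choose y₂ hy₂ using hex j k
  obtain ⟨u₀⟩ : Nonempty (∀ x, (t j k).L.Fib (y₂ x)) := ⟨fun _ => Classical.arbitrary _⟩
  obtain ⟨v₀⟩ : Nonempty (∀ x, (t i k).L.Fib (𝒢.m (y₂ x) (y₁ x))) :=
    ⟨fun _ => Classical.arbitrary _⟩
  obtain ⟨w₀⟩ : Nonempty (∀ x, (t i j).L.Fib (y₁ x)) := ⟨fun _ => Classical.arbitrary _⟩
  -- The second argument of `φ` has weight `-1`; with `u` and `w` in the divisor and `v` in the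
  -- dividend, the weights are `1`, `-1`, `1` as required.
  let D : ∀ (x : M) {y₂₃ y₁₂ : Y}, (t j k).L.Fib y₂₃ → (t i k).L.Fib (𝒢.m y₂₃ y₁₂) →
      (t i j).L.Fib y₁₂ → ℂˣ := fun x _ _ u v w =>
    (t i k).φ (v₀ x) v /ₛ 𝒢.mHat ((t j k).φ (u₀ x) u) ((t i j).φ (w₀ x) w)
  have hb₂ : ∀ {x y y'}, c.Over j k x y → c.Over i j x y' → c.Over j k x (y₂ x) :=
    fun h _ => hy₂ _ h.1 h.2.1
  have hb₁ : ∀ {x y y'}, c.Over j k x y → c.Over i j x y' → c.Over i j x (y₁ x) :=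
    fun _ h => hy₁ _ h.1 h.2.1
  have hsmul : ∀ {x : M} {y₂₃ y₁₂ : Y}, c.Over j k x y₂₃ → c.Over i j x y₁₂ →
      ∀ (z z' z'' : ℂˣ) (u : (t j k).L.Fib y₂₃) (v : (t i k).L.Fib (𝒢.m y₂₃ y₁₂))
        (w : (t i j).L.Fib y₁₂), D x (z • u) (z' • v) (z'' • w) = (z * z'⁻¹ * z'') * D x u v w := by
    intro x y₂₃ y₁₂ h h' z z' z'' u v w
    have b₁ := hb₁ h h'
    have b₂ := hb₂ h h'
    have e₁ := (t j k).φ_smul h.mem b₂.mem (h.proj_eq b₂) 1 z (u₀ x) u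
    have e₂ := (t i j).φ_smul h'.mem b₁.mem (h'.proj_eq b₁) 1 z'' (w₀ x) w
    have e₃ := (t i k).φ_smul (h.m h').mem (b₂.m b₁).mem ((h.m h').proj_eq (b₂.m b₁)) 1 z' (v₀ x) v
    rw [one_smul, one_mul] at e₁ e₂ e₃
    simp only [D]
    rw [e₁, e₂, e₃, 𝒢.mHat_smul (h.proj_eq b₂) (h'.proj_eq b₁) (h.snd_eq_fst h'),
      smul_sdiv_assoc, sdiv_smul_eq_sdiv_div]
    rw [← mul_inv, div_inv_eq_mul, mul_comm (_ /ₛ _), ← mul_assoc]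
    congr 1
    ac_rfl
  -- Inserting the primed elements between the references and the unprimed ones, multiplicativity of
  -- `φ` and of `mHat` splits `D` into a product, and the factor with the references cancels.
  have hratio : ∀ {x : M} {y₂₃ y₂₃' y₁₂ y₁₂' : Y}, c.Over j k x y₂₃ → c.Over j k x y₂₃' →
      c.Over i j x y₁₂ → c.Over i j x y₁₂' →
      ∀ (u : (t j k).L.Fib y₂₃) (u' : (t j k).L.Fib y₂₃')
        (v : (t i k).L.Fib (𝒢.m y₂₃ y₁₂)) (v' : (t i k).L.Fib (𝒢.m y₂₃' y₁₂'))
        (w : (t i j).L.Fib y₁₂) (w' : (t i j).L.Fib y₁₂'),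
        D x u' v' w' / D x u v w =
          𝒢.mHat ((t j k).φ u' u) ((t i j).φ w' w) /ₛ (t i k).φ v' v := by
    intro x y₂₃ y₂₃' y₁₂ y₁₂' h₂₃ h₂₃' h₁₂ h₁₂' u u' v v' w w'
    have b₁ := hb₁ h₂₃ h₁₂
    have b₂ := hb₂ h₂₃ h₁₂
    have e : D x u v w = D x u' v' w' *
        ((t i k).φ v' v /ₛ 𝒢.mHat ((t j k).φ u' u) ((t i j).φ w' w)) := by
      simp only [D]
      rw [← (t i k).φ_mul (h₂₃.m h₁₂).mem (h₂₃'.m h₁₂').mem (b₂.m b₁).mem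
          ((h₂₃.m h₁₂).proj_eq (h₂₃'.m h₁₂')) ((h₂₃'.m h₁₂').proj_eq (b₂.m b₁)) (v₀ x) v' v,
        ← (t j k).φ_mul h₂₃.mem h₂₃'.mem b₂.mem (h₂₃.proj_eq h₂₃') (h₂₃'.proj_eq b₂) (u₀ x) u' u,
        ← (t i j).φ_mul h₁₂.mem h₁₂'.mem b₁.mem (h₁₂.proj_eq h₁₂') (h₁₂'.proj_eq b₁) (w₀ x) w' w,
        𝒢.mHat_mul (h₂₃.proj_eq h₂₃') (h₂₃'.proj_eq b₂) (h₁₂.proj_eq h₁₂') (h₁₂'.proj_eq b₁)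
          (h₂₃.snd_eq_fst h₁₂),
        𝒢.gerbe.mul_sdiv_mul ((h₂₃.m h₁₂).proj_eq (h₂₃'.m h₁₂'))
          ((h₂₃'.m h₁₂').proj_eq (b₂.m b₁))]
    rw [e, div_mul_cancel_left, inv_sdiv_eq_sdiv_rev]
  let Fr : Set (Set M × (∀ _ : M, ULift.{w} ℂˣ)) := {F | ∃ V : Set M, IsOpen V ∧
    V ⊆ c.U i ∩ c.U j ∩ c.U k ∧ ∃ η₂₃ η₁₂ : M → Y, ContMDiffOn IM IY ∞ η₂₃ V ∧
    ContMDiffOn IM IY ∞ η₁₂ V ∧ (∀ x ∈ V, c.Over j k x (η₂₃ x)) ∧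
    (∀ x ∈ V, c.Over i j x (η₁₂ x)) ∧ ∃ f ∈ (t j k).L.frames, ∃ g ∈ (t i k).L.frames,
    ∃ h ∈ (t i j).L.frames, MapsTo η₂₃ V f.1 ∧ MapsTo (fun x => 𝒢.m (η₂₃ x) (η₁₂ x)) V g.1 ∧
    MapsTo η₁₂ V h.1 ∧
    F = (V, fun x => ⟨D x (f.2 (η₂₃ x)) (g.2 (𝒢.m (η₂₃ x) (η₁₂ x))) (h.2 (η₁₂ x))⟩)}
  refine ⟨⟨⟨fun _ => ULift.{w} ℂˣ, Fr, ?_, ?_, ?_⟩, fun x {_ _} u v w => ⟨D x u v w⟩, ?_, ?_, ?_⟩⟩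
  · rintro _ ⟨V, hV, -, η₂₃, η₁₂, -, -, -, -, f, -, g, -, h, -, -, -, -, rfl⟩ b hb
    exact mem_nhdsWithin_of_mem_nhds (hV.mem_nhds hb.1)
  · rintro x ⟨⟨hi, hj⟩, hk⟩
    obtain ⟨V₂, hV₂, hx₂, η₂₃, s₂₃, o₂₃⟩ := exists_local_section hj hk
    obtain ⟨V₁, hV₁, hx₁, η₁₂, s₁₂, o₁₂⟩ := exists_local_section hi hj
    have hV := hV₂.inter hV₁
    have hx : x ∈ V₂ ∩ V₁ := ⟨hx₂, hx₁⟩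
    have s₂ := s₂₃.mono (t := V₂ ∩ V₁) inter_subset_left
    have s₁ := s₁₂.mono (t := V₂ ∩ V₁) inter_subset_right
    have sm := contMDiffOn_m (𝒢 := 𝒢) s₂ s₁ fun x hx => (o₂₃ x hx.1).snd_eq_fst (o₁₂ x hx.2)
    have m₂ : MapsTo η₂₃ (V₂ ∩ V₁) (c.YSet j k) := fun x hx => (o₂₃ x hx.1).mem
    have m₁ : MapsTo η₁₂ (V₂ ∩ V₁) (c.YSet i j) := fun x hx => (o₁₂ x hx.2).mem
    have mm : MapsTo (fun x => 𝒢.m (η₂₃ x) (η₁₂ x)) (V₂ ∩ V₁) (c.YSet i k) :=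
      fun x hx => ((o₂₃ x hx.1).m (o₁₂ x hx.2)).mem
    obtain ⟨f, hf, hxf⟩ := (t j k).L.frames_cover _ (m₂ hx)
    obtain ⟨g, hg, hxg⟩ := (t i k).L.frames_cover _ (mm hx)
    obtain ⟨h, hh, hxh⟩ := (t i j).L.frames_cover _ (m₁ hx)
    have n₂ := CstarBundle.preimage_frame_mem hf s₂.continuousOn m₂ hx hxf
    have n := CstarBundle.preimage_frame_mem hg sm.continuousOn mm hx hxg
    have n₁ := CstarBundle.preimage_frame_mem hh s₁.continuousOn m₁ hx hxh
    rw [hV.nhdsWithin_eq hx] at n n₁ n₂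
    obtain ⟨W, hW, hWo, hxW⟩ := mem_nhds_iff.1 (Filter.inter_mem n₂ (Filter.inter_mem n n₁))
    have hl : W ∩ (V₂ ∩ V₁) ⊆ V₂ ∩ V₁ := inter_subset_right
    exact ⟨_, ⟨W ∩ (V₂ ∩ V₁), hWo.inter hV, fun x hx =>
      ⟨⟨(o₁₂ x hx.2.2).1, (o₁₂ x hx.2.2).2.1⟩, (o₂₃ x hx.2.1).2.1⟩, η₂₃, η₁₂, s₂.mono hl,
      s₁.mono hl, fun x hx => o₂₃ x hx.2.1, fun x hx => o₁₂ x hx.2.2, f, hf, g, hg, h, hh,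
      fun x hx => (hW hx.1).1, fun x hx => (hW hx.1).2.1, fun x hx => (hW hx.1).2.2, rfl⟩, hxW, hx⟩
  · rintro _ ⟨V, -, -, η₂₃, η₁₂, s₂₃, s₁₂, o₂₃, o₁₂, f, hf, g, hg, h, hh, mf, mg, mh, rfl⟩
      _ ⟨V', -, -, η₂₃', η₁₂', s₂₃', s₁₂', o₂₃', o₁₂', f', hf', g', hg', h', hh', mf', mg', mh', rfl⟩
    have l : V ∩ V' ∩ (c.U i ∩ c.U j ∩ c.U k) ⊆ V := fun x hx => hx.1.1
    have l' : V ∩ V' ∩ (c.U i ∩ c.U j ∩ c.U k) ⊆ V' := fun x hx => hx.1.2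
    have sm := contMDiffOn_m (𝒢 := 𝒢) s₂₃ s₁₂ fun x hx => (o₂₃ x hx).snd_eq_fst (o₁₂ x hx)
    have sm' := contMDiffOn_m (𝒢 := 𝒢) s₂₃' s₁₂' fun x hx => (o₂₃' x hx).snd_eq_fst (o₁₂' x hx)
    refine (smoothUnitOn_descent (b := id) (s₂₃'.mono l') (s₂₃.mono l) (s₁₂'.mono l') (s₁₂.mono l)
      (fun x hx => o₂₃' x (l' hx)) (fun x hx => o₂₃ x (l hx)) (fun x hx => o₁₂' x (l' hx))
      (fun x hx => o₁₂ x (l hx))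
      ((CstarBundle.smoothAlong_frame hf' s₂₃' (fun x hx => (o₂₃' x hx).mem) mf').mono l')
      ((CstarBundle.smoothAlong_frame hf s₂₃ (fun x hx => (o₂₃ x hx).mem) mf).mono l)
      ((CstarBundle.smoothAlong_frame hg' sm' (fun x hx => ((o₂₃' x hx).m (o₁₂' x hx)).mem)
        mg').mono l')
      ((CstarBundle.smoothAlong_frame hg sm (fun x hx => ((o₂₃ x hx).m (o₁₂ x hx)).mem) mg).mono l)
      ((CstarBundle.smoothAlong_frame hh' s₁₂' (fun x hx => (o₁₂' x hx).mem) mh').mono l')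
      ((CstarBundle.smoothAlong_frame hh s₁₂ (fun x hx => (o₁₂ x hx).mem) mh).mono l)).congr ?_
    exact fun x hx => hratio (o₂₃' x (l' hx)) (o₂₃ x (l hx)) (o₁₂' x (l' hx)) (o₁₂ x (l hx)) _ _ _ _ _ _
  · intro x y₂₃ y₁₂ h h' z z' z'' u v w
    exact ULift.ext _ _ (hsmul h h' z z' z'' u v w)
  · rintro f hf g hg h hh _ ⟨V, -, -, η₂₃, η₁₂, s₂₃, s₁₂, o₂₃, o₁₂, f', hf', g', hg', h', hh',
      mf', mg', mh', rfl⟩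
    set A : Set (Y × Y) := {z | (∃ x, c.Over j k x z.1 ∧ c.Over i j x z.2) ∧
        z.1 ∈ f.1 ∧ 𝒢.m z.1 z.2 ∈ g.1 ∧ z.2 ∈ h.1} with hA
    let b : Y × Y → M := fun z => 𝒢.π (𝒢.gerbe.proj z.2).1
    have ob₂ : ∀ z ∈ A, c.Over j k (b z) z.1 := by
      rintro z ⟨⟨x, h₂, h₁⟩, -⟩
      rwa [show b z = x from h₁.base]
    have ob₁ : ∀ z ∈ A, c.Over i j (b z) z.2 := by
      rintro z ⟨⟨x, h₂, h₁⟩, -⟩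
      rwa [show b z = x from h₁.base]
    have sb : ContMDiff (IY.prod IY) IM ∞ b :=
      𝒢.π_smooth.comp (contMDiff_fst.comp (𝒢.gerbe.proj_smooth.comp contMDiff_snd))
    have l : A ∩ b ⁻¹' V ⊆ A := inter_subset_left
    have s₁ : ContMDiffOn (IY.prod IY) IY ∞ (Prod.fst : Y × Y → Y) (A ∩ b ⁻¹' V) := contMDiffOn_fst
    have s₂ : ContMDiffOn (IY.prod IY) IY ∞ (Prod.snd : Y × Y → Y) (A ∩ b ⁻¹' V) := contMDiffOn_snd
    have s₁' := s₂₃.comp (sb.contMDiffOn (s := A ∩ b ⁻¹' V)) fun z hz => hz.2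
    have s₂' := s₁₂.comp (sb.contMDiffOn (s := A ∩ b ⁻¹' V)) fun z hz => hz.2
    have o₁' : ∀ z ∈ A ∩ b ⁻¹' V, c.Over j k (b z) (η₂₃ (b z)) := fun z hz => o₂₃ _ hz.2
    have o₂' : ∀ z ∈ A ∩ b ⁻¹' V, c.Over i j (b z) (η₁₂ (b z)) := fun z hz => o₁₂ _ hz.2
    have sm := contMDiffOn_m (𝒢 := 𝒢) s₁ s₂ fun z hz => (ob₂ z hz.1).snd_eq_fst (ob₁ z hz.1)
    have sm' := contMDiffOn_m (𝒢 := 𝒢) s₁' s₂' fun z hz => (o₁' z hz).snd_eq_fst (o₂' z hz)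
    refine (smoothUnitOn_descent (b := b) s₁' s₁ s₂' s₂ o₁' (fun z hz => ob₂ z hz.1) o₂'
      (fun z hz => ob₁ z hz.1)
      (CstarBundle.smoothAlong_frame hf' s₁' (fun z hz => (o₁' z hz).mem) fun z hz => mf' hz.2)
      (CstarBundle.smoothAlong_frame hf s₁ (fun z hz => (ob₂ z hz.1).mem) fun z hz => hz.1.2.1)
      (CstarBundle.smoothAlong_frame hg' sm' (fun z hz => ((o₁' z hz).m (o₂' z hz)).mem)
        fun z hz => mg' hz.2)
      (CstarBundle.smoothAlong_frame hg sm (fun z hz => ((ob₂ z hz.1).m (ob₁ z hz.1)).mem)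
        fun z hz => hz.1.2.2.1)
      (CstarBundle.smoothAlong_frame hh' s₂' (fun z hz => (o₂' z hz).mem) fun z hz => mh' hz.2)
      (CstarBundle.smoothAlong_frame hh s₂ (fun z hz => (ob₁ z hz.1).mem)
        fun z hz => hz.1.2.2.2)).congr ?_
    exact fun z hz => hratio (o₁' z hz) (ob₂ z hz.1) (o₂' z hz) (ob₁ z hz.1) _ _ _ _ _ _
  · intro x y₂₃ y₂₃' y₁₂ y₁₂' h₂₃ h₂₃' h₁₂ h₁₂' u u' v v' w w' h
    refine ULift.ext _ _ (div_eq_one.1 ?_)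
    change D x u' v' w' / D x u v w = 1
    rw [hratio h₂₃ h₂₃' h₁₂ h₁₂', h, sdiv_self]

end Descent

section Choices

variable {EM : Type*} [NormedAddCommGroup EM] [NormedSpace ℝ EM] [FiniteDimensional ℝ EM]
  {M : Type u} [TopologicalSpace M] [T2Space M] [ParacompactSpace M] [ChartedSpace EM M]
  [IsManifold 𝓘(ℝ, EM) ∞ M]
  {EX : Type*} [NormedAddCommGroup EX] [NormedSpace ℝ EX] {HX : Type*} [TopologicalSpace HX]
  {EY : Type*} [NormedAddCommGroup EY] [NormedSpace ℝ EY] {HY : Type*} [TopologicalSpace HY]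
  {IX : ModelWithCorners ℝ EX HX} {X : Type uX} [TopologicalSpace X] [ChartedSpace HX X]
  {IY : ModelWithCorners ℝ EY HY} {Y : Type uY} [TopologicalSpace Y] [ChartedSpace HY Y]
  {𝒢 : Bundle2Gerbe.{u, uX, uY, w} 𝓘(ℝ, EM) M IX X IY Y}

variable (𝒢) in
theorem nonempty_goodCover : Nonempty 𝒢.GoodCover := by
  choose V hV s hs hsp using 𝒢.π_local_sections
  obtain ⟨𝒲, r, hr, hW⟩ := exists_good_refinement EM (fun x => interior (V x))
    (fun _ => isOpen_interior) fun x => ⟨x, mem_interior_iff_mem_nhds.2 (hV x)⟩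
  have hr' : ∀ x, 𝒲.U x ⊆ V (r x) := fun x => (hr x).trans interior_subset
  exact ⟨⟨M, 𝒲.U, 𝒲.isOpen, fun x => ⟨x, 𝒲.mem x⟩, hW, fun x => s (r x),
    fun x => (hs _).mono (hr' x), fun x y hy => hsp _ y (hr' x hy)⟩⟩

/-- A nonempty double intersection is a contractible manifold embedded by `(s_i, s_j)`, so the
general result on bundle gerbes applies to the part of `Y` above its image. -/
theorem nonempty_trivialisation (c : 𝒢.GoodCover) (i j : c.ι) :
    Nonempty (𝒢.gerbe.Trivialisation (c.YSet i j)) := by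
  rcases c.isGoodFamily.inter i j with hU | hU
  · have hO : ∀ y, y ∉ c.YSet i j := fun y ⟨x, h⟩ => (hU ▸ ⟨h.1, h.2.1⟩ : x ∈ (∅ : Set M))
    refine ⟨⟨⟨fun _ => ULift.{w} ℂˣ, ∅, ?_, ?_, ?_⟩, fun _ _ => Classical.arbitrary _,
      ?_, ?_, ?_⟩⟩
    · exact fun _ h => h.elim
    · exact fun y h => (hO y h).elim
    · exact fun _ h => h.elim
    · exact fun h => (hO _ h).elim
    · exact fun _ h => h.elim
    · exact fun h => (hO _ h).elim
  let D : Opens M := ⟨c.U i ∩ c.U j, (c.isOpen i).inter (c.isOpen j)⟩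
  have : ContractibleSpace D := hU
  have : ParacompactSpace D := paracompactSpace_of_isPreconnected EM D
    (isPreconnected_iff_preconnectedSpace.2 (inferInstanceAs (PreconnectedSpace D)))
  classical
  obtain ⟨d₀⟩ : Nonempty D := inferInstance
  let s : D → X × X := fun x => (c.s i x, c.s j x)
  have hs : ContMDiff 𝓘(ℝ, EM) (IX.prod IX) ∞ s := by
    have h : ContMDiffOn 𝓘(ℝ, EM) (IX.prod IX) ∞ (fun x => (c.s i x, c.s j x)) (c.U i ∩ c.U j) :=
      ((c.s_smooth i).mono inter_subset_left).prodMk ((c.s_smooth j).mono inter_subset_right)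
    exact h.comp_contMDiff contMDiff_subtype_val fun x => x.2
  let b : Y → M := fun y => 𝒢.π (𝒢.gerbe.proj y).1
  have hb : ContMDiff IY 𝓘(ℝ, EM) ∞ b :=
    𝒢.π_smooth.comp (contMDiff_fst.comp 𝒢.gerbe.proj_smooth)
  -- The projection of `Y` to the base; its value `d₀` away from `D` is never used on `Y_ij`.
  let q : Y → D := fun y => if h : b y ∈ D then ⟨b y, h⟩ else d₀
  have hq : ∀ y ∈ c.YSet i j, (q y : M) = b y ∧ c.Over i j (q y) y := by
    rintro y ⟨x, hx⟩
    have h : b y ∈ D := by rw [show b y = x from hx.base]; exact ⟨hx.1, hx.2.1⟩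
    have e : (q y : M) = b y := by simp only [q, dif_pos h]
    exact ⟨e, by rwa [e, show b y = x from hx.base]⟩
  refine BundleGerbe.nonempty_trivialisation (E := EM) 𝒢.gerbe hs
    (fun x => GoodCover.pair_mem x.2.1 x.2.2) (fun x x' h => ?_) (q := q)
    (fun y hy => (hq y hy).2.2.2) ?_
  -- Injectivity holds because `π` inverts the section `s_i`.
  · have := congr_arg (fun p => 𝒢.π p.1) h
    simp only [s] at this
    rw [c.s_section i _ x.2.1, c.s_section i _ x'.2.1] at this
    exact Subtype.ext this
  · intro y hy
    have h : ContMDiffWithinAt IY 𝓘(ℝ, EM) ∞ (Subtype.val ∘ q) (c.YSet i j) y :=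
      (hb y).contMDiffWithinAt.congr (fun y hy => (hq y hy).1) (hq y hy).1
    exact (ContMDiffWithinAt.subtypeVal_comp_iff D q _ y).1 h

theorem nonempty_trivs (c : 𝒢.GoodCover) : Nonempty c.Trivs :=
  ⟨fun i j => (nonempty_trivialisation c i j).some⟩

theorem Descended.exists_section {c : 𝒢.GoodCover} {t : c.Trivs} {i j k : c.ι}
    (d : Descended c t i j k) :
    ∃ σ : ∀ x, d.L.Fib x, d.L.SmoothOn σ (c.U i ∩ c.U j ∩ c.U k) :=
  d.L.exists_smoothAlong (E := EM) (((c.isOpen i).inter (c.isOpen j)).inter (c.isOpen k))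
    (c.isGoodFamily.inter₃ i j k) contMDiffOn_id (mapsTo_id _)

end Choices

end Bundle2Gerbe

end ExistenceOfChoices

/-! ### The functions `g`: independence of representatives, smoothness, cocycle condition -/

section Cocycle

open Set TopologicalSpace

/-- Here `rₙ` stand for the changes of the four descent values, `sₙ` for the values divided by the
sections `σ`, and `α`, `α'` for the associator terms. The additive form is decided by `abel` and
transferred to the multiplicative one. -/
theorem ratio_identity {G : Type*} [AddCommGroup G] {r₁ r₂ r₃ r₄ s₁ s₂ s₃ s₄ α α' : G}
    (h : r₄ + r₂ + α = r₁ + r₃ + α') :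
    (r₁ + s₁) + -(r₂ + s₂) + (r₃ + s₃) + -(r₄ + s₄) + α' = s₁ + -s₂ + s₃ + -s₄ + α := by
  have e : (r₁ + s₁) + -(r₂ + s₂) + (r₃ + s₃) + -(r₄ + s₄) + α' - (s₁ + -s₂ + s₃ + -s₄ + α) =
      (r₁ + r₃ + α') - (r₄ + r₂ + α) := by abel
  rw [← sub_eq_zero, e, h, sub_self]

/-- The letters name the descent values by their index triples, and the `αₙ` are the associator
terms of the five faces. Eight triples cancel outright; `ilm` and `ijm` each occur at two different
bracketings, and the hypothesis balances their differences. -/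
theorem cocycle_identity {G : Type*} [AddCommGroup G]
    {klm jlm jkm jkl ilm ilm' ikm ikl ijm ijm' ijl ijk α₁ α₂ α₃ α₄ α₅ : G}
    (h : α₅ + (ilm - ilm') + (α₃ + (α₁ + (ijm - ijm'))) = α₂ + α₄) :
    (klm + -jlm + jkm + -jkl + α₁) + -(klm + -ilm + ikm + -ikl + α₂) +
      (jlm + -ilm' + ijm + -ijl + α₃) + -(jkm + -ikm + ijm' + -ijk + α₄) +
      (jkl + -ikl + ijl + -ijk + α₅) = 0 := by
  have e : (klm + -jlm + jkm + -jkl + α₁) + -(klm + -ilm + ikm + -ikl + α₂) +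
      (jlm + -ilm' + ijm + -ijl + α₃) + -(jkm + -ikm + ijm' + -ijk + α₄) +
      (jkl + -ikl + ijl + -ijk + α₅) =
      (α₅ + (ilm - ilm') + (α₃ + (α₁ + (ijm - ijm')))) - (α₂ + α₄) := by abel
  rw [e, h, sub_self]

theorem mul_ratio_identity {G : Type*} [CommGroup G] {r₁ r₂ r₃ r₄ s₁ s₂ s₃ s₄ α α' : G}
    (h : r₄ * r₂ * α = r₁ * r₃ * α') :
    (r₁ * s₁) * (r₂ * s₂)⁻¹ * (r₃ * s₃) * (r₄ * s₄)⁻¹ * α' = s₁ * s₂⁻¹ * s₃ * s₄⁻¹ * α :=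
  ratio_identity (G := Additive G) h

theorem mul_cocycle_identity {G : Type*} [CommGroup G]
    {klm jlm jkm jkl ilm ilm' ikm ikl ijm ijm' ijl ijk α₁ α₂ α₃ α₄ α₅ : G}
    (h : α₅ * (ilm / ilm') * (α₃ * (α₁ * (ijm / ijm'))) = α₂ * α₄) :
    (klm * jlm⁻¹ * jkm * jkl⁻¹ * α₁) * (klm * ilm⁻¹ * ikm * ikl⁻¹ * α₂)⁻¹ *
      (jlm * ilm'⁻¹ * ijm * ijl⁻¹ * α₃) * (jkm * ikm⁻¹ * ijm' * ijk⁻¹ * α₄)⁻¹ *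
      (jkl * ikl⁻¹ * ijl * ijk⁻¹ * α₅) = 1 :=
  cocycle_identity (G := Additive G) h

theorem CstarBundle.exists_smoothAlong_nhds {E : Type*} [NormedAddCommGroup E] [NormedSpace ℝ E]
    {H : Type*} [TopologicalSpace H] {I : ModelWithCorners ℝ E H} {N : Type*} [TopologicalSpace N]
    [ChartedSpace H N] {S : Set N} {E' : Type*} [NormedAddCommGroup E'] [NormedSpace ℝ E']
    {H' : Type*} [TopologicalSpace H'] {J : ModelWithCorners ℝ E' H'} {K : Type*}
    [TopologicalSpace K] [ChartedSpace H' K] (P : CstarBundle.{w} I S) {c : K → N} {A : Set K}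
    (hA : IsOpen A) (hc : ContMDiffOn J I ∞ c A) (hcS : MapsTo c A S) {k : K} (hk : k ∈ A) :
    ∃ τ : ∀ k, P.Fib (c k), ∃ O ∈ 𝓝 k, O ⊆ A ∧ P.SmoothAlong J c τ O := by
  obtain ⟨f, hf, hkf⟩ := P.frames_cover _ (hcS hk)
  have h := preimage_frame_mem hf hc.continuousOn hcS hk hkf
  rw [hA.nhdsWithin_eq hk] at h
  exact ⟨fun k => f.2 (c k), _, Filter.inter_mem (hA.mem_nhds hk) h, inter_subset_left,
    smoothAlong_frame hf (hc.mono inter_subset_left) (hcS.mono_left inter_subset_left)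
      fun _ hx => hx.2⟩

namespace Bundle2Gerbe

variable {EM : Type*} [NormedAddCommGroup EM] [NormedSpace ℝ EM] {HM : Type*} [TopologicalSpace HM]
  {EX : Type*} [NormedAddCommGroup EX] [NormedSpace ℝ EX] {HX : Type*} [TopologicalSpace HX]
  {EY : Type*} [NormedAddCommGroup EY] [NormedSpace ℝ EY] {HY : Type*} [TopologicalSpace HY]
  {IM : ModelWithCorners ℝ EM HM} {M : Type u} [TopologicalSpace M] [ChartedSpace HM M]
  {IX : ModelWithCorners ℝ EX HX} {X : Type uX} [TopologicalSpace X] [ChartedSpace HX X]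
  {IY : ModelWithCorners ℝ EY HY} {Y : Type uY} [TopologicalSpace Y] [ChartedSpace HY Y]
  {𝒢 : Bundle2Gerbe.{u, uX, uY, w} IM M IX X IY Y}

open GoodCover

namespace Choices

variable (C : 𝒢.Choices)

/-- The value of `g_ijkl` at `x`, computed from elements of the fibres of the bundles `L_ij`. -/
noncomputable def value {i j k l : C.c.ι} (x : M) {y₃₄ y₂₃ y₁₂ : Y}
    (u₃₄ : (C.t k l).L.Fib y₃₄) (u₂₃ : (C.t j k).L.Fib y₂₃) (u₁₂ : (C.t i j).L.Fib y₁₂)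
    (v₂₄ : (C.t j l).L.Fib (𝒢.m y₃₄ y₂₃)) (v₁₃ : (C.t i k).L.Fib (𝒢.m y₂₃ y₁₂))
    (l₁ : (C.t i l).L.Fib (𝒢.m (𝒢.m y₃₄ y₂₃) y₁₂))
    (l₂ : (C.t i l).L.Fib (𝒢.m y₃₄ (𝒢.m y₂₃ y₁₂))) : ℂˣ :=
  ((C.d j k l).D x u₃₄ v₂₄ u₂₃ /ₛ C.σ j k l x : ℂˣ) *
    ((C.d i k l).D x u₃₄ l₂ v₁₃ /ₛ C.σ i k l x : ℂˣ)⁻¹ *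
    ((C.d i j l).D x v₂₄ l₁ u₁₂ /ₛ C.σ i j l x : ℂˣ) *
    ((C.d i j k).D x u₂₃ v₁₃ u₁₂ /ₛ C.σ i j k x : ℂˣ)⁻¹ *
    (𝒢.a y₃₄ y₂₃ y₁₂ /ₛ (C.t i l).φ l₂ l₁ : ℂˣ)

variable {C} {i j k l : C.c.ι} {x : M} {y₃₄ y₂₃ y₁₂ y₃₄' y₂₃' y₁₂' : Y}

/-- Changing the representatives multiplies each descent value by a ratio of `mHat` to `φ`. The
descent property of the associator, rewritten with these ratios, says that their product compensates
the change of the associator term. -/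
theorem value_eq_value (h₃₄ : C.c.Over k l x y₃₄) (h₂₃ : C.c.Over j k x y₂₃)
    (h₁₂ : C.c.Over i j x y₁₂) (h₃₄' : C.c.Over k l x y₃₄') (h₂₃' : C.c.Over j k x y₂₃')
    (h₁₂' : C.c.Over i j x y₁₂')
    (u₃₄ : (C.t k l).L.Fib y₃₄) (u₂₃ : (C.t j k).L.Fib y₂₃) (u₁₂ : (C.t i j).L.Fib y₁₂)
    (v₂₄ : (C.t j l).L.Fib (𝒢.m y₃₄ y₂₃)) (v₁₃ : (C.t i k).L.Fib (𝒢.m y₂₃ y₁₂))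
    (l₁ : (C.t i l).L.Fib (𝒢.m (𝒢.m y₃₄ y₂₃) y₁₂)) (l₂ : (C.t i l).L.Fib (𝒢.m y₃₄ (𝒢.m y₂₃ y₁₂)))
    (u₃₄' : (C.t k l).L.Fib y₃₄') (u₂₃' : (C.t j k).L.Fib y₂₃') (u₁₂' : (C.t i j).L.Fib y₁₂')
    (v₂₄' : (C.t j l).L.Fib (𝒢.m y₃₄' y₂₃')) (v₁₃' : (C.t i k).L.Fib (𝒢.m y₂₃' y₁₂'))
    (l₁' : (C.t i l).L.Fib (𝒢.m (𝒢.m y₃₄' y₂₃') y₁₂'))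
    (l₂' : (C.t i l).L.Fib (𝒢.m y₃₄' (𝒢.m y₂₃' y₁₂'))) :
    C.value x u₃₄' u₂₃' u₁₂' v₂₄' v₁₃' l₁' l₂' = C.value x u₃₄ u₂₃ u₁₂ v₂₄ v₁₃ l₁ l₂ := by
  have h₁₃ := h₂₃.m h₁₂
  have h₁₃' := h₂₃'.m h₁₂'
  have h₂₄ := h₃₄.m h₂₃
  have h₂₄' := h₃₄'.m h₂₃'
  have hl₁ := h₂₄.m h₁₂
  have hl₁' := h₂₄'.m h₁₂'
  have hl₂ := h₃₄.m h₁₃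
  have hl₂' := h₃₄'.m h₁₃'
  have e₁ := (C.d j k l).D_sdiv_D h₃₄ h₃₄' h₂₃ h₂₃' u₃₄ u₃₄' v₂₄ v₂₄' u₂₃ u₂₃'
  have e₂ := (C.d i k l).D_sdiv_D h₃₄ h₃₄' h₁₃ h₁₃' u₃₄ u₃₄' l₂ l₂' v₁₃ v₁₃'
  have e₃ := (C.d i j l).D_sdiv_D h₂₄ h₂₄' h₁₂ h₁₂' v₂₄ v₂₄' l₁ l₁' u₁₂ u₁₂'
  have e₄ := (C.d i j k).D_sdiv_D h₂₃ h₂₃' h₁₂ h₁₂' u₂₃ u₂₃' v₁₃ v₁₃' u₁₂ u₁₂'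
  simp only [value]
  rw [← sdiv_mul_sdiv_cancel _ ((C.d j k l).D x u₃₄ v₂₄ u₂₃) (C.σ j k l x),
    ← sdiv_mul_sdiv_cancel _ ((C.d i k l).D x u₃₄ l₂ v₁₃) (C.σ i k l x),
    ← sdiv_mul_sdiv_cancel _ ((C.d i j l).D x v₂₄ l₁ u₁₂) (C.σ i j l x),
    ← sdiv_mul_sdiv_cancel _ ((C.d i j k).D x u₂₃ v₁₃ u₁₂) (C.σ i j k x)]
  refine mul_ratio_identity ?_
  generalize (C.d j k l).D x u₃₄' v₂₄' u₂₃' /ₛ (C.d j k l).D x u₃₄ v₂₄ u₂₃ = r₁ at e₁ ⊢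
  generalize (C.d i k l).D x u₃₄' l₂' v₁₃' /ₛ (C.d i k l).D x u₃₄ l₂ v₁₃ = r₂ at e₂ ⊢
  generalize (C.d i j l).D x v₂₄' l₁' u₁₂' /ₛ (C.d i j l).D x v₂₄ l₁ u₁₂ = r₃ at e₃ ⊢
  generalize (C.d i j k).D x u₂₃' v₁₃' u₁₂' /ₛ (C.d i j k).D x u₂₃ v₁₃ u₁₂ = r₄ at e₄ ⊢
  -- In this form each `mHat` of `φ`s is a scalar times a `φ`, so both sides of `ha` become
  -- multiples of the same element of a fibre of `Q`, and the scalars can be compared.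
  rw [eq_comm, ← eq_smul_iff_sdiv_eq] at e₁ e₂ e₃ e₄
  have ha := 𝒢.a_descent (h₃₄.proj_eq h₃₄') (h₂₃.proj_eq h₂₃') (h₁₂.proj_eq h₁₂')
    (h₂₃.snd_eq_fst h₁₂) (h₃₄.snd_eq_fst h₂₃) ((C.t k l).φ u₃₄' u₃₄) ((C.t j k).φ u₂₃' u₂₃)
    ((C.t i j).φ u₁₂' u₁₂)
  have hs₂ := 𝒢.mHat_smul (h₃₄.proj_eq h₃₄') (h₁₃.proj_eq h₁₃') (h₃₄.snd_eq_fst h₁₃) 1 r₄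
    ((C.t k l).φ u₃₄' u₃₄) ((C.t i k).φ v₁₃' v₁₃)
  have hs₁ := 𝒢.mHat_smul (h₂₄.proj_eq h₂₄') (h₁₂.proj_eq h₁₂') (h₂₄.snd_eq_fst h₁₂) r₁ 1
    ((C.t j l).φ v₂₄' v₂₄) ((C.t i j).φ u₁₂' u₁₂)
  rw [one_smul, one_mul] at hs₂
  rw [one_smul, mul_one] at hs₁
  rw [e₄, e₁, hs₂, hs₁, e₂, e₃, smul_smul, smul_smul,
    𝒢.gerbe.smul_mul (hl₁.proj_eq hl₂) (hl₂.proj_eq hl₂'),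
    𝒢.gerbe.mul_smul_right (hl₁.proj_eq hl₁') (hl₁'.proj_eq hl₂')] at ha
  rw [← sdiv_smul (𝒢.a y₃₄ y₂₃ y₁₂) ((C.t i l).φ l₂ l₁),
    ← sdiv_smul (𝒢.a y₃₄' y₂₃' y₁₂') ((C.t i l).φ l₂' l₁'),
    𝒢.gerbe.mul_smul_right (hl₁.proj_eq hl₂) (hl₂.proj_eq hl₂'),
    𝒢.gerbe.smul_mul (hl₁.proj_eq hl₁') (hl₁'.proj_eq hl₂'),
    (C.t i l).φ_mul hl₁.mem hl₂.mem hl₂'.mem (hl₁.proj_eq hl₂) (hl₂.proj_eq hl₂'),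
    (C.t i l).φ_mul hl₁.mem hl₁'.mem hl₂'.mem (hl₁.proj_eq hl₁') (hl₁'.proj_eq hl₂'),
    smul_smul, smul_smul] at ha
  exact smul_right_cancel _ ha

variable (C) in
theorem exists_represents : ∃ g, C.Represents g := by
  classical
  have h : ∀ (i j k l : C.c.ι) (x : M), ∃ z : ℂˣ, ∀ y₃₄ y₂₃ y₁₂ : Y,
      C.c.Over k l x y₃₄ → C.c.Over j k x y₂₃ → C.c.Over i j x y₁₂ →
      ∀ (u₃₄ : (C.t k l).L.Fib y₃₄) (u₂₃ : (C.t j k).L.Fib y₂₃) (u₁₂ : (C.t i j).L.Fib y₁₂)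
        (v₂₄ : (C.t j l).L.Fib (𝒢.m y₃₄ y₂₃)) (v₁₃ : (C.t i k).L.Fib (𝒢.m y₂₃ y₁₂))
        (l₁ : (C.t i l).L.Fib (𝒢.m (𝒢.m y₃₄ y₂₃) y₁₂))
        (l₂ : (C.t i l).L.Fib (𝒢.m y₃₄ (𝒢.m y₂₃ y₁₂))),
        C.value x u₃₄ u₂₃ u₁₂ v₂₄ v₁₃ l₁ l₂ = z := by
    intro i j k l x
    by_cases hx : ∃ y₃₄ y₂₃ y₁₂, C.c.Over k l x y₃₄ ∧ C.c.Over j k x y₂₃ ∧ C.c.Over i j x y₁₂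
    · obtain ⟨y₃₄, y₂₃, y₁₂, h₃₄, h₂₃, h₁₂⟩ := hx
      exact ⟨C.value x (Classical.arbitrary _) (Classical.arbitrary _) (Classical.arbitrary _)
        (Classical.arbitrary _) (Classical.arbitrary _) (Classical.arbitrary _)
        (Classical.arbitrary _), fun _ _ _ h₃₄' h₂₃' h₁₂' _ _ _ _ _ _ _ =>
          value_eq_value h₃₄ h₂₃ h₁₂ h₃₄' h₂₃' h₁₂' _ _ _ _ _ _ _ _ _ _ _ _ _ _⟩
    · exact ⟨1, fun y₃₄ y₂₃ y₁₂ h₃₄ h₂₃ h₁₂ => (hx ⟨y₃₄, y₂₃, y₁₂, h₃₄, h₂₃, h₁₂⟩).elim⟩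
  choose g hg using h
  exact ⟨g, hg⟩

variable {g g' : C.c.ι → C.c.ι → C.c.ι → C.c.ι → M → ℂˣ}

theorem Represents.eq (h : C.Represents g) (h' : C.Represents g')
    (hx : x ∈ C.c.U i ∩ C.c.U j ∩ C.c.U k ∩ C.c.U l) : g' i j k l x = g i j k l x := by
  obtain ⟨⟨⟨hi, hj⟩, hk⟩, hl⟩ := hx
  obtain ⟨y₁₂, h₁₂⟩ := exists_over hi hj
  obtain ⟨y₂₃, h₂₃⟩ := exists_over hj hk
  obtain ⟨y₃₄, h₃₄⟩ := exists_over hk hl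
  have e := h i j k l x y₃₄ y₂₃ y₁₂ h₃₄ h₂₃ h₁₂ (Classical.arbitrary _) (Classical.arbitrary _)
    (Classical.arbitrary _) (Classical.arbitrary _) (Classical.arbitrary _) (Classical.arbitrary _)
    (Classical.arbitrary _)
  exact (h' i j k l x y₃₄ y₂₃ y₁₂ h₃₄ h₂₃ h₁₂ _ _ _ _ _ _ _).symm.trans e

/-- Since any representatives may be used, they can be taken along smooth local sections of `Y` and
smooth local frames; every factor is then a quotient of smooth sections. -/
theorem Represents.smooth (h : C.Represents g) (i j k l : C.c.ι) :
    SmoothUnitOn IM (g i j k l) (C.c.U i ∩ C.c.U j ∩ C.c.U k ∩ C.c.U l) := by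
  refine SmoothUnitOn.of_local fun x hx => ?_
  obtain ⟨⟨⟨hi, hj⟩, hk⟩, hl⟩ := hx
  obtain ⟨V₁, hV₁, hx₁, η₁₂, s₁₂, o₁₂⟩ := exists_local_section hi hj
  obtain ⟨V₂, hV₂, hx₂, η₂₃, s₂₃, o₂₃⟩ := exists_local_section hj hk
  obtain ⟨V₃, hV₃, hx₃, η₃₄, s₃₄, o₃₄⟩ := exists_local_section hk hl
  obtain ⟨V, hV, hxV, hVV⟩ : ∃ V, IsOpen V ∧ x ∈ V ∧ V ⊆ V₁ ∩ V₂ ∩ V₃ :=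
    ⟨_, (hV₁.inter hV₂).inter hV₃, ⟨⟨hx₁, hx₂⟩, hx₃⟩, subset_rfl⟩
  replace s₁₂ := s₁₂.mono (t := V) fun _ h => (hVV h).1.1
  replace s₂₃ := s₂₃.mono (t := V) fun _ h => (hVV h).1.2
  replace s₃₄ := s₃₄.mono (t := V) fun _ h => (hVV h).2
  replace o₁₂ : ∀ x ∈ V, _ := fun x h => o₁₂ x (hVV h).1.1
  replace o₂₃ : ∀ x ∈ V, _ := fun x h => o₂₃ x (hVV h).1.2
  replace o₃₄ : ∀ x ∈ V, _ := fun x h => o₃₄ x (hVV h).2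
  have o₁₃ := fun x h => (o₂₃ x h).m (o₁₂ x h)
  have o₂₄ := fun x h => (o₃₄ x h).m (o₂₃ x h)
  have p₁ := fun x h => (o₂₄ x h).m (o₁₂ x h)
  have p₂ := fun x h => (o₃₄ x h).m (o₁₃ x h)
  have s₁₃ := contMDiffOn_m s₂₃ s₁₂ fun x h => (o₂₃ x h).snd_eq_fst (o₁₂ x h)
  have s₂₄ := contMDiffOn_m s₃₄ s₂₃ fun x h => (o₃₄ x h).snd_eq_fst (o₂₃ x h)
  have q₁ := contMDiffOn_m s₂₄ s₁₂ fun x h => (o₂₄ x h).snd_eq_fst (o₁₂ x h)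
  have q₂ := contMDiffOn_m s₃₄ s₁₃ fun x h => (o₃₄ x h).snd_eq_fst (o₁₃ x h)
  obtain ⟨u₁₂, O₁, hO₁, -, hu₁₂⟩ := (C.t i j).L.exists_smoothAlong_nhds hV s₁₂
    (fun x h => (o₁₂ x h).mem) hxV
  obtain ⟨u₂₃, O₂, hO₂, -, hu₂₃⟩ := (C.t j k).L.exists_smoothAlong_nhds hV s₂₃
    (fun x h => (o₂₃ x h).mem) hxV
  obtain ⟨u₃₄, O₃, hO₃, -, hu₃₄⟩ := (C.t k l).L.exists_smoothAlong_nhds hV s₃₄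
    (fun x h => (o₃₄ x h).mem) hxV
  obtain ⟨v₁₃, O₄, hO₄, -, hv₁₃⟩ := (C.t i k).L.exists_smoothAlong_nhds hV s₁₃
    (fun x h => (o₁₃ x h).mem) hxV
  obtain ⟨v₂₄, O₅, hO₅, -, hv₂₄⟩ := (C.t j l).L.exists_smoothAlong_nhds hV s₂₄
    (fun x h => (o₂₄ x h).mem) hxV
  obtain ⟨l₁, O₆, hO₆, -, hl₁⟩ := (C.t i l).L.exists_smoothAlong_nhds hV q₁
    (fun x h => (p₁ x h).mem) hxV
  obtain ⟨l₂, O₇, hO₇, -, hl₂⟩ := (C.t i l).L.exists_smoothAlong_nhds hV q₂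
    (fun x h => (p₂ x h).mem) hxV
  set O : Set M := V ∩ (O₁ ∩ O₂ ∩ O₃ ∩ O₄ ∩ O₅ ∩ O₆ ∩ O₇) with hO
  have hxO : O ∈ 𝓝 x := Filter.inter_mem (hV.mem_nhds hxV) (Filter.inter_mem (Filter.inter_mem
    (Filter.inter_mem (Filter.inter_mem (Filter.inter_mem (Filter.inter_mem hO₁ hO₂) hO₃) hO₄)
      hO₅) hO₆) hO₇)
  have l : O ⊆ V := inter_subset_left
  replace hu₁₂ := hu₁₂.mono (A' := O) fun x h => h.2.1.1.1.1.1.1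
  replace hu₂₃ := hu₂₃.mono (A' := O) fun x h => h.2.1.1.1.1.1.2
  replace hu₃₄ := hu₃₄.mono (A' := O) fun x h => h.2.1.1.1.1.2
  replace hv₁₃ := hv₁₃.mono (A' := O) fun x h => h.2.1.1.1.2
  replace hv₂₄ := hv₂₄.mono (A' := O) fun x h => h.2.1.1.2
  replace hl₁ := hl₁.mono (A' := O) fun x h => h.2.1.2
  replace hl₂ := hl₂.mono (A' := O) fun x h => h.2.2
  replace s₁₂ := s₁₂.mono l
  replace s₂₃ := s₂₃.mono l
  replace s₃₄ := s₃₄.mono l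
  replace s₁₃ := s₁₃.mono l
  replace s₂₄ := s₂₄.mono l
  replace q₁ := q₁.mono l
  replace q₂ := q₂.mono l
  have hσ : ∀ {i j k : C.c.ι}, (∀ x ∈ O, x ∈ C.c.U i ∩ C.c.U j ∩ C.c.U k) →
      ∀ {τ : ∀ x, (C.d i j k).L.Fib x}, (C.d i j k).L.SmoothAlong IM (fun x => x) τ O →
      SmoothUnitOn IM (fun x => τ x /ₛ C.σ i j k x) O := fun hU _ hτ =>
    hτ.sdiv ((C.σ_smooth _ _ _).mono hU) continuousOn_id hU
  have d₁ := hσ (fun x h => ⟨⟨(o₂₃ x (l h)).1, (o₂₃ x (l h)).2.1⟩, (o₃₄ x (l h)).2.1⟩)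
    ((C.d _ _ _).smoothAlong_D (b := fun x => x) s₃₄ s₂₃ (fun x h => o₃₄ x (l h))
      (fun x h => o₂₃ x (l h)) hu₃₄ hv₂₄ hu₂₃)
  have d₂ := hσ (fun x h => ⟨⟨(o₁₃ x (l h)).1, (o₁₃ x (l h)).2.1⟩, (o₃₄ x (l h)).2.1⟩)
    ((C.d _ _ _).smoothAlong_D (b := fun x => x) s₃₄ s₁₃ (fun x h => o₃₄ x (l h))
      (fun x h => o₁₃ x (l h)) hu₃₄ hl₂ hv₁₃)
  have d₃ := hσ (fun x h => ⟨⟨(o₁₂ x (l h)).1, (o₁₂ x (l h)).2.1⟩, (o₂₄ x (l h)).2.1⟩)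
    ((C.d _ _ _).smoothAlong_D (b := fun x => x) s₂₄ s₁₂ (fun x h => o₂₄ x (l h))
      (fun x h => o₁₂ x (l h)) hv₂₄ hl₁ hu₁₂)
  have d₄ := hσ (fun x h => ⟨⟨(o₁₂ x (l h)).1, (o₁₂ x (l h)).2.1⟩, (o₂₃ x (l h)).2.1⟩)
    ((C.d _ _ _).smoothAlong_D (b := fun x => x) s₂₃ s₁₂ (fun x h => o₂₃ x (l h))
      (fun x h => o₁₂ x (l h)) hu₂₃ hv₁₃ hu₁₂)
  have ha : 𝒢.gerbe.bundle.SmoothAlong IM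
      (fun x => (𝒢.m (𝒢.m (η₃₄ x) (η₂₃ x)) (η₁₂ x), 𝒢.m (η₃₄ x) (𝒢.m (η₂₃ x) (η₁₂ x))))
      (fun x => 𝒢.a (η₃₄ x) (η₂₃ x) (η₁₂ x)) O :=
    𝒢.a_smooth.comp (s₃₄.prodMk (s₂₃.prodMk s₁₂)) fun x h =>
      ⟨(o₂₃ x (l h)).snd_eq_fst (o₁₂ x (l h)), (o₃₄ x (l h)).snd_eq_fst (o₂₃ x (l h))⟩
  have pp := fun x (h : x ∈ O) => (p₁ x (l h)).proj_eq (p₂ x (l h))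
  have da := ha.sdiv (BundleGerbe.Trivialisation.smoothAlong_φ q₁ q₂ (fun x h => (p₁ x (l h)).mem)
    (fun x h => (p₂ x (l h)).mem) pp hl₂ hl₁) (q₁.prodMk q₂).continuousOn
    (BundleGerbe.mapsTo_pair pp)
  refine ⟨O, mem_nhdsWithin_of_mem_nhds hxO, (((((d₁.mul d₂.inv).mul d₃).mul d₄.inv).mul da).mono
    inter_subset_right).congr fun x hx => ?_⟩
  exact (h _ _ _ _ x _ _ _ (o₃₄ x (l hx.2)) (o₂₃ x (l hx.2)) (o₁₂ x (l hx.2)) _ _ _ _ _ _ _).symm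

/-- One element is fixed over every bracketing of the four points, including the five vertices of
the pentagon, and is used in all five values of `g`. Almost all descent values cancel in pairs; the
two leftover ratios are the associators whiskered by units, and coherency balances the rest. -/
theorem Represents.cocycle (h : C.Represents g) {i j k l m : C.c.ι}
    (hx : x ∈ C.c.U i ∩ C.c.U j ∩ C.c.U k ∩ C.c.U l ∩ C.c.U m) :
    g j k l m x * (g i k l m x)⁻¹ * g i j l m x * (g i j k m x)⁻¹ * g i j k l x = 1 := by
  obtain ⟨⟨⟨⟨hi, hj⟩, hk⟩, hl⟩, hm⟩ := hx
  obtain ⟨y₁₂, h₁₂⟩ := exists_over hi hj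
  obtain ⟨y₂₃, h₂₃⟩ := exists_over hj hk
  obtain ⟨y₃₄, h₃₄⟩ := exists_over hk hl
  obtain ⟨y₄₅, h₄₅⟩ := exists_over hl hm
  have h₁₃ := h₂₃.m h₁₂
  have h₂₄ := h₃₄.m h₂₃
  have h₃₅ := h₄₅.m h₃₄
  have hl₁ := h₂₄.m h₁₂
  have hl₂ := h₃₄.m h₁₃
  have hk₁ := h₃₅.m h₂₃
  have hk₂ := h₄₅.m h₂₄
  have q₁ := hk₁.m h₁₂
  have q₂ := h₃₅.m h₁₃
  have q₃ := h₄₅.m hl₂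
  have q₄ := h₄₅.m hl₁
  have q₅ := hk₂.m h₁₂
  have arb : ∀ i j y, Nonempty ((C.t i j).L.Fib y) := fun _ _ _ => inferInstance
  obtain ⟨u₁₂⟩ := arb i j y₁₂
  obtain ⟨u₂₃⟩ := arb j k y₂₃
  obtain ⟨u₃₄⟩ := arb k l y₃₄
  obtain ⟨u₄₅⟩ := arb l m y₄₅
  obtain ⟨v₁₃⟩ := arb i k (𝒢.m y₂₃ y₁₂)
  obtain ⟨v₂₄⟩ := arb j l (𝒢.m y₃₄ y₂₃)
  obtain ⟨v₃₅⟩ := arb k m (𝒢.m y₄₅ y₃₄)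
  obtain ⟨l₁⟩ := arb i l (𝒢.m (𝒢.m y₃₄ y₂₃) y₁₂)
  obtain ⟨l₂⟩ := arb i l (𝒢.m y₃₄ (𝒢.m y₂₃ y₁₂))
  obtain ⟨k₁⟩ := arb j m (𝒢.m (𝒢.m y₄₅ y₃₄) y₂₃)
  obtain ⟨k₂⟩ := arb j m (𝒢.m y₄₅ (𝒢.m y₃₄ y₂₃))
  obtain ⟨p₁⟩ := arb i m (𝒢.m (𝒢.m (𝒢.m y₄₅ y₃₄) y₂₃) y₁₂)
  obtain ⟨p₂⟩ := arb i m (𝒢.m (𝒢.m y₄₅ y₃₄) (𝒢.m y₂₃ y₁₂))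
  obtain ⟨p₃⟩ := arb i m (𝒢.m y₄₅ (𝒢.m y₃₄ (𝒢.m y₂₃ y₁₂)))
  obtain ⟨p₄⟩ := arb i m (𝒢.m y₄₅ (𝒢.m (𝒢.m y₃₄ y₂₃) y₁₂))
  obtain ⟨p₅⟩ := arb i m (𝒢.m (𝒢.m y₄₅ (𝒢.m y₃₄ y₂₃)) y₁₂)
  rw [← h j k l m x y₄₅ y₃₄ y₂₃ h₄₅ h₃₄ h₂₃ u₄₅ u₃₄ u₂₃ v₃₅ v₂₄ k₁ k₂,
    ← h i k l m x y₄₅ y₃₄ _ h₄₅ h₃₄ h₁₃ u₄₅ u₃₄ v₁₃ v₃₅ l₂ p₂ p₃,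
    ← h i j l m x y₄₅ _ y₁₂ h₄₅ h₂₄ h₁₂ u₄₅ v₂₄ u₁₂ k₂ l₁ p₅ p₄,
    ← h i j k m x _ y₂₃ y₁₂ h₃₅ h₂₃ h₁₂ v₃₅ u₂₃ u₁₂ k₁ v₁₃ p₁ p₂,
    ← h i j k l x y₃₄ y₂₃ y₁₂ h₃₄ h₂₃ h₁₂ u₃₄ u₂₃ u₁₂ v₂₄ v₁₃ l₁ l₂]
  refine mul_cocycle_identity ?_
  -- `L_ilm` and `L_ijm` are met at two bracketings each. In both cases one outer factor does not
  -- move, so its `φ u u` is a unit.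
  rw [sdiv_div_sdiv_cancel_right, sdiv_div_sdiv_cancel_right,
    (C.d i l m).D_sdiv_D h₄₅ h₄₅ hl₁ hl₂, (C.d i j m).D_sdiv_D hk₁ hk₂ h₁₂ h₁₂,
    (C.t l m).φ_self h₄₅.mem, (C.t i j).φ_self h₁₂.mem]
  have e := 𝒢.a_coherent y₄₅ y₃₄ y₂₃ y₁₂ (h₂₃.snd_eq_fst h₁₂) (h₃₄.snd_eq_fst h₂₃)
    (h₄₅.snd_eq_fst h₃₄)
  have e₁ := 𝒢.mHat_smul rfl (hl₁.proj_eq hl₂) (h₄₅.snd_eq_fst hl₁) 1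
    (𝒢.a y₃₄ y₂₃ y₁₂ /ₛ (C.t i l).φ l₂ l₁) (𝒢.gerbe.unit y₄₅) ((C.t i l).φ l₂ l₁)
  have e₂ := 𝒢.mHat_smul (hk₁.proj_eq hk₂) rfl (hk₁.snd_eq_fst h₁₂)
    (𝒢.a y₄₅ y₃₄ y₂₃ /ₛ (C.t j m).φ k₂ k₁) 1 ((C.t j m).φ k₂ k₁) (𝒢.gerbe.unit y₁₂)
  rw [one_smul, one_mul, sdiv_smul,
    ← sdiv_smul (𝒢.mHat (𝒢.gerbe.unit y₄₅) ((C.t i l).φ l₂ l₁)) ((C.t i m).φ p₃ p₄),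
    smul_smul] at e₁
  rw [one_smul, mul_one, sdiv_smul,
    ← sdiv_smul (𝒢.mHat ((C.t j m).φ k₂ k₁) (𝒢.gerbe.unit y₁₂)) ((C.t i m).φ p₅ p₁),
    smul_smul] at e₂
  -- Each edge of the pentagon is written as a scalar times the isomorphism between its two
  -- vertices. These isomorphisms compose to that from `p₁` to `p₃` along both paths, so only the
  -- scalars remain.
  rw [e₁, e₂, ← sdiv_smul (𝒢.a y₄₅ (𝒢.m y₃₄ y₂₃) y₁₂) ((C.t i m).φ p₄ p₅),
    ← sdiv_smul (𝒢.a y₄₅ y₃₄ (𝒢.m y₂₃ y₁₂)) ((C.t i m).φ p₃ p₂),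
    ← sdiv_smul (𝒢.a (𝒢.m y₄₅ y₃₄) y₂₃ y₁₂) ((C.t i m).φ p₂ p₁),
    𝒢.gerbe.mul_smul (q₁.proj_eq q₅) (q₅.proj_eq q₄),
    𝒢.gerbe.mul_smul (q₁.proj_eq q₄) (q₄.proj_eq q₃),
    𝒢.gerbe.mul_smul (q₁.proj_eq q₂) (q₂.proj_eq q₃),
    (C.t i m).φ_mul q₁.mem q₅.mem q₄.mem (q₁.proj_eq q₅) (q₅.proj_eq q₄),
    (C.t i m).φ_mul q₁.mem q₄.mem q₃.mem (q₁.proj_eq q₄) (q₄.proj_eq q₃),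
    (C.t i m).φ_mul q₁.mem q₂.mem q₃.mem (q₁.proj_eq q₂) (q₂.proj_eq q₃)] at e
  exact smul_right_cancel _ e

end Choices

end Bundle2Gerbe

end Cocycle

/-! ### Classes in the direct limit and refinement -/

section CechClasses

open Set

theorem prism_mem {X A : Type*} [AddCommGroup A] (B : AddSubgroup A) {S : Set X} :
    ∀ {n : ℕ} (c : (Fin (n + 1) → X) → A) (_ : ∀ t, (∀ k, t k ∈ S) → c t ∈ B)
      (e : Fin n → X × X) (_ : ∀ k, (e k).1 ∈ S ∧ (e k).2 ∈ S), prism c e ∈ B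
  | 0, _, _, _, _ => B.zero_mem
  | n + 1, c, hc, e, he => by
    rw [prism]
    refine B.sub_mem (hc _ fun k => ?_) (prism_mem B _ (fun t ht => hc _ fun k => ?_) _
      fun k => he _)
    · refine Fin.cases ?_ (fun k => ?_) k
      · simpa using (he 0).1
      · simpa using (he k).2
    · refine Fin.cases ?_ (fun k => ?_) k
      · simpa using (he 0).1
      · simpa using ht k

theorem prism_map {X A B : Type*} [AddCommGroup A] [AddCommGroup B] (f : A →+ B) :
    ∀ {n : ℕ} (c : (Fin (n + 1) → X) → A) (e : Fin n → X × X),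
      prism (fun t => f (c t)) e = f (prism c e)
  | 0, _, _ => by simp [prism]
  | n + 1, c, e => by
    have : contr (e 0).1 (fun t => f (c t)) = fun t => f (contr (e 0).1 c t) := rfl
    rw [prism, prism, map_sub, this, prism_map]

variable {M : Type u} {A : Type*} [AddCommGroup A]

/-- Two refinement maps induce the same map in cohomology. -/
theorem cechBoundaries_refine_sub (F : FunctionSheaf M A) {ι κ : Type*} {U : ι → Set M}
    {W : κ → Set M} {ρ ρ' : κ → ι} (hρ : ∀ k, W k ⊆ U (ρ k)) (hρ' : ∀ k, W k ⊆ U (ρ' k)) {n : ℕ}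
    {g : (Fin (n + 2) → ι) → M → A} (hg : g ∈ cechCocycles F U (n + 1)) :
    ((fun i => g (ρ ∘ i)) - fun i => g (ρ' ∘ i)) ∈ cechBoundaries F W (n + 1) := by
  -- The prism joins the two refinement maps. Its tuples mix indices from `ρ'` and `ρ`, which is
  -- harmless because `W k` lies in both corresponding members; the cocycle condition removes the
  -- error term.
  refine ⟨fun i x => prism (fun j => g j x) fun k => (ρ' (i k), ρ (i k)), fun i => ?_,
    fun i x hx => ?_⟩
  · change (fun x => prism (fun j => g j x) fun k => (ρ' (i k), ρ (i k))) ∈ _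
    have e : (fun x => prism (fun j => g j x) fun k => (ρ' (i k), ρ (i k))) =
        prism g fun k => (ρ' (i k), ρ (i k)) := by
      funext x
      exact prism_map (Pi.evalAddMonoidHom (fun _ => A) x) g _
    rw [e]
    refine prism_mem _ (S := {a | (⋂ k, W (i k)) ⊆ U a}) g (fun t ht => ?_) _ fun k =>
      ⟨(iInter_subset _ k).trans (hρ' _), (iInter_subset _ k).trans (hρ _)⟩
    exact F.mono (subset_iInter ht) (hg.1 t)
  · have h := altD_prism (fun j => g j x) fun k => (ρ' (i k), ρ (i k))
    rw [prism_eq_zero (S := {a | x ∈ U a}) (altD fun j => g j x) (fun t ht => hg.2 t x (mem_iInter.2 ht))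
      (fun k => (ρ' (i k), ρ (i k))) (fun k => ⟨hρ' _ (mem_iInter.1 hx k), hρ _ (mem_iInter.1 hx k)⟩), add_zero] at h
    exact h.symm

theorem cechBoundaries_congr (F : FunctionSheaf M A) {ι : Type*} {U : ι → Set M} {n : ℕ}
    {g g' : (Fin (n + 2) → ι) → M → A} (hg : g ∈ cechBoundaries F U (n + 1))
    (h : ∀ i, ∀ x ∈ ⋂ k, U (i k), g' i x = g i x) : g' ∈ cechBoundaries F U (n + 1) := by
  obtain ⟨f, hf, hgf⟩ := hg
  exact ⟨f, hf, fun i x hx => (h i x hx).trans (hgf i x hx)⟩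

variable [TopologicalSpace M] {F : FunctionSheaf M A} {n : ℕ} {𝒰 𝒱 : PointedCover M}

/-- The intersection of two pointed covers. -/
def PointedCover.inf (𝒰 𝒱 : PointedCover M) : PointedCover M where
  U x := 𝒰.U x ∩ 𝒱.U x
  isOpen x := (𝒰.isOpen x).inter (𝒱.isOpen x)
  mem x := ⟨𝒰.mem x, 𝒱.mem x⟩

theorem PointedCover.le_inf_left (𝒰 𝒱 : PointedCover M) : 𝒰 ≤ 𝒰.inf 𝒱 := fun _ => inter_subset_left

theorem PointedCover.le_inf_right (𝒰 𝒱 : PointedCover M) : 𝒱 ≤ 𝒰.inf 𝒱 :=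
  fun _ => inter_subset_right

instance : IsDirectedOrder (PointedCover M) :=
  ⟨fun 𝒰 𝒱 => ⟨𝒰.inf 𝒱, 𝒰.le_inf_left 𝒱, 𝒰.le_inf_right 𝒱⟩⟩

instance : Nonempty (PointedCover M) :=
  ⟨⟨fun _ => univ, fun _ => isOpen_univ, fun _ => mem_univ _⟩⟩

instance : DirectedSystem (fun 𝒰 : PointedCover M => CechHCover F 𝒰.U n)
    fun 𝒰 𝒱 h => cechRestrict F n 𝒰 𝒱 h where
  map_self 𝒰 x := by
    obtain ⟨g, rfl⟩ := QuotientAddGroup.mk_surjective x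
    rfl
  map_map 𝒰 𝒱 𝒲 h h' x := by
    obtain ⟨g, rfl⟩ := QuotientAddGroup.mk_surjective x
    rfl

theorem exists_cechClass_eq (κ : CechH F n) : ∃ (𝒰 : PointedCover M) (g : (Fin (n + 1) → M) → M → A)
    (hg : g ∈ cechCocycles F 𝒰.U n), cechClass F 𝒰 g hg = κ := by
  classical
  induction κ using AddCommGroup.DirectLimit.induction_on with
  | ih 𝒰 x =>
    obtain ⟨⟨g, hg⟩, rfl⟩ := QuotientAddGroup.mk_surjective x
    exact ⟨𝒰, g, hg, rfl⟩

theorem cechClass_of_le (h : 𝒰 ≤ 𝒱) {g : (Fin (n + 1) → M) → M → A}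
    (hg : g ∈ cechCocycles F 𝒰.U n) :
    cechClass F 𝒱 g (cechCocycles_mono F h n hg) = cechClass F 𝒰 g hg := by
  classical
  exact AddCommGroup.DirectLimit.of_f (f := cechRestrict F n) h (QuotientAddGroup.mk ⟨g, hg⟩)

theorem cechClass_sub {g g' : (Fin (n + 1) → M) → M → A} (hg : g ∈ cechCocycles F 𝒰.U n)
    (hg' : g' ∈ cechCocycles F 𝒰.U n) :
    cechClass F 𝒰 (g - g') (sub_mem hg hg') = cechClass F 𝒰 g hg - cechClass F 𝒰 g' hg' := by
  classical
  exact map_sub (AddCommGroup.DirectLimit.of (fun 𝒰 : PointedCover M => CechHCover F 𝒰.U n)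
    (cechRestrict F n) 𝒰) (QuotientAddGroup.mk ⟨g, hg⟩) (QuotientAddGroup.mk ⟨g', hg'⟩)

theorem cechClass_eq_zero {g : (Fin (n + 1) → M) → M → A} (hg : g ∈ cechCocycles F 𝒰.U n)
    (h : g ∈ cechBoundaries F 𝒰.U n) : cechClass F 𝒰 g hg = 0 := by
  classical
  have : (QuotientAddGroup.mk ⟨g, hg⟩ : CechHCover F 𝒰.U n) = 0 :=
    (QuotientAddGroup.eq_zero_iff _).2 h
  rw [cechClass, this, map_zero]

theorem exists_boundary_of_cechClass_eq_zero {g : (Fin (n + 1) → M) → M → A}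
    (hg : g ∈ cechCocycles F 𝒰.U n) (h : cechClass F 𝒰 g hg = 0) :
    ∃ 𝒱, 𝒰 ≤ 𝒱 ∧ g ∈ cechBoundaries F 𝒱.U n := by
  classical
  obtain ⟨𝒱, h𝒱, hz⟩ := AddCommGroup.DirectLimit.of.zero_exact (f := cechRestrict F n) 𝒰 _ h
  exact ⟨𝒱, h𝒱, (QuotientAddGroup.eq_zero_iff (⟨g, cechCocycles_mono F h𝒱 n hg⟩ :
    cechCocycles F 𝒱.U n)).1 hz⟩

theorem cechClass_eq_of_sub_mem {g g' : (Fin (n + 1) → M) → M → A} (hg : g ∈ cechCocycles F 𝒰.U n)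
    (hg' : g' ∈ cechCocycles F 𝒰.U n) (h : g - g' ∈ cechBoundaries F 𝒰.U n) :
    cechClass F 𝒰 g hg = cechClass F 𝒰 g' hg' := by
  rw [← sub_eq_zero, ← cechClass_sub]
  exact cechClass_eq_zero _ h

/-- The class of a cocycle does not depend on the refinement by a pointed cover. -/
theorem cechClass_refine {ι : Type*} {U : ι → Set M} {ρ ρ' : M → ι} (hρ : ∀ k, 𝒰.U k ⊆ U (ρ k))
    (hρ' : ∀ k, 𝒱.U k ⊆ U (ρ' k)) {g : (Fin (n + 2) → ι) → M → A}
    (hg : g ∈ cechCocycles F U (n + 1)) :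
    cechClass F 𝒰 (fun i => g (ρ ∘ i)) (cechCocycles_comp F ρ hρ hg) =
      cechClass F 𝒱 (fun i => g (ρ' ∘ i)) (cechCocycles_comp F ρ' hρ' hg) := by
  rw [← cechClass_of_le (𝒰.le_inf_left 𝒱), ← cechClass_of_le (𝒰.le_inf_right 𝒱)]
  exact cechClass_eq_of_sub_mem _ _ (cechBoundaries_refine_sub F (W := (𝒰.inf 𝒱).U)
    (fun k => inter_subset_left.trans (hρ k)) (fun k => inter_subset_right.trans (hρ' k)) hg)

end CechClasses

/-! ### The connecting isomorphism -/

section Connecting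

open Set

/-- A correspondence between abelian groups which is the graph of an isomorphism. -/
theorem exists_addEquiv_of_rel {A B : Type*} [AddCommGroup A] [AddCommGroup B] {R : A → B → Prop}
    (hsub : ∀ {a a' b b'}, R a b → R a' b' → R (a - a') (b - b')) (htot : ∀ a, ∃ b, R a b)
    (hsurj : ∀ b, ∃ a, R a b) (hl : ∀ b, R 0 b → b = 0) (hr : ∀ a, R a 0 → a = 0) :
    ∃ e : A ≃+ B, ∀ a b, R a b → e a = b := by
  choose f hf using htot
  have huniq : ∀ {a b}, R a b → f a = b := fun {a b} h =>
    sub_eq_zero.1 (hl _ (by simpa using hsub (hf a) h))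
  have h0 : R 0 0 := by simpa using hsub (hf 0) (hf 0)
  have hadd : ∀ a a', f (a + a') = f a + f a' := fun a a' => huniq (by
    simpa using hsub (hf a) (hsub h0 (hf a')))
  let φ : A →+ B := AddMonoidHom.mk' f hadd
  refine ⟨AddEquiv.ofBijective φ ⟨(injective_iff_map_eq_zero φ).2 fun a ha => hr a ?_,
    fun b => ?_⟩, fun a b h => huniq h⟩
  · have := hf a
    rwa [show f a = 0 from ha] at this
  · obtain ⟨a, ha⟩ := hsurj b
    exact ⟨a, huniq ha⟩

variable {E : Type*} [NormedAddCommGroup E] [NormedSpace ℝ E] {M : Type u} [TopologicalSpace M]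
  [ChartedSpace E M]

open Classical in
noncomputable instance {p : ℕ} : AddCommGroup (CechH (smoothUnits 𝓘(ℝ, E) M) p) :=
  AddCommGroup.DirectLimit.addCommGroup _ _

/-- The correspondence between the classes of `exp(2πi h)` and `δh`, for cochains `h` of smooth
functions. -/
def ConnectingRel (E : Type*) [NormedAddCommGroup E] [NormedSpace ℝ E] {M : Type u}
    [TopologicalSpace M] [ChartedSpace E M] (p : ℕ) (κ : CechH (smoothUnits 𝓘(ℝ, E) M) p)
    (l : CechH (constInt M) (p + 1)) : Prop :=
  ∃ (𝒰 : PointedCover M) (g : (Fin (p + 1) → M) → M → Additive ℂˣ)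
    (hg : g ∈ cechCocycles (smoothUnits 𝓘(ℝ, E) M) 𝒰.U p)
    (h : (Fin (p + 1) → M) → M → ℂ) (n : (Fin (p + 2) → M) → M → ℤ)
    (hn : n ∈ cechCocycles (constInt M) 𝒰.U (p + 1)),
    (∀ i, h i ∈ (smoothFunctions 𝓘(ℝ, E) M).sections (⋂ k, 𝒰.U (i k))) ∧
    (∀ i, ∀ x ∈ ⋂ k, 𝒰.U (i k), expUnits (h i x) = g i x) ∧
    (∀ i, ∀ x ∈ ⋂ k, 𝒰.U (i k), (n i x : ℂ) = cechD h i x) ∧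
    cechClass _ 𝒰 g hg = κ ∧ cechClass _ 𝒰 n hn = l

theorem iInter_mono_of_le {𝒰 𝒱 : PointedCover M} (h : 𝒰 ≤ 𝒱) {m : ℕ} (i : Fin m → M) :
    (⋂ l, 𝒱.U (i l)) ⊆ ⋂ l, 𝒰.U (i l) :=
  iInter_mono fun l => h (i l)

theorem ConnectingRel.sub {p : ℕ} {κ κ' : CechH (smoothUnits 𝓘(ℝ, E) M) p}
    {l l' : CechH (constInt M) (p + 1)} (H : ConnectingRel E p κ l) (H' : ConnectingRel E p κ' l') :
    ConnectingRel E p (κ - κ') (l - l') := by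
  obtain ⟨𝒰, g, hg, h, n, hn, h1, h2, h3, rfl, rfl⟩ := H
  obtain ⟨𝒰', g', hg', h', n', hn', h1', h2', h3', rfl, rfl⟩ := H'
  have a := 𝒰.le_inf_left 𝒰'
  have a' := 𝒰.le_inf_right 𝒰'
  have s := fun {m : ℕ} => iInter_mono_of_le (m := m) a
  have s' := fun {m : ℕ} => iInter_mono_of_le (m := m) a'
  refine ⟨𝒰.inf 𝒰', g - g', sub_mem (cechCocycles_mono _ a _ hg) (cechCocycles_mono _ a' _ hg'),
    h - h', n - n', sub_mem (cechCocycles_mono _ a _ hn) (cechCocycles_mono _ a' _ hn'),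
    fun i => sub_mem ((smoothFunctions _ M).mono (s i) (h1 i))
      ((smoothFunctions _ M).mono (s' i) (h1' i)), fun i x hx => ?_, fun i x hx => ?_, ?_, ?_⟩
  · simp only [Pi.sub_apply]
    rw [map_sub, h2 i x (s i hx), h2' i x (s' i hx)]
  · have e : cechD (h - h') i x = cechD h i x - cechD h' i x :=
      congrFun (altD_sub (fun j => h j x) fun j => h' j x) i
    rw [e, ← h3 i x (s i hx), ← h3' i x (s' i hx)]
    simp
  · rw [← cechClass_of_le a hg, ← cechClass_of_le a' hg']
    exact cechClass_sub _ _
  · rw [← cechClass_of_le a hn, ← cechClass_of_le a' hn']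
    exact cechClass_sub _ _

variable [FiniteDimensional ℝ E] [T2Space M] [ParacompactSpace M] [IsManifold 𝓘(ℝ, E) ∞ M]

/-- After passing to a good refinement the cocycle has a smooth logarithm, whose coboundary is
integral. -/
theorem ConnectingRel.exists_right {p : ℕ} (κ : CechH (smoothUnits 𝓘(ℝ, E) M) (p + 1)) :
    ∃ l, ConnectingRel E (p + 1) κ l := by
  obtain ⟨𝒰, g, hg, rfl⟩ := exists_cechClass_eq κ
  obtain ⟨𝒲, r, hr, hW⟩ := exists_good_refinement E 𝒰.U 𝒰.isOpen fun x => ⟨x, 𝒰.mem x⟩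
  have hg' := cechCocycles_comp _ r hr hg
  obtain ⟨h, hh, hgh⟩ := exists_log_cochain 𝒲.isOpen hW hg'.1
  obtain ⟨n, hn, hnh⟩ := exists_integral_coboundary hg' hh hgh
  exact ⟨_, 𝒲, _, hg', h, n, hn, hh, hgh, hnh,
    cechClass_refine (ρ' := id) hr (fun _ => subset_rfl) hg, rfl⟩

/-- An integral cocycle is also a cocycle of smooth functions, hence a coboundary `δh` by a
partition of unity; it therefore corresponds to `exp(2πi h)`. -/
theorem ConnectingRel.exists_left {p : ℕ} (l : CechH (constInt M) (p + 1)) :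
    ∃ κ, ConnectingRel E p κ l := by
  obtain ⟨𝒰, n, hn, rfl⟩ := exists_cechClass_eq l
  obtain ⟨ρ, hρ⟩ := exists_smoothPartitionOfUnity E 𝒰.U 𝒰.isOpen fun x => ⟨x, 𝒰.mem x⟩
  have hc : (fun i x => (n i x : ℂ)) ∈
      cechCocycles (smoothFunctions 𝓘(ℝ, E) M) 𝒰.U (p + 1) := by
    refine ⟨fun i => contMDiffOn_intCast (isOpen_iInter_of_finite fun k => 𝒰.isOpen _) (hn.1 i),
      fun i x hx => ?_⟩
    refine (congrFun (altD_map (Int.castAddHom ℂ) fun j => n j x) i).trans ?_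
    rw [← cechD_apply, hn.2 i x hx, map_zero]
  obtain ⟨h, hh, hnh⟩ := cechBoundaries_of_partition 𝒰.isOpen ρ hρ hc
  refine ⟨_, 𝒰, fun i x => expUnits (h i x), ⟨fun i => contMDiffOn_expUnits (hh i),
    fun i x hx => ?_⟩, h, n, hn, hh, fun _ _ _ => rfl, hnh, rfl, rfl⟩
  rw [cechD_apply, congrFun (altD_map expUnits fun j => h j x) i]
  exact (expUnits_eq_zero_iff _).2 ⟨n i x, (hnh i x hx).symm⟩

/-- If `g = δb` on a finer cover, take a logarithm `k` of `b` on a good refinement. Then `h - δk` is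
integral, and its coboundary is `n` because `δδk = 0`. -/
theorem ConnectingRel.eq_zero_right {p : ℕ} {l : CechH (constInt M) (p + 2)}
    (H : ConnectingRel E (p + 1) 0 l) : l = 0 := by
  obtain ⟨𝒰, g, hg, h, n, hn, h1, h2, h3, h4, rfl⟩ := H
  obtain ⟨𝒱, hle, b, hb, hgb⟩ := exists_boundary_of_cechClass_eq_zero hg h4
  obtain ⟨𝒲, r, hr, hW⟩ := exists_good_refinement E 𝒱.U 𝒱.isOpen fun x => ⟨x, 𝒱.mem x⟩
  have s : ∀ {m : ℕ} (i : Fin m → M), (⋂ l, 𝒲.U (i l)) ⊆ ⋂ l, 𝒱.U ((r ∘ i) l) :=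
    fun i => iInter_mono fun l => hr (i l)
  have s' : ∀ {m : ℕ} (i : Fin m → M), (⋂ l, 𝒲.U (i l)) ⊆ ⋂ l, 𝒰.U ((r ∘ i) l) :=
    fun i => (s i).trans (iInter_mono_of_le hle _)
  obtain ⟨k, hk, hbk⟩ := exists_log_cochain 𝒲.isOpen hW (g := fun i => b (r ∘ i))
    fun i => (smoothUnits _ M).mono (s i) (hb _)
  refine (cechClass_refine (𝒱 := 𝒲) (ρ := id) (ρ' := r) (fun _ => subset_rfl)
    (fun x => (hr x).trans (hle _)) hn).trans (cechClass_eq_zero _ ?_)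
  have key : ∀ i, ∀ x ∈ ⋂ l, 𝒲.U (i l),
      ((round (h (r ∘ i) x - cechD k i x).re : ℤ) : ℂ) = h (r ∘ i) x - cechD k i x := by
    intro i x hx
    have e1 : expUnits (h (r ∘ i) x - cechD k i x) = 0 := by
      rw [map_sub, h2 _ x (s' i hx), hgb _ x (s i hx), sub_eq_zero, cechD_apply, cechD_apply,
        ← congrFun (altD_map expUnits fun j => k j x) i]
      exact (altD_congr (U := 𝒲.U) (fun j hj => hbk j x (mem_iInter.2 hj)) hx).symm
    obtain ⟨m, hm⟩ := (expUnits_eq_zero_iff _).1 e1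
    rw [hm]; simp
  refine ⟨fun i x => round (h (r ∘ i) x - cechD k i x).re, fun i => ?_, fun i x hx => ?_⟩
  · exact continuousOn_of_intCast ((((h1 (r ∘ i)).continuousOn.mono (s' i)).sub
      (contMDiffOn_cechD hk i).continuousOn).congr (key i))
  · have e1 := h3 (r ∘ i) x (s' i hx)
    have e2 : ((cechD (fun i x => round (h (r ∘ i) x - cechD k i x).re) i x : ℤ) : ℂ) =
        altD (fun j => ((round (h (r ∘ j) x - cechD k j x).re : ℤ) : ℂ)) i :=
      (congrFun (altD_map (Int.castAddHom ℂ) fun j => round (h (r ∘ j) x - cechD k j x).re) i).symm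
    rw [altD_congr (U := 𝒲.U) (fun j hj => key j x (mem_iInter.2 hj)) hx] at e2
    have e3 : altD (fun j => h (r ∘ j) x - cechD k j x) i =
        altD (fun j => h (r ∘ j) x) i - altD (fun j => cechD k j x) i :=
      congrFun (altD_sub (fun j => h (r ∘ j) x) fun j => cechD k j x) i
    have e4 : altD (fun j => cechD k j x) i = 0 := congrFun (altD_altD fun j => k j x) i
    rw [e3, e4, sub_zero] at e2
    have e5 : ((n (r ∘ i) x : ℤ) : ℂ) =
        ((cechD (fun i x => round (h (r ∘ i) x - cechD k i x).re) i x : ℤ) : ℂ) := e1.trans e2.symm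
    exact_mod_cast e5

/-- Once `n` bounds an integral cochain on a finer cover, the acyclicity of smooth functions makes
`g` a coboundary there. -/
theorem ConnectingRel.eq_zero_left {p : ℕ} {κ : CechH (smoothUnits 𝓘(ℝ, E) M) (p + 1)}
    (H : ConnectingRel E (p + 1) κ 0) : κ = 0 := by
  obtain ⟨𝒰, g, hg, h, n, hn, h1, h2, h3, rfl, h5⟩ := H
  obtain ⟨𝒱, hle, hb⟩ := exists_boundary_of_cechClass_eq_zero hn h5
  obtain ⟨ρ, hρ⟩ := exists_smoothPartitionOfUnity E 𝒱.U 𝒱.isOpen fun x => ⟨x, 𝒱.mem x⟩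
  rw [← cechClass_of_le hle]
  refine cechClass_eq_zero _ ?_
  have s := fun {m : ℕ} => iInter_mono_of_le (m := m) hle
  exact cechBoundaries_of_integral 𝒱.isOpen ρ hρ (h := h)
    (fun i => (smoothFunctions _ M).mono (s i) (h1 i)) (fun i x hx => h2 i x (s i hx))
    (fun i x hx => h3 i x (s i hx)) hb

-- Uniqueness holds because every class has a representative with a logarithm, and on such
-- representatives the connecting property prescribes the value.
variable (E M) in
theorem existsUnique_isConnecting :
    ∃! e : CechH (smoothUnits 𝓘(ℝ, E) M) 3 ≃+ CechH (constInt M) 4,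
      IsConnecting 𝓘(ℝ, E) (M := M) e := by
  obtain ⟨e, he⟩ := exists_addEquiv_of_rel (R := ConnectingRel E (M := M) 3)
    ConnectingRel.sub ConnectingRel.exists_right ConnectingRel.exists_left
    (fun _ => ConnectingRel.eq_zero_right) (fun _ => ConnectingRel.eq_zero_left)
  refine ⟨e, fun 𝒰 g hg h n hn h1 h2 h3 => he _ _ ⟨𝒰, g, hg, h, n, hn, h1,
    fun i x hx => (expUnits_eq_iff _ _).2 (h2 i x hx), h3, rfl, rfl⟩, fun e' he' => ?_⟩
  ext κ
  obtain ⟨l, hl⟩ := ConnectingRel.exists_right (E := E) κ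
  rw [he κ l hl]
  obtain ⟨𝒰, g, hg, h, n, hn, h1, h2, h3, rfl, rfl⟩ := hl
  exact he' 𝒰 g hg h n hn h1 (fun i x hx => (expUnits_eq_iff _ _).1 (h2 i x hx)) h3

end Connecting

/-! ### Independence of the choices -/

section Independence

open Set TopologicalSpace

theorem cechD_toCochain {M ι : Type*} (g : ι → ι → ι → ι → M → ℂˣ) (i : Fin 5 → ι) (x : M) :
    cechD (toCochain g) i x = Additive.ofMul (g (i 1) (i 2) (i 3) (i 4) x *
      (g (i 0) (i 2) (i 3) (i 4) x)⁻¹ * g (i 0) (i 1) (i 3) (i 4) x *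
      (g (i 0) (i 1) (i 2) (i 4) x)⁻¹ * g (i 0) (i 1) (i 2) (i 3) x) := by
  have : cechD (toCochain g) i x =
      (-1 : ℤ) ^ 0 • Additive.ofMul (g (i 1) (i 2) (i 3) (i 4) x) +
      (-1 : ℤ) ^ 1 • Additive.ofMul (g (i 0) (i 2) (i 3) (i 4) x) +
      (-1 : ℤ) ^ 2 • Additive.ofMul (g (i 0) (i 1) (i 3) (i 4) x) +
      (-1 : ℤ) ^ 3 • Additive.ofMul (g (i 0) (i 1) (i 2) (i 4) x) +
      (-1 : ℤ) ^ 4 • Additive.ofMul (g (i 0) (i 1) (i 2) (i 3) x) := by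
    rw [cechD, Fin.sum_univ_five]; rfl
  rw [this]
  simp [pow_succ]

/-- The restriction of a bundle to a smaller set. -/
def CstarBundle.restrict {E : Type*} [NormedAddCommGroup E] [NormedSpace ℝ E]
    {H : Type*} [TopologicalSpace H] {I : ModelWithCorners ℝ E H} {N : Type*} [TopologicalSpace N]
    [ChartedSpace H N] {S S' : Set N} (P : CstarBundle.{w} I S) (h : S' ⊆ S) :
    CstarBundle.{w} I S' where
  Fib := P.Fib
  torsor := P.torsor
  frames := P.frames
  frames_nhds f hf b hb := nhdsWithin_mono _ h (P.frames_nhds f hf b ⟨hb.1, h hb.2⟩)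
  frames_cover b hb := P.frames_cover b (h hb)
  frames_compat f hf g hg := (P.frames_compat f hf g hg).mono (inter_subset_inter_right _ h)

/-- The restriction of a trivialisation to a smaller set. -/
def BundleGerbe.Trivialisation.restrict {EN : Type*} [NormedAddCommGroup EN] [NormedSpace ℝ EN]
    {HN : Type*} [TopologicalSpace HN] {EY : Type*} [NormedAddCommGroup EY] [NormedSpace ℝ EY]
    {HY : Type*} [TopologicalSpace HY] {IN : ModelWithCorners ℝ EN HN} {N : Type*}
    [TopologicalSpace N] [ChartedSpace HN N] {B : Set N} {IY : ModelWithCorners ℝ EY HY} {Y : Type*}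
    [TopologicalSpace Y] [ChartedSpace HY Y] {G : BundleGerbe.{w} IN B IY Y} {T T' : Set Y}
    (t : G.Trivialisation T) (h : T' ⊆ T) : G.Trivialisation T' where
  L := t.L.restrict h
  φ := t.φ
  φ_smul hy hy' := t.φ_smul (h hy) (h hy')
  φ_smooth f hf g hg := (t.φ_smooth f hf g hg).mono fun _ hz =>
    ⟨h hz.1, h hz.2.1, hz.2.2⟩
  φ_mul h₁ h₂ h₃ := t.φ_mul (h h₁) (h h₂) (h h₃)

namespace Bundle2Gerbe

section Cocycles

variable {EM : Type*} [NormedAddCommGroup EM] [NormedSpace ℝ EM] {HM : Type*} [TopologicalSpace HM]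
  {EX : Type*} [NormedAddCommGroup EX] [NormedSpace ℝ EX] {HX : Type*} [TopologicalSpace HX]
  {EY : Type*} [NormedAddCommGroup EY] [NormedSpace ℝ EY] {HY : Type*} [TopologicalSpace HY]
  {IM : ModelWithCorners ℝ EM HM} {M : Type u} [TopologicalSpace M] [ChartedSpace HM M]
  {IX : ModelWithCorners ℝ EX HX} {X : Type uX} [TopologicalSpace X] [ChartedSpace HX X]
  {IY : ModelWithCorners ℝ EY HY} {Y : Type uY} [TopologicalSpace Y] [ChartedSpace HY Y]
  {𝒢 : Bundle2Gerbe.{u, uX, uY, w} IM M IX X IY Y}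

theorem Choices.Represents.mem_cechCocycles {C : 𝒢.Choices}
    {g : C.c.ι → C.c.ι → C.c.ι → C.c.ι → M → ℂˣ} (h : C.Represents g) :
    toCochain g ∈ cechCocycles (smoothUnits IM M) C.c.U 3 := by
  refine ⟨fun i => (h.smooth (i 0) (i 1) (i 2) (i 3)).mono fun x hx => ?_, fun i x hx => ?_⟩
  · rw [mem_iInter] at hx
    exact ⟨⟨⟨hx 0, hx 1⟩, hx 2⟩, hx 3⟩
  · rw [mem_iInter] at hx
    rw [cechD_toCochain, h.cocycle ⟨⟨⟨⟨hx 0, hx 1⟩, hx 2⟩, hx 3⟩, hx 4⟩, ofMul_one]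

variable (C C' : 𝒢.Choices) (𝒲 : PointedCover M) (hW : IsGoodFamily 𝒲.U) {ρ : M → C.c.ι}
  {ρ' : M → C'.c.ι} (hρ : ∀ x, 𝒲.U x ⊆ C.c.U (ρ x)) (hρ' : ∀ x, 𝒲.U x ⊆ C'.c.U (ρ' x))

/-- Two copies of a common refinement of two good covers. -/
def joinCover : 𝒢.GoodCover where
  ι := M ⊕ M
  U i := 𝒲.U (i.elim id id)
  isOpen _ := 𝒲.isOpen _
  cover x := ⟨Sum.inl x, 𝒲.mem x⟩
  good n i := hW n fun k => (i k).elim id id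
  s := Sum.elim (fun x => C.c.s (ρ x)) fun x => C'.c.s (ρ' x)
  s_smooth
    | .inl x => (C.c.s_smooth _).mono (hρ x)
    | .inr x => (C'.c.s_smooth _).mono (hρ' x)
  s_section
    | .inl x => fun y hy => C.c.s_section _ y (hρ x hy)
    | .inr x => fun y hy => C'.c.s_section _ y (hρ' x hy)

variable {C C' 𝒲 hW hρ hρ'}

theorem over_of_join_inl {a b : M} {x : M} {y : Y}
    (h : (joinCover C C' 𝒲 hW hρ hρ').Over (.inl a) (.inl b) x y) : C.c.Over (ρ a) (ρ b) x y :=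
  ⟨hρ a h.1, hρ b h.2.1, h.2.2⟩

theorem over_of_join_inr {a b : M} {x : M} {y : Y}
    (h : (joinCover C C' 𝒲 hW hρ hρ').Over (.inr a) (.inr b) x y) : C'.c.Over (ρ' a) (ρ' b) x y :=
  ⟨hρ' a h.1, hρ' b h.2.1, h.2.2⟩

end Cocycles

variable {EM : Type*} [NormedAddCommGroup EM] [NormedSpace ℝ EM] [FiniteDimensional ℝ EM]
  {M : Type u} [TopologicalSpace M] [T2Space M] [ParacompactSpace M] [ChartedSpace EM M]
  [IsManifold 𝓘(ℝ, EM) ∞ M]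
  {EX : Type*} [NormedAddCommGroup EX] [NormedSpace ℝ EX] {HX : Type*} [TopologicalSpace HX]
  {EY : Type*} [NormedAddCommGroup EY] [NormedSpace ℝ EY] {HY : Type*} [TopologicalSpace HY]
  {IX : ModelWithCorners ℝ EX HX} {X : Type uX} [TopologicalSpace X] [ChartedSpace HX X]
  {IY : ModelWithCorners ℝ EY HY} {Y : Type uY} [TopologicalSpace Y] [ChartedSpace HY Y]
  {𝒢 : Bundle2Gerbe.{u, uX, uY, w} 𝓘(ℝ, EM) M IX X IY Y}

variable (𝒢) in
theorem nonempty_choices : Nonempty 𝒢.Choices := by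
  obtain ⟨c⟩ := nonempty_goodCover 𝒢
  obtain ⟨t⟩ := nonempty_trivs c
  choose σ hσ using fun i j k => (nonempty_descended c t i j k).some.exists_section
  exact ⟨⟨c, t, _, σ, hσ⟩⟩

section Join

variable (C C' : 𝒢.Choices) (𝒲 : PointedCover M) (hW : IsGoodFamily 𝒲.U) {ρ : M → C.c.ι}
  {ρ' : M → C'.c.ι} (hρ : ∀ x, 𝒲.U x ⊆ C.c.U (ρ x)) (hρ' : ∀ x, 𝒲.U x ⊆ C'.c.U (ρ' x))

/-- The given trivialisations over the two copies, and arbitrary ones over the mixed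
intersections. -/
noncomputable def joinTrivs : (joinCover C C' 𝒲 hW hρ hρ').Trivs
  | .inl a, .inl b => (C.t (ρ a) (ρ b)).restrict fun _ ⟨x, h⟩ => ⟨x, over_of_join_inl h⟩
  | .inr a, .inr b => (C'.t (ρ' a) (ρ' b)).restrict fun _ ⟨x, h⟩ => ⟨x, over_of_join_inr h⟩
  | .inl a, .inr b => (nonempty_trivialisation (joinCover C C' 𝒲 hW hρ hρ') (Sum.inl a) (Sum.inr b)).some
  | .inr a, .inl b => (nonempty_trivialisation (joinCover C C' 𝒲 hW hρ hρ') (Sum.inr a) (Sum.inl b)).some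

/-- The given descended bundles over the two copies, and arbitrary ones over the mixed
intersections. -/
noncomputable def joinDescended : ∀ i j k,
    Descended (joinCover C C' 𝒲 hW hρ hρ') (joinTrivs C C' 𝒲 hW hρ hρ') i j k
  | .inl a, .inl b, .inl c =>
    { L := (C.d (ρ a) (ρ b) (ρ c)).L.restrict
        (inter_subset_inter (inter_subset_inter (hρ a) (hρ b)) (hρ c))
      D := (C.d (ρ a) (ρ b) (ρ c)).D
      D_smul := fun h h' => (C.d (ρ a) (ρ b) (ρ c)).D_smul (over_of_join_inl h) (over_of_join_inl h')
      D_smooth := fun f hf g hg h hh =>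
        ((C.d (ρ a) (ρ b) (ρ c)).D_smooth f hf g hg h hh).mono fun _ ⟨⟨x, o, o'⟩, hz⟩ =>
          ⟨⟨x, over_of_join_inl o, over_of_join_inl o'⟩, hz⟩
      D_descent := fun h₁ h₂ h₃ h₄ => (C.d (ρ a) (ρ b) (ρ c)).D_descent (over_of_join_inl h₁)
        (over_of_join_inl h₂) (over_of_join_inl h₃) (over_of_join_inl h₄) }
  | .inr a, .inr b, .inr c =>
    { L := (C'.d (ρ' a) (ρ' b) (ρ' c)).L.restrict
        (inter_subset_inter (inter_subset_inter (hρ' a) (hρ' b)) (hρ' c))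
      D := (C'.d (ρ' a) (ρ' b) (ρ' c)).D
      D_smul := fun h h' =>
        (C'.d (ρ' a) (ρ' b) (ρ' c)).D_smul (over_of_join_inr h) (over_of_join_inr h')
      D_smooth := fun f hf g hg h hh =>
        ((C'.d (ρ' a) (ρ' b) (ρ' c)).D_smooth f hf g hg h hh).mono fun _ ⟨⟨x, o, o'⟩, hz⟩ =>
          ⟨⟨x, over_of_join_inr o, over_of_join_inr o'⟩, hz⟩
      D_descent := fun h₁ h₂ h₃ h₄ => (C'.d (ρ' a) (ρ' b) (ρ' c)).D_descent (over_of_join_inr h₁)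
        (over_of_join_inr h₂) (over_of_join_inr h₃) (over_of_join_inr h₄) }
  | i, j, k => (nonempty_descended _ _ i j k).some

/-- The given sections over the two copies, and arbitrary ones over the mixed intersections. -/
noncomputable def joinSection : ∀ i j k x, (joinDescended C C' 𝒲 hW hρ hρ' i j k).L.Fib x
  | .inl a, .inl b, .inl c => C.σ (ρ a) (ρ b) (ρ c)
  | .inr a, .inr b, .inr c => C'.σ (ρ' a) (ρ' b) (ρ' c)
  | i, j, k => (joinDescended C C' 𝒲 hW hρ hρ' i j k).exists_section.choose

/-- Choices which restrict to given choices over two copies of a common refinement. -/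
noncomputable def joinChoices : 𝒢.Choices where
  c := joinCover C C' 𝒲 hW hρ hρ'
  t := joinTrivs C C' 𝒲 hW hρ hρ'
  d := joinDescended C C' 𝒲 hW hρ hρ'
  σ := joinSection C C' 𝒲 hW hρ hρ'
  σ_smooth := by
    rintro (a | a) (b | b) (c | c)
    · exact (C.σ_smooth (ρ a) (ρ b) (ρ c)).mono
        (inter_subset_inter (inter_subset_inter (hρ a) (hρ b)) (hρ c))
    · exact (joinDescended C C' 𝒲 hW hρ hρ' _ _ _).exists_section.choose_spec
    · exact (joinDescended C C' 𝒲 hW hρ hρ' _ _ _).exists_section.choose_spec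
    · exact (joinDescended C C' 𝒲 hW hρ hρ' _ _ _).exists_section.choose_spec
    · exact (joinDescended C C' 𝒲 hW hρ hρ' _ _ _).exists_section.choose_spec
    · exact (joinDescended C C' 𝒲 hW hρ hρ' _ _ _).exists_section.choose_spec
    · exact (joinDescended C C' 𝒲 hW hρ hρ' _ _ _).exists_section.choose_spec
    · exact (C'.σ_smooth (ρ' a) (ρ' b) (ρ' c)).mono
        (inter_subset_inter (inter_subset_inter (hρ' a) (hρ' b)) (hρ' c))

variable {C C' 𝒲 hW hρ hρ'}

/-- On the first copy the joined choices are restrictions of those of `C`, with the same fibres and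
maps, so both functions are given by the same expression. -/
theorem Choices.Represents.join_inl {g : C.c.ι → C.c.ι → C.c.ι → C.c.ι → M → ℂˣ}
    (h : C.Represents g) {G : M ⊕ M → M ⊕ M → M ⊕ M → M ⊕ M → M → ℂˣ}
    (hG : (joinChoices C C' 𝒲 hW hρ hρ').Represents G) {i : Fin 4 → M} {x : M}
    (hx : x ∈ ⋂ k, 𝒲.U (i k)) : toCochain g (ρ ∘ i) x = toCochain G (Sum.inl ∘ i) x := by
  rw [mem_iInter] at hx
  let c := joinCover C C' 𝒲 hW hρ hρ'
  obtain ⟨y₁₂, h₁₂⟩ := c.exists_over (i := .inl (i 0)) (j := .inl (i 1)) (hx 0) (hx 1)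
  obtain ⟨y₂₃, h₂₃⟩ := c.exists_over (i := .inl (i 1)) (j := .inl (i 2)) (hx 1) (hx 2)
  obtain ⟨y₃₄, h₃₄⟩ := c.exists_over (i := .inl (i 2)) (j := .inl (i 3)) (hx 2) (hx 3)
  have e := h (ρ (i 0)) (ρ (i 1)) (ρ (i 2)) (ρ (i 3)) x y₃₄ y₂₃ y₁₂ (over_of_join_inl h₃₄)
    (over_of_join_inl h₂₃) (over_of_join_inl h₁₂) (Classical.arbitrary _) (Classical.arbitrary _)
    (Classical.arbitrary _) (Classical.arbitrary _) (Classical.arbitrary _) (Classical.arbitrary _)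
    (Classical.arbitrary _)
  -- The fibre elements are named through `C.t` so that they are literally those used in `e`; the
  -- two fibre types agree by unfolding the joined choices.
  have e' := hG (.inl (i 0)) (.inl (i 1)) (.inl (i 2)) (.inl (i 3)) x y₃₄ y₂₃ y₁₂ h₃₄ h₂₃ h₁₂
    (Classical.arbitrary ((C.t _ _).L.Fib _)) (Classical.arbitrary ((C.t _ _).L.Fib _))
    (Classical.arbitrary ((C.t _ _).L.Fib _)) (Classical.arbitrary ((C.t _ _).L.Fib _))
    (Classical.arbitrary ((C.t _ _).L.Fib _)) (Classical.arbitrary ((C.t _ _).L.Fib _))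
    (Classical.arbitrary ((C.t _ _).L.Fib _))
  exact congrArg Additive.ofMul (e.symm.trans e')

theorem Choices.Represents.join_inr {g : C'.c.ι → C'.c.ι → C'.c.ι → C'.c.ι → M → ℂˣ}
    (h : C'.Represents g) {G : M ⊕ M → M ⊕ M → M ⊕ M → M ⊕ M → M → ℂˣ}
    (hG : (joinChoices C C' 𝒲 hW hρ hρ').Represents G) {i : Fin 4 → M} {x : M}
    (hx : x ∈ ⋂ k, 𝒲.U (i k)) : toCochain g (ρ' ∘ i) x = toCochain G (Sum.inr ∘ i) x := by
  rw [mem_iInter] at hx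
  let c := joinCover C C' 𝒲 hW hρ hρ'
  obtain ⟨y₁₂, h₁₂⟩ := c.exists_over (i := .inr (i 0)) (j := .inr (i 1)) (hx 0) (hx 1)
  obtain ⟨y₂₃, h₂₃⟩ := c.exists_over (i := .inr (i 1)) (j := .inr (i 2)) (hx 1) (hx 2)
  obtain ⟨y₃₄, h₃₄⟩ := c.exists_over (i := .inr (i 2)) (j := .inr (i 3)) (hx 2) (hx 3)
  have e := h (ρ' (i 0)) (ρ' (i 1)) (ρ' (i 2)) (ρ' (i 3)) x y₃₄ y₂₃ y₁₂ (over_of_join_inr h₃₄)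
    (over_of_join_inr h₂₃) (over_of_join_inr h₁₂) (Classical.arbitrary _) (Classical.arbitrary _)
    (Classical.arbitrary _) (Classical.arbitrary _) (Classical.arbitrary _) (Classical.arbitrary _)
    (Classical.arbitrary _)
  have e' := hG (.inr (i 0)) (.inr (i 1)) (.inr (i 2)) (.inr (i 3)) x y₃₄ y₂₃ y₁₂ h₃₄ h₂₃ h₁₂
    (Classical.arbitrary ((C'.t _ _).L.Fib _)) (Classical.arbitrary ((C'.t _ _).L.Fib _))
    (Classical.arbitrary ((C'.t _ _).L.Fib _)) (Classical.arbitrary ((C'.t _ _).L.Fib _))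
    (Classical.arbitrary ((C'.t _ _).L.Fib _)) (Classical.arbitrary ((C'.t _ _).L.Fib _))
    (Classical.arbitrary ((C'.t _ _).L.Fib _))
  exact congrArg Additive.ofMul (e.symm.trans e')

end Join

/-- The class of the cocycle is independent of all choices. -/
theorem Choices.Represents.cechClass_eq {C C' : 𝒢.Choices}
    {g : C.c.ι → C.c.ι → C.c.ι → C.c.ι → M → ℂˣ} (h : C.Represents g)
    {g' : C'.c.ι → C'.c.ι → C'.c.ι → C'.c.ι → M → ℂˣ} (h' : C'.Represents g')
    (r : M → C.c.ι) (hr : ∀ x, x ∈ C.c.U (r x)) (r' : M → C'.c.ι) (hr' : ∀ x, x ∈ C'.c.U (r' x)) :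
    cechClass (smoothUnits 𝓘(ℝ, EM) M) (PointedCover.ofIndex C.c.U C.c.isOpen r hr)
        (fun i => toCochain g (r ∘ i))
        (cechCocycles_pullback _ C.c.isOpen r hr h.mem_cechCocycles) =
      cechClass (smoothUnits 𝓘(ℝ, EM) M) (PointedCover.ofIndex C'.c.U C'.c.isOpen r' hr')
        (fun i => toCochain g' (r' ∘ i))
        (cechCocycles_pullback _ C'.c.isOpen r' hr' h'.mem_cechCocycles) := by
  -- The cover by pairwise intersections is indexed by pairs, so one refinement map `s` yields
  -- refinement maps to both given covers.
  obtain ⟨𝒲, s, hs, hW⟩ := exists_good_refinement EM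
    (fun p : C.c.ι × C'.c.ι => C.c.U p.1 ∩ C'.c.U p.2)
    (fun p => (C.c.isOpen _).inter (C'.c.isOpen _)) fun x => ⟨(r x, r' x), hr x, hr' x⟩
  have hρ : ∀ x, 𝒲.U x ⊆ C.c.U (s x).1 := fun x => (hs x).trans inter_subset_left
  have hρ' : ∀ x, 𝒲.U x ⊆ C'.c.U (s x).2 := fun x => (hs x).trans inter_subset_right
  obtain ⟨G, hG⟩ := (joinChoices C C' 𝒲 hW hρ hρ').exists_represents
  have e := cechClass_refine (𝒰 := PointedCover.ofIndex C.c.U C.c.isOpen r hr) (𝒱 := 𝒲) (ρ := r)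
    (fun _ => subset_rfl) hρ h.mem_cechCocycles
  have e' := cechClass_refine (𝒰 := PointedCover.ofIndex C'.c.U C'.c.isOpen r' hr') (𝒱 := 𝒲)
    (ρ := r') (fun _ => subset_rfl) hρ' h'.mem_cechCocycles
  refine e.trans (Eq.trans ?_ e'.symm)
  -- The inclusions of `M` as the two halves of `M ⊕ M` are both refinement maps from `𝒲` to the
  -- doubled cover, so they pull `G` back to cohomologous cocycles; these are the two given ones.
  refine cechClass_eq_of_sub_mem _ _ (cechBoundaries_congr _ (cechBoundaries_refine_sub
    (smoothUnits 𝓘(ℝ, EM) M) (W := 𝒲.U) (ρ := Sum.inl) (ρ' := Sum.inr) (fun _ => subset_rfl)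
    (fun _ => subset_rfl) hG.mem_cechCocycles) fun i x hx => ?_)
  exact congrArg₂ (· - ·) (h.join_inl hG hx) (h'.join_inr hG hx)

end Bundle2Gerbe

end Independence

/-! ### The main theorem -/

theorem proposition9p1
    {EM : Type*} [NormedAddCommGroup EM] [NormedSpace ℝ EM] [FiniteDimensional ℝ EM]
    {M : Type u} [TopologicalSpace M] [T2Space M] [ParacompactSpace M]
    [ChartedSpace EM M] [IsManifold 𝓘(ℝ, EM) ∞ M]
    {EX : Type*} [NormedAddCommGroup EX] [NormedSpace ℝ EX]
    {X : Type uX} [TopologicalSpace X] [ChartedSpace EX X] [IsManifold 𝓘(ℝ, EX) ∞ X]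
    {EY : Type*} [NormedAddCommGroup EY] [NormedSpace ℝ EY]
    {Y : Type uY} [TopologicalSpace Y] [ChartedSpace EY Y] [IsManifold 𝓘(ℝ, EY) ∞ Y]
    (𝒢 : Bundle2Gerbe.{u, uX, uY, w} 𝓘(ℝ, EM) M 𝓘(ℝ, EX) X 𝓘(ℝ, EY) Y) :
    -- the choices can be made, one after the other
    Nonempty 𝒢.GoodCover ∧
    (∀ c : 𝒢.GoodCover, Nonempty c.Trivs) ∧
    (∀ (c : 𝒢.GoodCover) (t : c.Trivs) (i j k : c.ι),
      Nonempty (Bundle2Gerbe.Descended c t i j k)) ∧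
    (∀ (c : 𝒢.GoodCover) (t : c.Trivs) (i j k : c.ι) (d : Bundle2Gerbe.Descended c t i j k),
      ∃ σ : ∀ x, d.L.Fib x, d.L.SmoothOn σ (c.U i ∩ c.U j ∩ c.U k)) ∧
    -- they determine smooth functions `g_ijkl` on `U_ijkl`, which satisfy the cocycle condition
    (∀ C : 𝒢.Choices, ∃ g : C.c.ι → C.c.ι → C.c.ι → C.c.ι → M → ℂˣ, C.Represents g) ∧
    (∀ (C : 𝒢.Choices) (g : C.c.ι → C.c.ι → C.c.ι → C.c.ι → M → ℂˣ), C.Represents g →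
      (∀ g', C.Represents g' → ∀ i j k l, ∀ x ∈ C.c.U i ∩ C.c.U j ∩ C.c.U k ∩ C.c.U l,
        g' i j k l x = g i j k l x) ∧
      (∀ i j k l, ContMDiffOn 𝓘(ℝ, EM) 𝓘(ℝ, ℂ) ∞ (fun x => (g i j k l x : ℂ))
        (C.c.U i ∩ C.c.U j ∩ C.c.U k ∩ C.c.U l)) ∧
      (∀ i j k l m, ∀ x ∈ C.c.U i ∩ C.c.U j ∩ C.c.U k ∩ C.c.U l ∩ C.c.U m,
        g j k l m x * (g i k l m x)⁻¹ * g i j l m x * (g i j k m x)⁻¹ * g i j k l x = 1)) ∧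
    -- the class in Čech cohomology does not depend on any of the choices
    (∃! κ : CechH (smoothUnits 𝓘(ℝ, EM) M) 3,
      ∀ (C : 𝒢.Choices) (g : C.c.ι → C.c.ι → C.c.ι → C.c.ι → M → ℂˣ), C.Represents g →
        ∃ hg : toCochain g ∈ cechCocycles (smoothUnits 𝓘(ℝ, EM) M) C.c.U 3,
          ∀ (r : M → C.c.ι) (hr : ∀ x, x ∈ C.c.U (r x)),
            cechClass (smoothUnits 𝓘(ℝ, EM) M) (PointedCover.ofIndex C.c.U C.c.isOpen r hr)
              (fun i => toCochain g (r ∘ i))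
              (cechCocycles_pullback _ C.c.isOpen r hr hg) = κ) ∧
    -- `Ȟ³(M; ℂˣ)` is isomorphic to `H⁴(M; ℤ)` by the connecting homomorphism
    (∃! e : CechH (smoothUnits 𝓘(ℝ, EM) M) 3 ≃+ CechH (constInt M) 4,
      IsConnecting 𝓘(ℝ, EM) e) := by
  refine ⟨Bundle2Gerbe.nonempty_goodCover 𝒢, Bundle2Gerbe.nonempty_trivs,
    Bundle2Gerbe.nonempty_descended, fun _ _ _ _ _ d => d.exists_section,
    fun C => C.exists_represents, fun C g hg => ⟨fun g' hg' i j k l x hx => hg.eq hg' hx,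
      hg.smooth, fun i j k l m x hx => hg.cocycle hx⟩, ?_, existsUnique_isConnecting EM M⟩
  -- The class is that of one fixed set of choices and one fixed index map; the existence of such
  -- choices is also what makes it unique.
  obtain ⟨C₀⟩ := Bundle2Gerbe.nonempty_choices 𝒢
  obtain ⟨g₀, hg₀⟩ := C₀.exists_represents
  choose r₀ hr₀ using C₀.c.cover
  refine ⟨_, fun C g hg => ⟨hg.mem_cechCocycles, fun r hr => hg.cechClass_eq hg₀ r hr r₀ hr₀⟩,
    fun κ hκ => ?_⟩
  obtain ⟨_, h⟩ := hκ C₀ g₀ hg₀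
  exact (h r₀ hr₀).symm
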